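/- Let $\Bbbk$ be a field and let $\iota\colon K\to H$ be a morphism of Hopf algebras over $\Bbbk$, both with invertible antipode. Assume that $H$ is finitely generated and projective as a left $K$-module (via $\iota$) and that there is an algebra map $\pi\colon H\to K$ with $\pi\iota=\mathrm{id}_K$. Notation. For a Hopf algebra $H$, $H\text{-}\mathrm{Mod}$ is the monoidal category of all left $H$-modules. ${}^H_H\mathcal{YD}$ is the braided monoidal category of Yetter–Drinfeld modules: left $H$-modules $V$ with a left $H$-coaction $v\mapsto v^{(-1)}\otimes v^{(0)}$ such that $h_{(1)}v^{(-1)}\otimes h_{(2)}v^{(0)}=(h_{(1)}v)^{(-1)}h_{(2)}\otimes (h_{(1)}v)^{(0)}$, with tensor product carrying the diagonal action and the coaction $v\otimes w\mapsto v^{(-1)}w^{(-1)}\otimes v^{(0)}\otimes w^{(0)}$, and with braiding $v\otimes w\mapsto v^{(-1)}w\otimes v^{(0)}$; this braiding identifies it with the Drinfeld center $\mathcal Z(H\text{-}\mathrm{Mod})$. The restriction functor $G=\mathrm{Res}\colon H\text{-}\mathrm{Mod}\to K\text{-}\mathrm{Mod}$ is strong monoidal; its right adjoint $R=\mathrm{CoInd}=\mathrm{Hom}_K(H,-)$,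 with action $(h\cdot f)(g)=f(gh)$, is lax monoidal via $f\otimes g\mapsto (h\mapsto f(h_{(1)})\otimes g(h_{(2)}))$. The canonical maps $A\otimes R(V)\to R(G(A)\otimes V)$ and $R(V)\otimes A\to R(V\otimes G(A))$ are isomorphisms, and $\mathcal Z(\mathrm{CoInd})\colon \mathcal Z(K\text{-}\mathrm{Mod})\to\mathcal Z(H\text{-}\mathrm{Mod})$, that is, ${}^K_K\mathcal{YD}\to{}^H_H\mathcal{YD}$, is the braided lax monoidal functor sending $(V,c)$ to $R(V)$ with the half-braiding $$R(V)\otimes A\cong R(V\otimes G(A))\xrightarrow{R(c_{G(A)})}R(G(A)\otimes V)\cong A\otimes R(V).$$ Let $A_{H|K}=\mathcal Z(\mathrm{CoInd})(\mathbb 1)$, a commutative algebra in ${}^H_H\mathcal{YD}$ with underlying $H$-module $\mathrm{CoInd}(\Bbbk)$. Let $T_{A_{H|K}}=(-)\otimes A_{H|K}$ be the associated monad on $H\text{-}\mathrm{Mod}$; it is a monoidal monad through the half-braiding of $A_{H|K}$, so its Kleisli category is monoidal. The category $\mathrm{Mod}_{H\text{-}\mathrm{Mod}}(A_{H|K})$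 of right $A_{H|K}$-modules in $H\text{-}\mathrm{Mod}$ is monoidal under $\otimes_{A_{H|K}}$, where the left action on a right module is obtained from the half-braiding of $A_{H|K}$. A right $A$-module $(X,a)$ in a braided category is local if $a\circ c_{A,X}\circ c_{X,A}=a$; the local $A_{H|K}$-modules in ${}^H_H\mathcal{YD}$ form a braided monoidal category $\mathrm{Mod}^{\mathrm{loc}}_{{}^H_H\mathcal{YD}}(A_{H|K})$ under $\otimes_{A_{H|K}}$. Then: 1. There are equivalences of monoidal categories $$\mathrm{Kleisli}(T_{A_{H|K}})\simeq K\text{-}\mathrm{Mod}\simeq \mathrm{Mod}_{H\text{-}\mathrm{Mod}}(A_{H|K}).$$ The first one, composed with the free functor $H\text{-}\mathrm{Mod}\to\mathrm{Kleisli}(T_{A_{H|K}})$, is isomorphic to $\mathrm{Res}$ as a monoidal functor; the second one, $E$, composed with the forgetful functor $\mathrm{Mod}_{H\text{-}\mathrm{Mod}}(A_{H|K})\to H\text{-}\mathrm{Mod}$, is isomorphic to $\mathrm{CoInd}$ as a lax monoidal functor; their composite is isomorphic to the comparison functor that sends $X$ to the free module $X\otimes A_{H|K}$. 2. $\mathcal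 Z(K\text{-}\mathrm{Mod})\simeq{}^K_K\mathcal{YD}$, and the equivalences of Part 1 induce an equivalence of braided monoidal categories $$\Phi\colon{}^K_K\mathcal{YD}\simeq\mathrm{Mod}^{\mathrm{loc}}_{{}^H_H\mathcal{YD}}(A_{H|K}),$$ that is, the right $A_{H|K}$-module in $H\text{-}\mathrm{Mod}$ underlying $\Phi(V)$ is naturally isomorphic to $E(V)$. 3. Under $\Phi$, the functor $\mathcal Z(\mathrm{CoInd})$ corresponds to the forgetful functor $\mathrm{Forg}^{\mathrm{loc}}\colon\mathrm{Mod}^{\mathrm{loc}}_{{}^H_H\mathcal{YD}}(A_{H|K})\to{}^H_H\mathcal{YD}$: there is an isomorphism of lax monoidal functors $\mathrm{Forg}^{\mathrm{loc}}\circ\Phi\cong\mathcal Z(\mathrm{CoInd})$, compatible on underlying $H$-modules with the isomorphisms in Parts 1 and 2. -/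

import Mathlib

open CategoryTheory MonoidalCategory Limits
open scoped TensorProduct

universe u v v₁ v₂ u₁ u₂

set_option linter.unusedSectionVars false

noncomputable section

namespace HopfCat

/-! ## Left modules over a bialgebra, as a monoidal category -/

section Strict

theorem strict_aux₁ {C : Type*} [Category* C] {X Y : C} (f : X ⟶ Y) : f = (Iso.refl X).inv ≫ f ≫ (Iso.refl Y).hom := by
  simp

variable {C : Type*} [Category* C] [MonoidalCategory C]

theorem strict_aux₂ (X Y Z : C) : (α_ X Y Z).hom =
    (((Iso.refl ((X ⊗ Y) ⊗ Z)).symm ≪≫ ((Iso.refl (X ⊗ Y)).symm ⊗ᵢ .refl Z)) ≪≫ α_ X Y Z ≪≫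
      ((.refl X ⊗ᵢ Iso.refl (Y ⊗ Z)) ≪≫ Iso.refl (X ⊗ Y ⊗ Z))).hom := by simp

theorem strict_aux₃ (X : C) : (λ_ X).hom =
    (((Iso.refl (𝟙_ C ⊗ X)).symm ≪≫ ((Iso.refl (𝟙_ C)).symm ⊗ᵢ .refl X)) ≪≫ λ_ X).hom := by simp

theorem strict_aux₄ (X : C) : (ρ_ X).hom =
    (((Iso.refl (X ⊗ 𝟙_ C)).symm ≪≫ (.refl X ⊗ᵢ (Iso.refl (𝟙_ C)).symm)) ≪≫ ρ_ X).hom := by simp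

end Strict

section Raw

variable {k A B C V W X V' W' : Type*} [CommRing k] [Ring A] [Algebra k A] [Ring B] [Algebra k B]
  [Ring C] [Algebra k C]
  [AddCommGroup V] [Module k V] [AddCommGroup W] [Module k W] [AddCommGroup X] [Module k X]
  [AddCommGroup V'] [Module k V'] [AddCommGroup W'] [Module k W']

/-- The action of `A ⊗ B` on `V ⊗ W` obtained from actions of `A` on `V` and of `B` on `W`. -/
def actT (a : A →ₐ[k] Module.End k V) (b : B →ₐ[k] Module.End k W) :
    A ⊗[k] B →ₐ[k] Module.End k (V ⊗[k] W) :=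
  Module.endTensorEndAlgHom.comp (Algebra.TensorProduct.map a b)

theorem actT_tmul (a : A →ₐ[k] Module.End k V) (b : B →ₐ[k] Module.End k W) (x : A) (y : B)
    (v : V) (w : W) : actT a b (x ⊗ₜ y) (v ⊗ₜ w) = a x v ⊗ₜ b y w := rfl

theorem actT_map (a : A →ₐ[k] Module.End k V) (b : B →ₐ[k] Module.End k W)
    (a' : A →ₐ[k] Module.End k V') (b' : B →ₐ[k] Module.End k W') (f : V →ₗ[k] V')
    (g : W →ₗ[k] W') (hf : ∀ x v, f (a x v) = a' x (f v)) (hg : ∀ x v, g (b x v) = b' x (g v))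
    (t : A ⊗[k] B) (z : V ⊗[k] W) :
    TensorProduct.map f g (actT a b t z) = actT a' b' t (TensorProduct.map f g z) := by
  induction t with
  | zero => simp
  | add p q hp hq => simp only [map_add, LinearMap.add_apply, hp, hq]
  | tmul p q =>
    induction z with
    | zero => simp
    | add p q hp hq => simp only [map_add, hp, hq]
    | tmul x y => simp only [actT_tmul, TensorProduct.map_tmul, hf, hg]

theorem actT_assoc (a : A →ₐ[k] Module.End k V) (b : B →ₐ[k] Module.End k W)
    (c : C →ₐ[k] Module.End k X) (w : (A ⊗[k] B) ⊗[k] C) (s : (V ⊗[k] W) ⊗[k] X) :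
    TensorProduct.assoc k V W X (actT (actT a b) c w s) =
      actT a (actT b c) (TensorProduct.assoc k A B C w) (TensorProduct.assoc k V W X s) := by
  induction w with
  | zero => simp
  | add a b ha hb => simp only [map_add, LinearMap.add_apply, ha, hb]
  | tmul ab c =>
    induction ab with
    | zero => simp
    | add a b ha hb => simp only [TensorProduct.add_tmul, map_add, LinearMap.add_apply, ha, hb]
    | tmul a b =>
      induction s with
      | zero => simp
      | add a b ha hb => simp only [map_add, ha, hb]
      | tmul xy z =>
        induction xy with
        | zero => simp
        | add a b ha hb => simp only [TensorProduct.add_tmul, map_add, ha, hb]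
        | tmul x y => rfl

theorem actT_comp {A' B' : Type*} [Ring A'] [Algebra k A'] [Ring B'] [Algebra k B']
    (a : A →ₐ[k] Module.End k V) (b : B →ₐ[k] Module.End k W)
    (f : A' →ₐ[k] A) (g : B' →ₐ[k] B) (w : A' ⊗[k] B') :
    actT (a.comp f) (b.comp g) w = actT a b (TensorProduct.map f.toLinearMap g.toLinearMap w) := by
  induction w with
  | zero => simp
  | add a b ha hb => simp only [map_add, ha, hb]
  | tmul a b => rfl

end Raw

section Raw₂

variable {k H V W X : Type*} [CommRing k] [Ring H] [Bialgebra k H]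
  [AddCommGroup V] [Module k V] [AddCommGroup W] [Module k W] [AddCommGroup X] [Module k X]

/-- The action of a bialgebra `H` on the tensor product of two modules. -/
def tensorAct (a : H →ₐ[k] Module.End k V) (b : H →ₐ[k] Module.End k W) :
    H →ₐ[k] Module.End k (V ⊗[k] W) := (actT a b).comp (Bialgebra.comulAlgHom k H)

theorem tensorAct_apply (a : H →ₐ[k] Module.End k V) (b : H →ₐ[k] Module.End k W) (h : H) :
    tensorAct a b h = actT a b (Coalgebra.comul (R := k) h) := rfl

variable (k H) in
/-- The action of a bialgebra on the ground ring through the counit. -/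
def trivAct : H →ₐ[k] Module.End k k := (Algebra.ofId k _).comp (Bialgebra.counitAlgHom k H)

theorem trivAct_apply (h : H) (c : k) : trivAct k H h c = Coalgebra.counit (R := k) h * c := rfl

theorem tensorAct_assoc (a : H →ₐ[k] Module.End k V) (b : H →ₐ[k] Module.End k W)
    (c : H →ₐ[k] Module.End k X) (h : H) (s : (V ⊗[k] W) ⊗[k] X) :
    TensorProduct.assoc k V W X (tensorAct (tensorAct a b) c h s) =
      tensorAct a (tensorAct b c) h (TensorProduct.assoc k V W X s) := by
  have e1 : tensorAct (tensorAct a b) c h = actT (actT a b) c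
        ((Coalgebra.comul (R := k)).rTensor H (Coalgebra.comul (R := k) h)) :=
    actT_comp (actT a b) c (Bialgebra.comulAlgHom k H) (AlgHom.id k H) _
  have e2 : tensorAct a (tensorAct b c) h = actT a (actT b c)
        ((Coalgebra.comul (R := k)).lTensor H (Coalgebra.comul (R := k) h)) :=
    actT_comp a (actT b c) (AlgHom.id k H) (Bialgebra.comulAlgHom k H) _
  rw [e1, e2, actT_assoc, Coalgebra.coassoc_apply]

theorem tensorAct_lid (a : H →ₐ[k] Module.End k V) (h : H) (t : k ⊗[k] V) :
    TensorProduct.lid k V (tensorAct (trivAct k H) a h t) = a h (TensorProduct.lid k V t) := by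
  have key : ∀ w : H ⊗[k] H, TensorProduct.lid k V (actT (trivAct k H) a w t) =
      a (TensorProduct.lid k H ((Coalgebra.counit (R := k)).rTensor H w))
        (TensorProduct.lid k V t) := by
    intro w
    induction w with
    | zero => simp
    | add a b ha hb => simp only [map_add, LinearMap.add_apply, ha, hb]
    | tmul a b =>
      induction t with
      | zero => simp
      | add a b ha hb => simp only [map_add, ha, hb]
      | tmul c x => simp [actT_tmul, trivAct_apply, mul_smul, smul_comm c]
  rw [tensorAct_apply, key, Coalgebra.rTensor_counit_comul]
  simp

theorem tensorAct_rid (a : H →ₐ[k] Module.End k V) (h : H) (t : V ⊗[k] k) :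
    TensorProduct.rid k V (tensorAct a (trivAct k H) h t) = a h (TensorProduct.rid k V t) := by
  have key : ∀ w : H ⊗[k] H, TensorProduct.rid k V (actT a (trivAct k H) w t) =
      a (TensorProduct.rid k H ((Coalgebra.counit (R := k)).lTensor H w))
        (TensorProduct.rid k V t) := by
    intro w
    induction w with
    | zero => simp
    | add a b ha hb => simp only [map_add, LinearMap.add_apply, ha, hb]
    | tmul a b =>
      induction t with
      | zero => simp
      | add a b ha hb => simp only [map_add, ha, hb]
      | tmul x c => simp [actT_tmul, trivAct_apply, mul_smul, smul_comm c]
  rw [tensorAct_apply, key, Coalgebra.lTensor_counit_comul]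
  simp

end Raw₂

/-- A left `H`-module: a `k`-module with an algebra map `H → End_k(V)`. -/
structure LMod (k H : Type u) [CommRing k] [Ring H] [Algebra k H] where
  /-- the underlying `k`-module -/
  V : ModuleCat.{u} k
  /-- the action -/
  ρ : H →ₐ[k] Module.End k V

namespace LMod

section Cat

variable {k H : Type u} [CommRing k] [Ring H] [Algebra k H]

/-- `H`-linear maps. -/
@[ext]
structure Hom (X Y : LMod k H) where
  /-- the underlying `k`-linear map -/
  f : X.V ⟶ Y.V
  comm : ∀ (h : H) (x : X.V), f.hom (X.ρ h x) = Y.ρ h (f.hom x)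

instance : Category (LMod k H) where
  Hom := Hom
  id X := ⟨𝟙 _, fun _ _ => rfl⟩
  comp f g := ⟨f.f ≫ g.f, fun h x => by
    change g.f.hom (f.f.hom _) = _
    rw [f.comm, g.comm]; rfl⟩

@[ext]
theorem hom_ext {X Y : LMod k H} {f g : X ⟶ Y} (w : f.f = g.f) : f = g := Hom.ext w

@[simp] theorem id_f (X : LMod k H) : Hom.f (𝟙 X) = 𝟙 X.V := rfl
@[simp] theorem comp_f {X Y Z : LMod k H} (f : X ⟶ Y) (g : Y ⟶ Z) : (f ≫ g).f = f.f ≫ g.f := rfl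

theorem hom_comm {X Y : LMod k H} (f : X ⟶ Y) (h : H) (x : X.V) :
    f.f.hom (X.ρ h x) = Y.ρ h (f.f.hom x) := f.comm h x

variable (k H) in
/-- The forgetful functor to `k`-modules. -/
@[simps]
def forgetV : LMod k H ⥤ ModuleCat.{u} k where
  obj X := X.V
  map f := f.f

instance : (forgetV k H).Faithful where
  map_injective w := hom_ext w

/-- A linear isomorphism commuting with the actions is an isomorphism of `H`-modules. -/
@[simps]
def isoMk {X Y : LMod k H} (e : X.V ≅ Y.V)
    (w : ∀ (h : H) (x : X.V), e.hom.hom (X.ρ h x) = Y.ρ h (e.hom.hom x)) : X ≅ Y where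
  hom := ⟨e.hom, w⟩
  inv := ⟨e.inv, fun h y => by
    have inj : Function.Injective e.hom.hom := e.toLinearEquiv.injective
    have hi : ∀ z, e.hom.hom (e.inv.hom z) = z := fun z => e.toLinearEquiv.apply_symm_apply z
    apply inj
    rw [w, hi, hi]⟩
  hom_inv_id := hom_ext e.hom_inv_id
  inv_hom_id := hom_ext e.inv_hom_id

instance : (forgetV k H).ReflectsIsomorphisms where
  reflects {X Y} f hf := by
    have : IsIso f.f := hf
    have e : f = (isoMk (asIso f.f) f.comm).hom := rfl
    rw [e]; infer_instance

end Cat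

section Monoidal

variable {k H : Type u} [CommRing k] [Ring H] [Bialgebra k H]

instance : MonoidalCategoryStruct (LMod k H) where
  tensorObj X Y := ⟨X.V ⊗ Y.V, tensorAct X.ρ Y.ρ⟩
  whiskerLeft X {Y Z} f := ⟨X.V ◁ f.f, fun h =>
    actT_map X.ρ Y.ρ X.ρ Z.ρ LinearMap.id f.f.hom (fun _ _ => rfl) f.comm
      (Coalgebra.comul (R := k) h)⟩
  whiskerRight {Y Z} f X := ⟨f.f ▷ X.V, fun h =>
    actT_map Y.ρ X.ρ Z.ρ X.ρ f.f.hom LinearMap.id f.comm (fun _ _ => rfl)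
      (Coalgebra.comul (R := k) h)⟩
  tensorHom {X Y Z W} f g := ⟨f.f ⊗ₘ g.f, fun h =>
    actT_map X.ρ Z.ρ Y.ρ W.ρ f.f.hom g.f.hom f.comm g.comm (Coalgebra.comul (R := k) h)⟩
  tensorUnit := ⟨𝟙_ (ModuleCat k), trivAct k H⟩
  associator X Y Z := isoMk (α_ X.V Y.V Z.V) (tensorAct_assoc X.ρ Y.ρ Z.ρ)
  leftUnitor X := isoMk (λ_ X.V) (tensorAct_lid X.ρ)
  rightUnitor X := isoMk (ρ_ X.V) (tensorAct_rid X.ρ)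

@[simp] theorem tensor_V (X Y : LMod k H) : (X ⊗ Y).V = X.V ⊗ Y.V := rfl
@[simp] theorem unit_V : (𝟙_ (LMod k H)).V = 𝟙_ (ModuleCat k) := rfl
@[simp] theorem whiskerLeft_f (X : LMod k H) {Y Z : LMod k H} (f : Y ⟶ Z) :
    (X ◁ f).f = X.V ◁ f.f := rfl
@[simp] theorem whiskerRight_f {Y Z : LMod k H} (f : Y ⟶ Z) (X : LMod k H) :
    (f ▷ X).f = f.f ▷ X.V := rfl
@[simp] theorem tensorHom_f {X Y Z W : LMod k H} (f : X ⟶ Y) (g : Z ⟶ W) :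
    (f ⊗ₘ g).f = f.f ⊗ₘ g.f := rfl
@[simp] theorem associator_hom_f (X Y Z : LMod k H) :
    (α_ X Y Z).hom.f = (α_ X.V Y.V Z.V).hom := rfl
@[simp] theorem associator_inv_f (X Y Z : LMod k H) :
    (α_ X Y Z).inv.f = (α_ X.V Y.V Z.V).inv := rfl
@[simp] theorem leftUnitor_hom_f (X : LMod k H) : (λ_ X).hom.f = (λ_ X.V).hom := rfl
@[simp] theorem leftUnitor_inv_f (X : LMod k H) : (λ_ X).inv.f = (λ_ X.V).inv := rfl
@[simp] theorem rightUnitor_hom_f (X : LMod k H) : (ρ_ X).hom.f = (ρ_ X.V).hom := rfl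
@[simp] theorem rightUnitor_inv_f (X : LMod k H) : (ρ_ X).inv.f = (ρ_ X.V).inv := rfl

variable (k H) in
/-- The forgetful functor strictly preserves the tensor product. -/
def inducingData : Monoidal.InducingFunctorData (forgetV k H) where
  μIso X Y := Iso.refl (X.V ⊗ Y.V)
  εIso := Iso.refl (𝟙_ (ModuleCat k))
  whiskerLeft_eq X _ _ f := (strict_aux₁ (X.V ◁ f.f))
  whiskerRight_eq f Y := (strict_aux₁ (f.f ▷ Y.V))
  tensorHom_eq f g := (strict_aux₁ (f.f ⊗ₘ g.f))
  associator_eq X Y Z := strict_aux₂ X.V Y.V Z.V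
  leftUnitor_eq X := strict_aux₃ X.V
  rightUnitor_eq X := strict_aux₄ X.V

instance : MonoidalCategory (LMod k H) := Monoidal.induced (forgetV k H) (inducingData k H)

instance : (forgetV k H).Monoidal := Monoidal.fromInducedMonoidal (forgetV k H) (inducingData k H)

theorem tensor_ρ (X Y : LMod k H) : (X ⊗ Y).ρ = tensorAct X.ρ Y.ρ := rfl
theorem unit_ρ : (𝟙_ (LMod k H)).ρ = trivAct k H := rfl

end Monoidal
end LMod

/-! ### Colimits of modules -/

/-- A functor preserving and reflecting tensor products and colimits transports the preservation of
colimits by tensor products. -/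
theorem preserves_tensorLeft_of {C : Type u₁} [Category.{v₁} C] [MonoidalCategory C]
    {D : Type u₂} [Category.{v₂} D] [MonoidalCategory D] (F : C ⥤ D) [F.Monoidal]
    [PreservesColimitsOfSize.{0, 0} F] [ReflectsColimitsOfSize.{0, 0} F]
    [∀ Y : D, PreservesColimitsOfSize.{0, 0} (tensorLeft Y)] (X : C) :
    PreservesColimitsOfSize.{0, 0} (tensorLeft X) := by
  have e : F ⋙ tensorLeft (F.obj X) ≅ tensorLeft X ⋙ F :=
    NatIso.ofComponents (fun Y => Functor.Monoidal.μIso F X Y)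
      (fun f => Functor.LaxMonoidal.μ_natural_right F X f)
  have : PreservesColimitsOfSize.{0, 0} (tensorLeft X ⋙ F) :=
    preservesColimits_of_natIso e
  exact preservesColimits_of_reflects_of_preserves (tensorLeft X) F

theorem preserves_tensorRight_of {C : Type u₁} [Category.{v₁} C] [MonoidalCategory C]
    {D : Type u₂} [Category.{v₂} D] [MonoidalCategory D] (F : C ⥤ D) [F.Monoidal]
    [PreservesColimitsOfSize.{0, 0} F] [ReflectsColimitsOfSize.{0, 0} F]
    [∀ Y : D, PreservesColimitsOfSize.{0, 0} (tensorRight Y)] (X : C) :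
    PreservesColimitsOfSize.{0, 0} (tensorRight X) := by
  have e : F ⋙ tensorRight (F.obj X) ≅ tensorRight X ⋙ F :=
    NatIso.ofComponents (fun Y => Functor.Monoidal.μIso F Y X)
      (fun f => Functor.LaxMonoidal.μ_natural_left F f X)
  have : PreservesColimitsOfSize.{0, 0} (tensorRight X ⋙ F) :=
    preservesColimits_of_natIso e
  exact preservesColimits_of_reflects_of_preserves (tensorRight X) F

namespace LMod

section Colimits

variable {k H : Type u} [CommRing k] [Ring H] [Algebra k H]
variable {J : Type} [SmallCategory J] (F : J ⥤ LMod k H)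
  (c : Cocone (F ⋙ forgetV k H)) (t : IsColimit c)

/-- The action of an element on the colimit of the underlying modules. -/
def colimAct (h : H) : c.pt ⟶ c.pt :=
  t.desc ⟨c.pt, { app := fun j => ModuleCat.ofHom ((F.obj j).ρ h) ≫ c.ι.app j
                  naturality := fun i j f => by
                    ext x
                    exact (congrArg (c.ι.app j).hom ((F.map f).comm h x)).symm.trans
                      (congrArg (fun g => g.hom ((F.obj i).ρ h x)) (c.w f)) }⟩

theorem ι_colimAct (h : H) (j : J) :
    c.ι.app j ≫ colimAct F c t h = ModuleCat.ofHom ((F.obj j).ρ h) ≫ c.ι.app j :=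
  t.fac _ j

theorem colimAct_apply (h : H) (j : J) (x : (F.obj j).V) :
    (colimAct F c t h).hom ((c.ι.app j).hom x) = (c.ι.app j).hom ((F.obj j).ρ h x) :=
  congrArg (fun f => f.hom x) (ι_colimAct F c t h j)

theorem colim_ext {F : J ⥤ LMod k H} {c : Cocone (F ⋙ forgetV k H)} (t : IsColimit c) {W : ModuleCat.{u} k} {f g : c.pt ⟶ W}
    (w : ∀ (j : J) (x : (F.obj j).V), f.hom ((c.ι.app j).hom x) = g.hom ((c.ι.app j).hom x)) :
    f = g := t.hom_ext fun j => by ext x; exact w j x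

/-- The action on the colimit of the underlying modules. -/
def colimρ : H →ₐ[k] Module.End k c.pt :=
  AlgHom.ofLinearMap
    { toFun := fun h => (colimAct F c t h).hom
      map_add' := fun a b => congrArg ModuleCat.Hom.hom
        (show colimAct F c t (a + b) = ModuleCat.ofHom ((colimAct F c t a).hom +
          (colimAct F c t b).hom) from colim_ext t fun j x => by
            rw [ModuleCat.hom_ofHom, LinearMap.add_apply, colimAct_apply, colimAct_apply,
              colimAct_apply, map_add, LinearMap.add_apply]
            exact map_add (c.ι.app j).hom _ _)
      map_smul' := fun a b => congrArg ModuleCat.Hom.hom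
        (show colimAct F c t (a • b) = ModuleCat.ofHom (a • (colimAct F c t b).hom) from
          colim_ext t fun j x => by
            rw [ModuleCat.hom_ofHom, LinearMap.smul_apply, colimAct_apply,
              colimAct_apply, map_smul, LinearMap.smul_apply]
            exact map_smul (c.ι.app j).hom _ _) }
    (congrArg ModuleCat.Hom.hom
        (show colimAct F c t 1 = ModuleCat.ofHom LinearMap.id from
          colim_ext t fun j x => by
            rw [ModuleCat.hom_ofHom, colimAct_apply, map_one]; rfl))
    (fun a b => congrArg ModuleCat.Hom.hom
        (show colimAct F c t (a * b) = ModuleCat.ofHom ((colimAct F c t a).hom ∘ₗ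
          (colimAct F c t b).hom) from colim_ext t fun j x => by
            rw [ModuleCat.hom_ofHom, LinearMap.comp_apply, colimAct_apply, colimAct_apply,
              colimAct_apply, map_mul]; rfl))

theorem colimρ_apply (h : H) (j : J) (x : (F.obj j).V) :
    colimρ F c t h ((c.ι.app j).hom x) = (c.ι.app j).hom ((F.obj j).ρ h x) :=
  colimAct_apply F c t h j x

/-- The colimit cocone. -/
def colimCocone : Cocone F where
  pt := ⟨c.pt, colimρ F c t⟩
  ι := { app := fun j => ⟨c.ι.app j, fun h x => (colimρ_apply F c t h j x).symm⟩
         naturality := fun _ _ f => hom_ext (c.ι.naturality f) }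

/-- The colimit cocone is a colimit. -/
def colimIsColimit : IsColimit (colimCocone F c t) where
  desc s := ⟨t.desc ((forgetV k H).mapCocone s), fun h => by
    have hf : ∀ (j : J) (x : (F.obj j).V),
        (t.desc ((forgetV k H).mapCocone s)).hom ((c.ι.app j).hom x) = (s.ι.app j).f.hom x :=
      fun j x => congrArg (fun f => f.hom x) (t.fac ((forgetV k H).mapCocone s) j)
    intro x
    have : ModuleCat.ofHom (colimρ F c t h) ≫ t.desc ((forgetV k H).mapCocone s) =
        t.desc ((forgetV k H).mapCocone s) ≫ ModuleCat.ofHom (s.pt.ρ h) :=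
      colim_ext t fun j x => by
        change (t.desc ((forgetV k H).mapCocone s)).hom (colimρ F c t h ((c.ι.app j).hom x)) =
          s.pt.ρ h ((t.desc ((forgetV k H).mapCocone s)).hom ((c.ι.app j).hom x))
        rw [colimρ_apply, hf, hf]
        exact (s.ι.app j).comm h x
    exact congrArg (fun f => f.hom x) this⟩
  fac s j := hom_ext (t.fac ((forgetV k H).mapCocone s) j)
  uniq s m w := hom_ext (t.uniq ((forgetV k H).mapCocone s) m.f fun j =>
    congrArg Hom.f (w j))

instance : CreatesColimitsOfSize.{0, 0} (forgetV k H) where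
  CreatesColimitsOfShape :=
    { CreatesColimit := fun {F} => createsColimitOfReflectsIso fun c t =>
        { liftedCocone := colimCocone F c t
          validLift := Cocone.ext (Iso.refl _) (fun _ => Category.comp_id _)
          makesColimit := colimIsColimit F c t } }

instance : HasColimitsOfSize.{0, 0} (LMod k H) :=
  hasColimits_of_hasColimits_createsColimits (forgetV k H)

end Colimits

section

variable {k H : Type u} [CommRing k] [Ring H] [Bialgebra k H]

instance (X : LMod k H) : PreservesColimitsOfSize.{0, 0} (tensorLeft X) :=
  preserves_tensorLeft_of (forgetV k H) X

instance (X : LMod k H) : PreservesColimitsOfSize.{0, 0} (tensorRight X) :=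
  preserves_tensorRight_of (forgetV k H) X

end

end LMod

/-! ## Commutative central monoids and their modules -/

section Central

variable {C : Type u₁} [Category.{v₁} C] [MonoidalCategory C]

open MonObj

/-- The monoid in `C` underlying a commutative monoid in the Drinfeld center. -/
def mon (M : CommMon (Center C)) : Mon C where
  X := M.X.1
  mon :=
    { one := Center.Hom.f η[M.X]
      mul := Center.Hom.f μ[M.X]
      one_mul := congrArg Center.Hom.f (MonObj.one_mul M.X)
      mul_one := congrArg Center.Hom.f (MonObj.mul_one M.X)
      mul_assoc := congrArg Center.Hom.f (MonObj.mul_assoc M.X) }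

/-- The half-braiding `M ⊗ U ≅ U ⊗ M`. -/
def swap (M : CommMon (Center C)) (U : C) : (mon M).X ⊗ U ≅ U ⊗ (mon M).X := M.X.2.β U

variable (M : CommMon (Center C))

theorem swap_nat {U V : C} (f : U ⟶ V) :
    (mon M).X ◁ f ≫ (swap M V).hom = (swap M U).hom ≫ f ▷ (mon M).X := M.X.2.naturality f

theorem swap_nat_assoc {U V : C} (f : U ⟶ V) {Z : C} (g : V ⊗ (mon M).X ⟶ Z) :
    (mon M).X ◁ f ≫ (swap M V).hom ≫ g = (swap M U).hom ≫ f ▷ (mon M).X ≫ g := by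
  rw [← Category.assoc, swap_nat, Category.assoc]

theorem swap_tensor (U V : C) :
    (swap M (U ⊗ V)).hom = (α_ _ _ _).inv ≫ (swap M U).hom ▷ V ≫ (α_ _ _ _).hom ≫
      U ◁ (swap M V).hom ≫ (α_ _ _ _).inv := M.X.2.monoidal U V

theorem swap_mul (U : C) :
    μ[(mon M).X] ▷ U ≫ (swap M U).hom = (α_ _ _ _).hom ≫ (mon M).X ◁ (swap M U).hom ≫
      (α_ _ _ _).inv ≫ (swap M U).hom ▷ (mon M).X ≫ (α_ _ _ _).hom ≫ U ◁ μ[(mon M).X] := by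
  have e : ∀ {X₁ X₂ X₃ X₄ X₅ X₆ X₇ : C} (a : X₁ ⟶ X₂) (b : X₂ ⟶ X₃) (c : X₃ ⟶ X₄) (d : X₄ ⟶ X₅)
      (e : X₅ ⟶ X₆) (f : X₆ ⟶ X₇), (a ≫ b ≫ c ≫ d ≫ e) ≫ f = a ≫ b ≫ c ≫ d ≫ e ≫ f := by simp
  exact (Center.Hom.comm μ[M.X] U).trans (e _ _ _ _ _ _)

theorem swap_one (U : C) :
    η[(mon M).X] ▷ U ≫ (swap M U).hom = (λ_ U).hom ≫ (ρ_ U).inv ≫ U ◁ η[(mon M).X] := by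
  exact (Center.Hom.comm η[M.X] U).trans (Category.assoc _ _ _)

theorem swap_comm : (swap M (mon M).X).hom ≫ μ[(mon M).X] = μ[(mon M).X] :=
  congrArg Center.Hom.f (IsCommMonObj.mul_comm M.X)

/-- Right modules over (the monoid underlying) a commutative central monoid `M`. -/
structure RMod (M : CommMon (Center C)) where
  /-- the underlying object -/
  X : C
  /-- the right action -/
  act : X ⊗ (mon M).X ⟶ X
  act_one : X ◁ η[(mon M).X] ≫ act = (ρ_ X).hom
  act_mul : X ◁ μ[(mon M).X] ≫ act = (α_ X _ _).inv ≫ act ▷ (mon M).X ≫ act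

namespace RMod

variable {M}

/-- Morphisms of right modules. -/
@[ext]
structure Hom (X Y : RMod M) where
  /-- the underlying morphism -/
  f : X.X ⟶ Y.X
  comm : X.act ≫ f = f ▷ (mon M).X ≫ Y.act

instance : Category (RMod M) where
  Hom := Hom
  id X := ⟨𝟙 _, by simp⟩
  comp f g := ⟨f.f ≫ g.f, by
    rw [← Category.assoc, f.comm, Category.assoc, g.comm, comp_whiskerRight, Category.assoc]⟩

@[ext]
theorem hom_ext {X Y : RMod M} {f g : X ⟶ Y} (w : f.f = g.f) : f = g := Hom.ext w

@[simp] theorem id_f (X : RMod M) : Hom.f (𝟙 X) = 𝟙 X.X := rfl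
@[simp] theorem comp_f {X Y Z : RMod M} (f : X ⟶ Y) (g : Y ⟶ Z) : (f ≫ g).f = f.f ≫ g.f := rfl

variable (M) in
/-- The forgetful functor. -/
@[simps]
def forg : RMod M ⥤ C where
  obj X := X.X
  map f := f.f

instance : (forg M).Faithful where
  map_injective w := hom_ext w

/-- The left action `M ⊗ X → X ⊗ M → X` on a right module. -/
def lact (X : RMod M) : (mon M).X ⊗ X.X ⟶ X.X := (swap M X.X).hom ≫ X.act

theorem act_comm (X : RMod M) :
    X.X ◁ (swap M (mon M).X).hom ≫ (α_ X.X _ _).inv ≫ X.act ▷ (mon M).X ≫ X.act =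
      (α_ X.X _ _).inv ≫ X.act ▷ (mon M).X ≫ X.act := by
  rw [← X.act_mul, ← whiskerLeft_comp_assoc, swap_comm]

/-- A right module is a bimodule through the half-braiding of `M`. -/
abbrev toBimodObj (X : RMod M) : Bimod (mon M) (mon M) where
  X := X.X
  actLeft := X.lact
  actRight := X.act
  actRight_one := X.act_one
  right_assoc := X.act_mul
  one_actLeft := by
    unfold lact
    rw [← Category.assoc, swap_one, Category.assoc, Category.assoc, act_one, Iso.inv_hom_id,
      Category.comp_id]
  left_assoc := by
    unfold lact
    rw [← Category.assoc, swap_mul]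
    simp only [Category.assoc, whiskerLeft_comp]
    rw [X.act_mul, swap_nat_assoc, swap_tensor]
    simp only [Category.assoc, act_comm]
  middle_assoc := by
    unfold lact
    rw [swap_nat_assoc, swap_tensor]
    simp only [comp_whiskerRight, Category.assoc, act_comm]
    simp

end RMod

section BimodMonoidal

variable [HasCoequalizers C] [∀ X : C, PreservesColimitsOfSize.{0, 0} (tensorLeft X)]
  [∀ X : C, PreservesColimitsOfSize.{0, 0} (tensorRight X)]

/-- Endomorphisms in the bicategory of monoids and bimodules. -/
abbrev bimodEnd (A : Mon C) : MonoidalCategory (Bimod A A) :=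
  letI : Bicategory (Mon C) := Bimod.monBicategory
  (inferInstance : @MonoidalCategory (Bicategory.toCategoryStruct.toQuiver.Hom A A)
    (Bicategory.homCategory A A))

/-- Bimodules over a monoid form a monoidal category under the relative tensor product. -/
instance bimodMonoidal (A : Mon C) : MonoidalCategory (Bimod A A) where
  tensorObj P Q := P.tensorBimod Q
  whiskerLeft P _ _ f := Bimod.whiskerLeft P f
  whiskerRight f Q := Bimod.whiskerRight f Q
  tensorUnit := Bimod.regular A
  associator P Q R := Bimod.associatorBimod P Q R
  leftUnitor P := Bimod.leftUnitorBimod P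
  rightUnitor P := Bimod.rightUnitorBimod P
  tensorHom_def := (bimodEnd A).tensorHom_def
  id_tensorHom_id := (bimodEnd A).id_tensorHom_id
  tensorHom_comp_tensorHom := (bimodEnd A).tensorHom_comp_tensorHom
  whiskerLeft_id _ _ := Bimod.whiskerLeft_id_bimod
  id_whiskerRight _ _ := Bimod.id_whiskerRight_bimod
  associator_naturality := (bimodEnd A).associator_naturality
  leftUnitor_naturality := (bimodEnd A).leftUnitor_naturality
  rightUnitor_naturality := (bimodEnd A).rightUnitor_naturality
  pentagon P Q R S := Bimod.pentagon_bimod P Q R S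
  triangle P Q := Bimod.triangle_bimod P Q

end BimodMonoidal

end Central

/-! ### The relative tensor product of modules over a commutative central monoid -/

section RModMonoidal

variable {C : Type u₁} [Category.{v₁} C] [MonoidalCategory C]
open MonObj

namespace RMod

variable {M : CommMon (Center C)}

theorem lact_nat {X Y : RMod M} (f : X ⟶ Y) : X.lact ≫ f.f = (mon M).X ◁ f.f ≫ Y.lact := by
  unfold lact
  rw [swap_nat_assoc, Category.assoc, f.comm]

/-- A morphism of right modules is a morphism of the associated bimodules. -/
def toBimodMap {X Y : RMod M} (f : X ⟶ Y) : toBimodObj X ⟶ toBimodObj Y where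
  hom := f.f
  left_act_hom := lact_nat f
  right_act_hom := f.comm

/-- A morphism between the bimodules associated with right modules is one of right modules. -/
def ofBimodMap {X Y : RMod M} (f : toBimodObj X ⟶ toBimodObj Y) : X ⟶ Y where
  f := f.hom
  comm := f.right_act_hom

variable (M) in
/-- Right modules as bimodules. -/
def toBimod : RMod M ⥤ Bimod (mon M) (mon M) where
  obj := toBimodObj
  map := toBimodMap

instance : (toBimod M).Faithful where
  map_injective w := hom_ext (congrArg Bimod.Hom.hom w)

/-- An isomorphism between the associated bimodules gives one of right modules. -/
def ofBimodIso {X Y : RMod M} (e : toBimodObj X ≅ toBimodObj Y) : X ≅ Y where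
  hom := ofBimodMap e.hom
  inv := ofBimodMap e.inv
  hom_inv_id := hom_ext (congrArg Bimod.Hom.hom e.hom_inv_id)
  inv_hom_id := hom_ext (congrArg Bimod.Hom.hom e.inv_hom_id)

variable [HasCoequalizers C] [∀ X : C, PreservesColimitsOfSize.{0, 0} (tensorLeft X)]
  [∀ X : C, PreservesColimitsOfSize.{0, 0} (tensorRight X)]


/-- The relative tensor product: the coequalizer of the two maps `X ⊗ M ⊗ Y → X ⊗ Y` given by the
right action on `X` and by `X ⊗ M ⊗ Y → X ⊗ Y ⊗ M → X ⊗ Y`. -/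
def relTensor (X Y : RMod M) : C := Bimod.TensorBimod.X (toBimodObj X) (toBimodObj Y)

/-- The projection onto the relative tensor product. -/
def π (X Y : RMod M) : X.X ⊗ Y.X ⟶ relTensor X Y :=
  coequalizer.π (X.act ▷ Y.X) ((α_ _ _ _).hom ≫ X.X ◁ Y.lact)

instance (X Y : RMod M) : Epi (π X Y) := ⟨fun _ _ h => coequalizer.hom_ext h⟩
instance (X Y : RMod M) (Z : C) : Epi (π X Y ▷ Z) := by
  have : Epi ((tensorRight Z).map (coequalizer.π (X.act ▷ Y.X) ((α_ _ _ _).hom ≫ X.X ◁ Y.lact))) :=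
    inferInstance
  exact this
instance (X Y : RMod M) (Z : C) : Epi (Z ◁ π X Y) := by
  have : Epi ((tensorLeft Z).map (coequalizer.π (X.act ▷ Y.X) ((α_ _ _ _).hom ≫ X.X ◁ Y.lact))) :=
    inferInstance
  exact this

theorem π_condition (X Y : RMod M) :
    X.act ▷ Y.X ≫ π X Y = (α_ _ _ _).hom ≫ X.X ◁ Y.lact ≫ π X Y := by
  rw [← Category.assoc (α_ _ _ _).hom]
  exact coequalizer.condition _ _

/-- The universal property of the relative tensor product. -/
def descπ {X Y : RMod M} {Z : C} (f : X.X ⊗ Y.X ⟶ Z)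
    (w : X.act ▷ Y.X ≫ f = (α_ _ _ _).hom ≫ X.X ◁ Y.lact ≫ f) : relTensor X Y ⟶ Z :=
  coequalizer.desc f (by rw [w, Category.assoc])

theorem π_descπ {X Y : RMod M} {Z : C} (f : X.X ⊗ Y.X ⟶ Z)
    (w : X.act ▷ Y.X ≫ f = (α_ _ _ _).hom ≫ X.X ◁ Y.lact ≫ f) : π X Y ≫ descπ f w = f :=
  coequalizer.π_desc _ _

/-- The right action on the relative tensor product, induced by that on the second factor. -/
def relAct (X Y : RMod M) : relTensor X Y ⊗ (mon M).X ⟶ relTensor X Y :=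
  Bimod.TensorBimod.actRight (toBimodObj X) (toBimodObj Y)

theorem π_relAct (X Y : RMod M) :
    π X Y ▷ (mon M).X ≫ relAct X Y = (α_ _ _ _).hom ≫ X.X ◁ Y.act ≫ π X Y :=
  Bimod.TensorBimod.π_tensor_id_actRight (toBimodObj X) (toBimodObj Y)

/-- The relative tensor product as a right module. -/
abbrev tensorObj (X Y : RMod M) : RMod M where
  X := relTensor X Y
  act := relAct X Y
  act_one := Bimod.TensorBimod.actRight_one' (toBimodObj X) (toBimodObj Y)
  act_mul := Bimod.TensorBimod.right_assoc' (toBimodObj X) (toBimodObj Y)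

theorem tensor_lact (X Y : RMod M) :
    Bimod.TensorBimod.actLeft (toBimodObj X) (toBimodObj Y) = (tensorObj X Y).lact := by
  have h₁ := Bimod.TensorBimod.whiskerLeft_π_actLeft (toBimodObj X) (toBimodObj Y)
  have h₂ : (mon M).X ◁ π X Y ≫ (tensorObj X Y).lact =
      (α_ _ _ _).inv ≫ X.lact ▷ Y.X ≫ π X Y := by
    unfold lact
    rw [swap_nat_assoc, swap_tensor]
    simp only [Category.assoc, comp_whiskerRight]
    rw [π_relAct, π_condition]
    simp only [Iso.inv_hom_id_assoc]
    unfold lact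
    simp
  exact (cancel_epi ((mon M).X ◁ π X Y)).1 (h₁.trans h₂.symm)

/-- The bimodule of the relative tensor product is the tensor product of bimodules. -/
def tensorIso (X Y : RMod M) :
    (toBimod M).obj X ⊗ (toBimod M).obj Y ≅ (toBimod M).obj (tensorObj X Y) :=
  Bimod.isoOfIso (Iso.refl (relTensor X Y))
    ((Category.comp_id _).trans ((tensor_lact X Y).trans (by
      rw [Iso.refl_hom]; erw [whiskerLeft_id, Category.id_comp]; rfl)))
    ((Category.comp_id _).trans (by
      rw [Iso.refl_hom]; erw [id_whiskerRight, Category.id_comp]; rfl))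

/-- The tensor unit: `M` as a module over itself. -/
abbrev unit (M : CommMon (Center C)) : RMod M where
  X := (mon M).X
  act := μ[(mon M).X]
  act_one := MonObj.mul_one _
  act_mul := by rw [MonObj.mul_assoc, Iso.inv_hom_id_assoc]

/-- The bimodule of the unit is the regular bimodule. -/
def unitIso (M : CommMon (Center C)) :
    𝟙_ (Bimod (mon M) (mon M)) ≅ (toBimod M).obj (unit M) :=
  Bimod.isoOfIso (Iso.refl (mon M).X)
    ((Category.comp_id _).trans ((swap_comm M).symm.trans (by
      rw [Iso.refl_hom]; erw [whiskerLeft_id, Category.id_comp]; rfl)))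
    ((Category.comp_id _).trans (by
      rw [Iso.refl_hom]; erw [id_whiskerRight, Category.id_comp]; rfl))

instance : MonoidalCategoryStruct (RMod M) where
  tensorObj := tensorObj
  tensorUnit := unit M
  whiskerLeft X {Y Z} f :=
    ofBimodMap ((tensorIso X Y).inv ≫ (toBimod M).obj X ◁ (toBimod M).map f ≫ (tensorIso X Z).hom)
  whiskerRight {Y Z} f X :=
    ofBimodMap ((tensorIso Y X).inv ≫ (toBimod M).map f ▷ (toBimod M).obj X ≫ (tensorIso Z X).hom)
  tensorHom {X Y Z W} f g :=
    ofBimodMap ((tensorIso X Z).inv ≫ ((toBimod M).map f ⊗ₘ (toBimod M).map g) ≫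
      (tensorIso Y W).hom)
  associator X Y Z := ofBimodIso
    (((tensorIso _ _).symm ≪≫ ((tensorIso _ _).symm ⊗ᵢ .refl _)) ≪≫
      α_ ((toBimod M).obj X) ((toBimod M).obj Y) ((toBimod M).obj Z) ≪≫
      ((.refl _ ⊗ᵢ tensorIso _ _) ≪≫ tensorIso _ _))
  leftUnitor X := ofBimodIso
    (((tensorIso _ _).symm ≪≫ ((unitIso M).symm ⊗ᵢ .refl _)) ≪≫ λ_ ((toBimod M).obj X))
  rightUnitor X := ofBimodIso
    (((tensorIso _ _).symm ≪≫ (.refl _ ⊗ᵢ (unitIso M).symm)) ≪≫ ρ_ ((toBimod M).obj X))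

variable (M) in
/-- The data for transporting the monoidal structure. -/
def inducingData : Monoidal.InducingFunctorData (toBimod M) where
  μIso := tensorIso
  εIso := unitIso M
  whiskerLeft_eq _ _ _ _ := rfl
  whiskerRight_eq _ _ := rfl
  tensorHom_eq _ _ := rfl
  associator_eq _ _ _ := rfl
  leftUnitor_eq _ := rfl
  rightUnitor_eq _ := rfl

instance : MonoidalCategory (RMod M) := Monoidal.induced (toBimod M) (inducingData M)

end RMod
end RModMonoidal

section RModLax

variable {C : Type u₁} [Category.{v₁} C] [MonoidalCategory C]
variable [HasCoequalizers C] [∀ X : C, PreservesColimitsOfSize.{0, 0} (tensorLeft X)]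
  [∀ X : C, PreservesColimitsOfSize.{0, 0} (tensorRight X)]


namespace RMod

variable {M : CommMon (Center C)}

theorem tensor_X (X Y : RMod M) : (X ⊗ Y).X = relTensor X Y := rfl

/-- The projection `X ⊗ Y → X ⊗_M Y`. -/
def proj (X Y : RMod M) : X.X ⊗ Y.X ⟶ (X ⊗ Y).X := π X Y

instance (X Y : RMod M) : Epi (proj X Y) := inferInstanceAs (Epi (π X Y))
instance (X Y : RMod M) (Z : C) : Epi (proj X Y ▷ Z) := inferInstanceAs (Epi (π X Y ▷ Z))
instance (X Y : RMod M) (Z : C) : Epi (Z ◁ proj X Y) := inferInstanceAs (Epi (Z ◁ π X Y))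

theorem proj_act (X Y : RMod M) : proj X Y ▷ (mon M).X ≫ (X ⊗ Y).act =
    (α_ _ _ _).hom ≫ X.X ◁ Y.act ≫ proj X Y := π_relAct X Y

theorem proj_condition (X Y : RMod M) :
    X.act ▷ Y.X ≫ proj X Y = (α_ _ _ _).hom ≫ X.X ◁ Y.lact ≫ proj X Y := π_condition X Y

/-- The universal property of the relative tensor product. -/
def desc {X Y : RMod M} {Z : C} (f : X.X ⊗ Y.X ⟶ Z)
    (w : X.act ▷ Y.X ≫ f = (α_ _ _ _).hom ≫ X.X ◁ Y.lact ≫ f) : (X ⊗ Y).X ⟶ Z := descπ f w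

theorem proj_desc {X Y : RMod M} {Z : C} (f : X.X ⊗ Y.X ⟶ Z)
    (w : X.act ▷ Y.X ≫ f = (α_ _ _ _).hom ≫ X.X ◁ Y.lact ≫ f) : proj X Y ≫ desc f w = f :=
  π_descπ f w

theorem proj_desc_assoc {X Y : RMod M} {Z : C} (f : X.X ⊗ Y.X ⟶ Z)
    (w : X.act ▷ Y.X ≫ f = (α_ _ _ _).hom ≫ X.X ◁ Y.lact ≫ f) {W : C} (g : Z ⟶ W) :
    proj X Y ≫ desc f w ≫ g = f ≫ g := by rw [← Category.assoc, proj_desc]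

theorem desc_ext {X Y : RMod M} {Z : C} {f g : (X ⊗ Y).X ⟶ Z}
    (w : proj X Y ≫ f = proj X Y ≫ g) : f = g := (cancel_epi (proj X Y)).1 w

section aux

variable {A : Mon C}

/-- The projection from the tensor product to the relative tensor product of bimodules. -/
def bproj (P Q : Bimod A A) : P.X ⊗ Q.X ⟶ (P ⊗ Q).X :=
  coequalizer.π (P.actRight ▷ Q.X) ((α_ _ _ _).hom ≫ P.X ◁ Q.actLeft)

theorem bproj_whiskerLeft (P : Bimod A A) {Q R : Bimod A A} (f : Q ⟶ R) :
    bproj P Q ≫ Bimod.Hom.hom (P ◁ f) = P.X ◁ f.hom ≫ bproj P R :=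
  ι_colimMap _ _

theorem bproj_whiskerRight {Q R : Bimod A A} (f : Q ⟶ R) (P : Bimod A A) :
    bproj Q P ≫ Bimod.Hom.hom (f ▷ P) = f.hom ▷ P.X ≫ bproj R P :=
  ι_colimMap _ _

theorem bproj_associator (P Q R : Bimod A A) :
    bproj P Q ▷ R.X ≫ bproj (P ⊗ Q) R ≫ Bimod.Hom.hom (α_ P Q R).hom =
      (α_ _ _ _).hom ≫ P.X ◁ bproj Q R ≫ bproj P (Q ⊗ R) := by
  have h₁ : bproj (P ⊗ Q) R ≫ Bimod.Hom.hom (α_ P Q R).hom =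
    Bimod.AssociatorBimod.homAux P Q R := coequalizer.π_desc _ _
  rw [h₁]
  exact π_tensor_id_preserves_coequalizer_inv_desc _ _ _ _

theorem bproj_leftUnitor (P : Bimod A A) :
    bproj (𝟙_ (Bimod A A)) P ≫ Bimod.Hom.hom (λ_ P).hom = P.actLeft := coequalizer.π_desc _ _

theorem bproj_rightUnitor (P : Bimod A A) :
    bproj P (𝟙_ (Bimod A A)) ≫ Bimod.Hom.hom (ρ_ P).hom = P.actRight := coequalizer.π_desc _ _

theorem proj_eq (X Y : RMod M) :
    proj X Y = bproj ((toBimod M).obj X) ((toBimod M).obj Y) ≫ (tensorIso X Y).hom.hom :=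
  (Category.comp_id _).symm

theorem tensorIso_hom_inv (X Y : RMod M) :
    (tensorIso X Y).hom.hom ≫ (tensorIso X Y).inv.hom = 𝟙 _ :=
  congrArg Bimod.Hom.hom (tensorIso X Y).hom_inv_id

theorem proj_inv (X Y : RMod M) : proj X Y ≫ (tensorIso X Y).inv.hom =
    bproj ((toBimod M).obj X) ((toBimod M).obj Y) :=
  (congrArg (· ≫ _) (proj_eq X Y)).trans ((Category.assoc _ _ _).trans
    ((congrArg (_ ≫ ·) (tensorIso_hom_inv X Y)).trans (Category.comp_id _)))

theorem proj_inv_assoc (X Y : RMod M) {Z : C} (f : ((toBimod M).obj X ⊗ (toBimod M).obj Y).X ⟶ Z) :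
    proj X Y ≫ (tensorIso X Y).inv.hom ≫ f =
    bproj ((toBimod M).obj X) ((toBimod M).obj Y) ≫ f :=
  (Category.assoc _ _ _).symm.trans (congrArg (· ≫ f) (proj_inv X Y))

theorem bproj_inv (X Y : RMod M) : bproj ((toBimod M).obj X) ((toBimod M).obj Y) ≫
    (tensorIso X Y).hom.hom = proj X Y := (proj_eq X Y).symm

end aux

theorem proj_whiskerLeft (X : RMod M) {Y Z : RMod M} (f : Y ⟶ Z) :
    proj X Y ≫ Hom.f (X ◁ f) = X.X ◁ f.f ≫ proj X Z :=
  (proj_inv_assoc X Y _).trans <| (Category.assoc _ _ _).symm.trans <|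
    (congrArg (· ≫ _) (bproj_whiskerLeft _ _)).trans <| (Category.assoc _ _ _).trans <|
      congrArg (_ ≫ ·) (bproj_inv X Z)

theorem proj_whiskerRight {Y Z : RMod M} (f : Y ⟶ Z) (X : RMod M) :
    proj Y X ≫ Hom.f (f ▷ X) = f.f ▷ X.X ≫ proj Z X :=
  (proj_inv_assoc Y X _).trans <| (Category.assoc _ _ _).symm.trans <|
    (congrArg (· ≫ _) (bproj_whiskerRight _ _)).trans <| (Category.assoc _ _ _).trans <|
      congrArg (_ ≫ ·) (bproj_inv Z X)

theorem proj_tensorHom {X Y Z W : RMod M} (f : X ⟶ Y) (g : Z ⟶ W) :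
    proj X Z ≫ Hom.f (f ⊗ₘ g) = (f.f ⊗ₘ g.f) ≫ proj Y W := by
  rw [MonoidalCategory.tensorHom_def, MonoidalCategory.tensorHom_def, comp_f, ← Category.assoc,
    proj_whiskerRight, Category.assoc, proj_whiskerLeft, Category.assoc]

theorem leftUnitor_eq (X : RMod M) : (toBimod M).map (λ_ X).hom =
    (tensorIso (unit M) X).inv ≫ (unitIso M).inv ▷ (toBimod M).obj X ≫
      (λ_ ((toBimod M).obj X)).hom := by
  rw [(inducingData M).leftUnitor_eq X]
  simp [inducingData]
  rfl

theorem rightUnitor_eq (X : RMod M) : (toBimod M).map (ρ_ X).hom =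
    (tensorIso X (unit M)).inv ≫ (toBimod M).obj X ◁ (unitIso M).inv ≫
      (ρ_ ((toBimod M).obj X)).hom := by
  rw [(inducingData M).rightUnitor_eq X]
  simp [inducingData]
  rfl

theorem associator_eq (X Y Z : RMod M) : (toBimod M).map (α_ X Y Z).hom =
    (tensorIso (X ⊗ Y) Z).inv ≫ (tensorIso X Y).inv ▷ (toBimod M).obj Z ≫
      (α_ _ _ _).hom ≫ (toBimod M).obj X ◁ (tensorIso Y Z).hom ≫ (tensorIso X (Y ⊗ Z)).hom := by
  rw [(inducingData M).associator_eq X Y Z]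
  simp [inducingData]

theorem unit_aux {X₁ X₂ X₃ X₄ X₅ : C} {p : X₁ ⟶ X₂} {i : X₂ ⟶ X₃} {w : X₃ ⟶ X₄} {l : X₄ ⟶ X₅}
    {b : X₁ ⟶ X₃} {b' : X₁ ⟶ X₄} {a : X₁ ⟶ X₅} (h₁ : p ≫ i = b) (h₂ : b ≫ w = 𝟙 _ ≫ b')
    (h₃ : b' ≫ l = a) : p ≫ i ≫ w ≫ l = a := by
  rw [← h₃, ← Category.id_comp b', ← h₂, ← h₁]; simp

theorem proj_leftUnitor (X : RMod M) : proj (𝟙_ (RMod M)) X ≫ Hom.f (λ_ X).hom = X.lact := by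
  have h : Hom.f (λ_ X).hom = (tensorIso (unit M) X).inv.hom ≫
      Bimod.Hom.hom ((unitIso M).inv ▷ (toBimod M).obj X) ≫
      Bimod.Hom.hom (λ_ ((toBimod M).obj X)).hom := congrArg Bimod.Hom.hom (leftUnitor_eq X)
  rw [h]
  refine unit_aux (proj_inv _ _) ((bproj_whiskerRight _ _).trans ?_) (bproj_leftUnitor ((toBimod M).obj X))
  exact congrArg (· ≫ _) (id_whiskerRight _ _)

theorem proj_rightUnitor (X : RMod M) : proj X (𝟙_ (RMod M)) ≫ Hom.f (ρ_ X).hom = X.act := by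
  have h : Hom.f (ρ_ X).hom = (tensorIso X (unit M)).inv.hom ≫
      Bimod.Hom.hom ((toBimod M).obj X ◁ (unitIso M).inv) ≫
      Bimod.Hom.hom (ρ_ ((toBimod M).obj X)).hom := congrArg Bimod.Hom.hom (rightUnitor_eq X)
  rw [h]
  refine unit_aux (proj_inv _ _) ((bproj_whiskerLeft _ _).trans ?_) (bproj_rightUnitor ((toBimod M).obj X))
  exact congrArg (· ≫ _) (whiskerLeft_id _ _)

theorem assoc_aux {X₁ X₂ X₃ X₄ X₅ X₆ X₇ Y₁ Y₂ Y₃ Y₄ : C} {p₁ : X₁ ⟶ X₂} {p₂ : X₂ ⟶ X₃} {i₁ : X₃ ⟶ X₄}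
    {i₂ : X₄ ⟶ X₅} {a : X₅ ⟶ X₆} {j₁ : X₆ ⟶ X₇} {Z : C} {j₂ : X₇ ⟶ Z}
    {b : X₂ ⟶ X₄} (h₁ : p₂ ≫ i₁ = b) {i : X₂ ⟶ Y₁} {b₁ : Y₁ ⟶ X₅} (h₂ : b ≫ i₂ = i ≫ b₁)
    {c : X₁ ⟶ Y₁} (h₃ : p₁ ≫ i = c) {a' : X₁ ⟶ Y₂} {d : Y₂ ⟶ Y₃} {e : Y₃ ⟶ X₆}
    (h₄ : c ≫ b₁ ≫ a = a' ≫ d ≫ e) {j : Y₃ ⟶ Y₄} {f : Y₄ ⟶ X₇} (h₅ : e ≫ j₁ = j ≫ f)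
    {g : Y₂ ⟶ Y₄} {q : Y₄ ⟶ Z}
    (h₆ : d ≫ j = g) (h₇ : f ≫ j₂ = q) :
    p₁ ≫ p₂ ≫ i₁ ≫ i₂ ≫ a ≫ j₁ ≫ j₂ = a' ≫ g ≫ q := by
  calc _ = p₁ ≫ (p₂ ≫ i₁) ≫ i₂ ≫ a ≫ j₁ ≫ j₂ := by simp
    _ = p₁ ≫ (b ≫ i₂) ≫ a ≫ j₁ ≫ j₂ := by rw [h₁]; simp
    _ = (p₁ ≫ i) ≫ b₁ ≫ a ≫ j₁ ≫ j₂ := by rw [h₂]; simp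
    _ = (c ≫ b₁ ≫ a) ≫ j₁ ≫ j₂ := by rw [h₃]; simp
    _ = a' ≫ d ≫ (e ≫ j₁) ≫ j₂ := by rw [h₄]; simp
    _ = a' ≫ (d ≫ j) ≫ (f ≫ j₂) := by rw [h₅]; simp
    _ = _ := by rw [h₆, h₇]

theorem proj_associator (X Y Z : RMod M) :
    proj X Y ▷ Z.X ≫ proj (X ⊗ Y) Z ≫ Hom.f (α_ X Y Z).hom =
      (α_ _ _ _).hom ≫ X.X ◁ proj Y Z ≫ proj X (Y ⊗ Z) := by
  have h : Hom.f (α_ X Y Z).hom = (tensorIso (X ⊗ Y) Z).inv.hom ≫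
      Bimod.Hom.hom ((tensorIso X Y).inv ▷ (toBimod M).obj Z) ≫
      Bimod.Hom.hom (α_ ((toBimod M).obj X) ((toBimod M).obj Y) ((toBimod M).obj Z)).hom ≫
      Bimod.Hom.hom ((toBimod M).obj X ◁ (tensorIso Y Z).hom) ≫
      (tensorIso X (Y ⊗ Z)).hom.hom := congrArg Bimod.Hom.hom (associator_eq X Y Z)
  rw [h]
  exact assoc_aux (proj_inv _ _) (bproj_whiskerRight _ _)
    ((comp_whiskerRight _ _ _).symm.trans (congrArg (· ▷ Z.X) (proj_inv X Y)))
    (bproj_associator ((toBimod M).obj X) ((toBimod M).obj Y) ((toBimod M).obj Z)) (bproj_whiskerLeft _ _)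
    ((whiskerLeft_comp _ _ _).symm.trans (congrArg (X.X ◁ ·) (bproj_inv Y Z))) (bproj_inv _ _)

variable (M) in
/-- The forgetful functor is lax monoidal, through the projections `X ⊗ Y → X ⊗_M Y`. -/
instance : (forg M).LaxMonoidal where
  ε := MonObj.one (X := (mon M).X)
  μ X Y := proj X Y
  μ_natural_left f X := (proj_whiskerRight f X).symm
  μ_natural_right X f := (proj_whiskerLeft X f).symm
  associativity X Y Z := proj_associator X Y Z
  left_unitality X := by
    change _ = MonObj.one (X := (mon M).X) ▷ X.X ≫ proj (𝟙_ (RMod M)) X ≫ Hom.f (λ_ X).hom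
    rw [proj_leftUnitor]
    exact (toBimodObj X).one_actLeft.symm
  right_unitality X := by
    change _ = X.X ◁ MonObj.one (X := (mon M).X) ≫ proj X (𝟙_ (RMod M)) ≫ Hom.f (ρ_ X).hom
    rw [proj_rightUnitor]
    exact X.act_one.symm

end RMod
end RModLax

/-! ### Local modules over a commutative monoid in a braided category -/

section Local

variable {C : Type u₁} [Category.{v₁} C] [MonoidalCategory C] [BraidedCategory C]

instance ofBraidedBraided : (Center.ofBraided C).Braided where
  braided X Y := by
    apply Center.ext
    change 𝟙 _ ≫ (β_ X Y).hom = (β_ X Y).hom ≫ 𝟙 _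
    rw [Category.id_comp, Category.comp_id]

/-- A commutative monoid in a braided category is a commutative central monoid, with the braiding as
half-braiding. -/
def central (N : CommMon C) : CommMon (Center C) := (Center.ofBraided C).mapCommMon.obj N

/-- The underlying object of `N`. -/
abbrev car (N : CommMon C) : C := (mon (central N)).X

theorem swap_central (N : CommMon C) (U : C) : swap (central N) U = β_ (car N) U := rfl

/-- A module is local if the double braiding with `N` does not change the action. -/
def isLocal (N : CommMon C) : ObjectProperty (RMod (central N)) := fun X =>
  (β_ X.X (car N)).hom ≫ (β_ (car N) X.X).hom ≫ X.act = X.act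

namespace RMod

variable {N : CommMon C}

theorem lact_eq (X : RMod (central N)) : X.lact = (β_ (car N) X.X).hom ≫ X.act := rfl

theorem act_eq (X : RMod (central N)) : X.act = (β_ (car N) X.X).inv ≫ X.lact := by
  rw [lact_eq, Iso.inv_hom_id_assoc]

theorem act_eq_of_local {X : RMod (central N)} (h : isLocal N X) :
    X.act = (β_ X.X (car N)).hom ≫ X.lact := h.symm

theorem lact_eq_of_local {X : RMod (central N)} (h : isLocal N X) :
    X.lact = (β_ X.X (car N)).inv ≫ X.act := by
  rw [Iso.eq_inv_comp]; exact h

variable [HasCoequalizers C] [∀ X : C, PreservesColimitsOfSize.{0, 0} (tensorLeft X)]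
  [∀ X : C, PreservesColimitsOfSize.{0, 0} (tensorRight X)]

theorem lact_proj (X Y : RMod (central N)) : X.X ◁ Y.lact ≫ proj X Y =
    (α_ _ _ _).inv ≫ X.act ▷ Y.X ≫ proj X Y := by
  rw [proj_condition, Iso.inv_hom_id_assoc]

theorem act_proj_of_local {X : RMod (central N)} (h : isLocal N X) (Y : RMod (central N)) :
    Y.X ◁ X.act ≫ proj Y X = Y.X ◁ (β_ X.X (car N)).hom ≫ (α_ _ _ _).inv ≫ Y.act ▷ X.X ≫
      proj Y X := by
  rw [act_eq_of_local h, whiskerLeft_comp, Category.assoc, lact_proj]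

/-- The braiding of the base category descends to the relative tensor product. -/
def locHom {X : RMod (central N)} (h : isLocal N X) (Y : RMod (central N)) :
    (X ⊗ Y).X ⟶ (Y ⊗ X).X :=
  desc ((β_ X.X Y.X).hom ≫ proj Y X) (by
    rw [BraidedCategory.braiding_naturality_left_assoc, act_proj_of_local h, lact_eq,
      BraidedCategory.braiding_tensor_left_hom]
    simp only [whiskerLeft_comp, Category.assoc]
    rw [BraidedCategory.braiding_naturality_right_assoc, BraidedCategory.braiding_tensor_right_hom]
    simp)

/-- The inverse braiding of the base category descends to the relative tensor product. -/
def locInv {X : RMod (central N)} (h : isLocal N X) (Y : RMod (central N)) :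
    (Y ⊗ X).X ⟶ (X ⊗ Y).X :=
  desc ((β_ X.X Y.X).inv ≫ proj X Y) (by
    rw [BraidedCategory.braiding_inv_naturality_left_assoc, act_eq Y, whiskerLeft_comp,
      Category.assoc, lact_proj, lact_eq_of_local h, whiskerLeft_comp, Category.assoc,
      BraidedCategory.braiding_inv_naturality_right_assoc, BraidedCategory.braiding_tensor_left_inv,
      BraidedCategory.braiding_tensor_right_inv]
    simp)

theorem proj_locHom {X : RMod (central N)} (h : isLocal N X) (Y : RMod (central N)) :
    proj X Y ≫ locHom h Y = (β_ X.X Y.X).hom ≫ proj Y X := proj_desc _ _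

theorem proj_locInv {X : RMod (central N)} (h : isLocal N X) (Y : RMod (central N)) :
    proj Y X ≫ locInv h Y = (β_ X.X Y.X).inv ≫ proj X Y := proj_desc _ _

theorem proj_locHom_assoc {X : RMod (central N)} (h : isLocal N X) (Y : RMod (central N))
    {Z : C} (f : _ ⟶ Z) :
    proj X Y ≫ locHom h Y ≫ f = (β_ X.X Y.X).hom ≫ proj Y X ≫ f := by
  rw [← Category.assoc, proj_locHom, Category.assoc]

theorem proj_locInv_assoc {X : RMod (central N)} (h : isLocal N X) (Y : RMod (central N))
    {Z : C} (f : _ ⟶ Z) :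
    proj Y X ≫ locInv h Y ≫ f = (β_ X.X Y.X).inv ≫ proj X Y ≫ f := by
  rw [← Category.assoc, proj_locInv, Category.assoc]

/-- The induced isomorphism of modules. -/
def locIso {X : RMod (central N)} (h : isLocal N X) (Y : RMod (central N)) : X ⊗ Y ≅ Y ⊗ X where
  hom := ⟨locHom h Y, by
    apply (cancel_epi (proj X Y ▷ (car N))).1
    rw [← Category.assoc, proj_act, Category.assoc, Category.assoc, proj_locHom,
      BraidedCategory.braiding_naturality_right_assoc, ← comp_whiskerRight_assoc, proj_locHom,
      comp_whiskerRight, Category.assoc, proj_act, act_proj_of_local h,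
      BraidedCategory.braiding_tensor_right_hom]
    simp⟩
  inv := ⟨locInv h Y, by
    apply (cancel_epi (proj Y X ▷ (car N))).1
    rw [← Category.assoc, proj_act, Category.assoc, Category.assoc, proj_locInv,
      BraidedCategory.braiding_inv_naturality_right_assoc, ← comp_whiskerRight_assoc, proj_locInv,
      comp_whiskerRight, Category.assoc, proj_act, act_eq Y, whiskerLeft_comp, Category.assoc,
      proj_condition, BraidedCategory.braiding_tensor_left_inv]
    simp⟩
  hom_inv_id := hom_ext (desc_ext (by
    rw [comp_f, proj_locHom_assoc, proj_locInv, Iso.hom_inv_id_assoc, id_f, Category.comp_id]))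
  inv_hom_id := hom_ext (desc_ext (by
    rw [comp_f, proj_locInv_assoc, proj_locHom, Iso.inv_hom_id_assoc, id_f, Category.comp_id]))

theorem proj_whiskerLeft_assoc (X : RMod (central N)) {Y Z : RMod (central N)} (f : Y ⟶ Z) {W : C}
    (g : (X ⊗ Z).X ⟶ W) : proj X Y ≫ Hom.f (X ◁ f) ≫ g = X.X ◁ f.f ≫ proj X Z ≫ g := by
  rw [← Category.assoc, proj_whiskerLeft, Category.assoc]

theorem proj_whiskerRight_assoc {Y Z : RMod (central N)} (f : Y ⟶ Z) (X : RMod (central N)) {W : C}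
    (g : (Z ⊗ X).X ⟶ W) : proj Y X ≫ Hom.f (f ▷ X) ≫ g = f.f ▷ X.X ≫ proj Z X ≫ g := by
  rw [← Category.assoc, proj_whiskerRight, Category.assoc]

theorem proj_associator_assoc (X Y Z : RMod (central N)) {W : C} (g : (X ⊗ Y ⊗ Z).X ⟶ W) :
    proj X Y ▷ Z.X ≫ proj (X ⊗ Y) Z ≫ Hom.f (α_ X Y Z).hom ≫ g =
      (α_ _ _ _).hom ≫ X.X ◁ proj Y Z ≫ proj X (Y ⊗ Z) ≫ g := by
  rw [← Category.assoc (proj (X ⊗ Y) Z), ← Category.assoc (proj X Y ▷ Z.X), proj_associator]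
  simp only [Category.assoc]

theorem proj_associator_inv (X Y Z : RMod (central N)) :
    X.X ◁ proj Y Z ≫ proj X (Y ⊗ Z) ≫ Hom.f (α_ X Y Z).inv =
      (α_ _ _ _).inv ≫ proj X Y ▷ Z.X ≫ proj (X ⊗ Y) Z := by
  rw [Iso.eq_inv_comp, ← proj_associator_assoc, ← comp_f, Iso.hom_inv_id, id_f, Category.comp_id]

theorem proj_associator_inv_assoc (X Y Z : RMod (central N)) {W : C} (g : ((X ⊗ Y) ⊗ Z).X ⟶ W) :
    X.X ◁ proj Y Z ≫ proj X (Y ⊗ Z) ≫ Hom.f (α_ X Y Z).inv ≫ g =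
      (α_ _ _ _).inv ≫ proj X Y ▷ Z.X ≫ proj (X ⊗ Y) Z ≫ g := by
  rw [← Category.assoc (proj X (Y ⊗ Z)), ← Category.assoc (X.X ◁ proj Y Z), proj_associator_inv]
  simp only [Category.assoc]

theorem loc_nat_right {X : RMod (central N)} (h : isLocal N X) {Y Z : RMod (central N)}
    (f : Y ⟶ Z) : X ◁ f ≫ (locIso h Z).hom = (locIso h Y).hom ≫ f ▷ X := hom_ext <| desc_ext <| by
  rw [comp_f, comp_f, proj_whiskerLeft_assoc]
  change _ ≫ proj X Z ≫ locHom h Z = _ ≫ locHom h Y ≫ _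
  rw [proj_locHom, proj_locHom_assoc, proj_whiskerRight,
    BraidedCategory.braiding_naturality_right_assoc]

theorem loc_nat_left {X Y : RMod (central N)} (hX : isLocal N X) (hY : isLocal N Y) (f : X ⟶ Y)
    (Z : RMod (central N)) :
    f ▷ Z ≫ (locIso hY Z).hom = (locIso hX Z).hom ≫ Z ◁ f := hom_ext <| desc_ext <| by
  rw [comp_f, comp_f, proj_whiskerRight_assoc]
  change _ ≫ proj Y Z ≫ locHom hY Z = _ ≫ locHom hX Z ≫ _
  rw [proj_locHom, proj_locHom_assoc, proj_whiskerLeft,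
    BraidedCategory.braiding_naturality_left_assoc]

theorem loc_hexagon {X Y : RMod (central N)} (hX : isLocal N X) (Z : RMod (central N)) :
    (α_ X Y Z).hom ≫ (locIso hX (Y ⊗ Z)).hom ≫ (α_ Y Z X).hom =
      (locIso hX Y).hom ▷ Z ≫ (α_ Y X Z).hom ≫ Y ◁ (locIso hX Z).hom :=
  hom_ext <| desc_ext <| (cancel_epi (proj X Y ▷ Z.X)).1 <| by
    simp only [comp_f]
    rw [proj_associator_assoc, proj_whiskerRight_assoc]
    change _ ≫ _ ≫ _ ≫ locHom hX _ ≫ _ = _ ≫ locHom hX Y ▷ Z.X ≫ _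
    rw [proj_locHom_assoc, ← comp_whiskerRight_assoc, proj_locHom, comp_whiskerRight,
      BraidedCategory.braiding_naturality_right_assoc, proj_associator, Category.assoc,
      proj_associator_assoc, proj_whiskerLeft, ← whiskerLeft_comp_assoc]
    change _ = _ ≫ _ ≫ Y.X ◁ (proj X Z ≫ locHom hX Z) ≫ _
    rw [proj_locHom]
    simp

theorem loc_hexagon' {X Y : RMod (central N)} (hX : isLocal N X) (hY : isLocal N Y)
    (hXY : isLocal N (X ⊗ Y)) (Z : RMod (central N)) :
    (α_ X Y Z).inv ≫ (locIso hXY Z).hom ≫ (α_ Z X Y).inv =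
      X ◁ (locIso hY Z).hom ≫ (α_ X Z Y).inv ≫ (locIso hX Z).hom ▷ Y :=
  hom_ext <| desc_ext <| (cancel_epi (X.X ◁ proj Y Z)).1 <| by
    simp only [comp_f]
    rw [proj_associator_inv_assoc, proj_whiskerLeft_assoc]
    change _ ≫ _ ≫ _ ≫ locHom hXY _ ≫ _ = _ ≫ X.X ◁ locHom hY Z ≫ _
    rw [proj_locHom_assoc, ← whiskerLeft_comp_assoc, proj_locHom, whiskerLeft_comp,
      BraidedCategory.braiding_naturality_left_assoc, proj_associator_inv, Category.assoc,
      proj_associator_inv_assoc, proj_whiskerRight, ← comp_whiskerRight_assoc]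
    change _ = _ ≫ _ ≫ (proj X Z ≫ locHom hX Z) ▷ Y.X ≫ _
    rw [proj_locHom]
    simp

theorem isLocal_unit : isLocal N (𝟙_ (RMod (central N))) := by
  have h := swap_comm (central N)
  rw [swap_central] at h
  have h' : (𝟙_ (RMod (central N))).act = MonObj.mul (X := (mon (central N)).X) := rfl
  change (β_ (car N) (car N)).hom ≫ (β_ (car N) (car N)).hom ≫
    MonObj.mul (X := (mon (central N)).X) = MonObj.mul (X := (mon (central N)).X)
  rw [h, h]

theorem isLocal_tensor {X Y : RMod (central N)} (hX : isLocal N X) (hY : isLocal N Y) :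
    isLocal N (X ⊗ Y) := by
  unfold isLocal
  apply (cancel_epi (proj X Y ▷ (car N))).1
  rw [BraidedCategory.braiding_naturality_left_assoc,
    BraidedCategory.braiding_naturality_right_assoc, proj_act,
    BraidedCategory.braiding_tensor_left_hom, BraidedCategory.braiding_tensor_right_hom]
  simp only [Category.assoc, Iso.inv_hom_id_assoc]
  rw [← whiskerLeft_comp_assoc _ (β_ (car N) Y.X).hom Y.act, ← lact_eq, lact_proj]
  simp only [Iso.hom_inv_id_assoc]
  rw [← comp_whiskerRight_assoc, ← comp_whiskerRight_assoc, Category.assoc]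
  have hX' : (β_ X.X (car N)).hom ≫ (β_ (car N) X.X).hom ≫ X.act = X.act := hX
  rw [hX', proj_condition, Iso.inv_hom_id_assoc, ← whiskerLeft_comp_assoc, ← act_eq_of_local hY]

end RMod

variable [HasCoequalizers C] [∀ X : C, PreservesColimitsOfSize.{0, 0} (tensorLeft X)]
  [∀ X : C, PreservesColimitsOfSize.{0, 0} (tensorRight X)]

instance (N : CommMon C) : (isLocal N).IsMonoidal where
  prop_unit := RMod.isLocal_unit
  prop_tensor _ _ := RMod.isLocal_tensor

/-- The category of local modules, a full monoidal subcategory of the category of modules. -/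
abbrev Loc (N : CommMon C) := (isLocal N).FullSubcategory

namespace Loc

variable {N : CommMon C}

instance : BraidedCategory (Loc N) where
  braiding X Y := (isLocal N).isoMk (RMod.locIso X.2 Y.1)
  braiding_naturality_right X _ _ f := ObjectProperty.hom_ext _ (RMod.loc_nat_right X.2 f.hom)
  braiding_naturality_left {X Y} f Z :=
    ObjectProperty.hom_ext _ (RMod.loc_nat_left X.2 Y.2 f.hom Z.1)
  hexagon_forward X _ Z := ObjectProperty.hom_ext _ (RMod.loc_hexagon X.2 Z.1)
  hexagon_reverse X Y Z := ObjectProperty.hom_ext _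
    (RMod.loc_hexagon' X.2 Y.2 (RMod.isLocal_tensor X.2 Y.2) Z.1)

variable (N) in
/-- The forgetful functor from local modules. -/
abbrev forg : Loc N ⥤ C := (isLocal N).ι ⋙ RMod.forg (central N)

instance : (forg N).LaxBraided where
  braided X Y := by
    have h : Functor.LaxMonoidal.μ (forg N) X Y = RMod.proj X.1 Y.1 :=
      Category.comp_id (RMod.proj X.1 Y.1)
    have h' : Functor.LaxMonoidal.μ (forg N) Y X = RMod.proj Y.1 X.1 :=
      Category.comp_id (RMod.proj Y.1 X.1)
    rw [h, h']
    exact RMod.proj_locHom X.2 Y.1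

end Loc

end Local

/-! ## The functor on Drinfeld centers induced by the right adjoint of a monoidal functor -/

namespace CenterFunctor

open Functor.LaxMonoidal Functor.OplaxMonoidal

variable {C : Type u₁} [Category.{v₁} C] [MonoidalCategory C]
  {D : Type u₂} [Category.{v₂} D] [MonoidalCategory D]
  {G : C ⥤ D} {R : D ⥤ C} [G.Monoidal] [R.LaxMonoidal] (adj : G ⊣ R) [adj.IsMonoidal]

/-- The unit of the adjunction. -/
abbrev un (A : C) : A ⟶ R.obj (G.obj A) := adj.unit.app A

/-- The counit of the adjunction. -/
abbrev cu (X : D) : G.obj (R.obj X) ⟶ X := adj.counit.app X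

theorem cu_nat {X Y : D} (f : X ⟶ Y) : G.map (R.map f) ≫ cu adj Y = cu adj X ≫ f :=
  adj.counit_naturality f

theorem un_cu (X : D) : un adj (R.obj X) ≫ R.map (cu adj X) = 𝟙 (R.obj X) :=
  adj.right_triangle_components X

/-- The left projection formula morphism `A ⊗ R X → R (G A ⊗ X)`. -/
def lproj (A : C) (X : D) : A ⊗ R.obj X ⟶ R.obj (G.obj A ⊗ X) :=
  un adj A ▷ R.obj X ≫ μ R (G.obj A) X

/-- The right projection formula morphism `R X ⊗ A → R (X ⊗ G A)`. -/
def rproj (X : D) (A : C) : R.obj X ⊗ A ⟶ R.obj (X ⊗ G.obj A) :=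
  R.obj X ◁ un adj A ≫ μ R X (G.obj A)

/-- The projection formula holds: the projection formula morphisms are isomorphisms. -/
class ProjectionFormula : Prop where
  isIso_lproj : ∀ A X, IsIso (lproj adj A X)
  isIso_rproj : ∀ X A, IsIso (rproj adj X A)

attribute [instance] ProjectionFormula.isIso_lproj ProjectionFormula.isIso_rproj

/-- The transpose of `lproj`. -/
def ltr (A : C) (X : D) : G.obj (A ⊗ R.obj X) ⟶ G.obj A ⊗ X :=
  δ G A (R.obj X) ≫ G.obj A ◁ cu adj X

/-- The transpose of `rproj`. -/
def rtr (X : D) (A : C) : G.obj (R.obj X ⊗ A) ⟶ X ⊗ G.obj A :=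
  δ G (R.obj X) A ≫ cu adj X ▷ G.obj A

theorem homEquiv_ltr (A : C) (X : D) : adj.homEquiv _ _ (ltr adj A X) = lproj adj A X := by
  have h₁ : un adj (A ⊗ R.obj X) ≫ R.map (δ G A (R.obj X)) =
      (un adj A ▷ R.obj X ≫ R.obj (G.obj A) ◁ un adj (R.obj X)) ≫
        μ R (G.obj A) (G.obj (R.obj X)) :=
    (adj.unit_app_tensor_comp_map_δ A (R.obj X)).trans
      (congrArg (· ≫ μ R _ _) (MonoidalCategory.tensorHom_def _ _))
  have h₂ : μ R (G.obj A) (G.obj (R.obj X)) ≫ R.map (G.obj A ◁ cu adj X) =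
      R.obj (G.obj A) ◁ R.map (cu adj X) ≫ μ R (G.obj A) X :=
    (μ_natural_right R _ _).symm
  have h₃ : R.obj (G.obj A) ◁ un adj (R.obj X) ≫ R.obj (G.obj A) ◁ R.map (cu adj X)
      = 𝟙 _ := (whiskerLeft_comp _ _ _).symm.trans
        ((congrArg (R.obj (G.obj A) ◁ ·) (un_cu adj X)).trans
          (whiskerLeft_id _ _))
  rw [Adjunction.homEquiv_apply, ltr, R.map_comp]
  refine (Category.assoc _ _ _).symm.trans ?_
  refine (congrArg (· ≫ _) h₁).trans ?_
  refine (Category.assoc _ _ _).trans ?_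
  refine (congrArg (_ ≫ ·) h₂).trans ?_
  rw [Category.assoc, ← Category.assoc (_ ◁ _), h₃, Category.id_comp]
  rfl

theorem homEquiv_rtr (X : D) (A : C) : adj.homEquiv _ _ (rtr adj X A) = rproj adj X A := by
  have h₁ : un adj (R.obj X ⊗ A) ≫ R.map (δ G (R.obj X) A) =
      (R.obj X ◁ un adj A ≫ un adj (R.obj X) ▷ R.obj (G.obj A)) ≫
        μ R (G.obj (R.obj X)) (G.obj A) :=
    (adj.unit_app_tensor_comp_map_δ (R.obj X) A).trans
      (congrArg (· ≫ μ R _ _) (MonoidalCategory.tensorHom_def' _ _))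
  have h₂ : μ R (G.obj (R.obj X)) (G.obj A) ≫ R.map (cu adj X ▷ G.obj A) =
      R.map (cu adj X) ▷ R.obj (G.obj A) ≫ μ R X (G.obj A) :=
    (μ_natural_left R _ _).symm
  have h₃ : un adj (R.obj X) ▷ R.obj (G.obj A) ≫ R.map (cu adj X) ▷ R.obj (G.obj A)
      = 𝟙 _ := (comp_whiskerRight _ _ _).symm.trans
        ((congrArg (· ▷ R.obj (G.obj A)) (un_cu adj X)).trans
          (id_whiskerRight _ _))
  rw [Adjunction.homEquiv_apply, rtr, R.map_comp]
  refine (Category.assoc _ _ _).symm.trans ?_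
  refine (congrArg (· ≫ _) h₁).trans ?_
  refine (Category.assoc _ _ _).trans ?_
  refine (congrArg (_ ≫ ·) h₂).trans ?_
  rw [Category.assoc, ← Category.assoc (_ ▷ _), h₃, Category.id_comp]
  rfl

theorem homEquiv_map_ltr {W A : C} {X : D} (f : W ⟶ A ⊗ R.obj X) :
    adj.homEquiv _ _ (G.map f ≫ ltr adj A X) = f ≫ lproj adj A X := by
  rw [Adjunction.homEquiv_naturality_left, homEquiv_ltr]

variable [ProjectionFormula adj]

/-- A morphism into `A ⊗ R X` is determined by its transpose. -/
theorem ltr_ext {W A : C} {X : D} {f g : W ⟶ A ⊗ R.obj X}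
    (w : G.map f ≫ ltr adj A X = G.map g ≫ ltr adj A X) : f = g := by
  rw [← cancel_mono (lproj adj A X), ← homEquiv_map_ltr, ← homEquiv_map_ltr, w]

/-- The half-braiding `R X ⊗ A ≅ A ⊗ R X` induced by a half-braiding on `X`. -/
def swapIso {X : D} (c : HalfBraiding X) (A : C) : R.obj X ⊗ A ≅ A ⊗ R.obj X :=
  asIso (rproj adj X A) ≪≫ R.mapIso (c.β (G.obj A)) ≪≫ (asIso (lproj adj A X)).symm

theorem swapIso_ltr {X : D} (c : HalfBraiding X) (A : C) :
    G.map (swapIso adj c A).hom ≫ ltr adj A X = rtr adj X A ≫ (c.β (G.obj A)).hom := by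
  apply (adj.homEquiv _ _).injective
  rw [homEquiv_map_ltr, Adjunction.homEquiv_naturality_right, homEquiv_rtr]
  simp [swapIso]

theorem swapIso_ltr_assoc {X : D} (c : HalfBraiding X) (A : C) {Z : D} (f : G.obj A ⊗ X ⟶ Z) :
    G.map (swapIso adj c A).hom ≫ ltr adj A X ≫ f =
    rtr adj X A ≫ (c.β (G.obj A)).hom ≫ f := by
  rw [← Category.assoc, swapIso_ltr, Category.assoc]

theorem ltr_nat_left {A A' : C} (f : A ⟶ A') (X : D) :
    G.map (f ▷ R.obj X) ≫ ltr adj A' X = ltr adj A X ≫ G.map f ▷ X := by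
  simp only [ltr, ← δ_natural_left_assoc, Category.assoc]
  erw [whisker_exchange]

theorem ltr_nat_right (A : C) {X Y : D} (f : X ⟶ Y) :
    G.map (A ◁ R.map f) ≫ ltr adj A Y = ltr adj A X ≫ G.obj A ◁ f := by
  simp only [ltr, ← δ_natural_right_assoc, Category.assoc, ← whiskerLeft_comp, cu_nat]

theorem rtr_nat_right {A A' : C} (f : A ⟶ A') (X : D) :
    G.map (R.obj X ◁ f) ≫ rtr adj X A' = rtr adj X A ≫ X ◁ G.map f := by
  simp only [rtr, ← δ_natural_right_assoc, Category.assoc]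
  erw [whisker_exchange]

theorem rtr_nat_left (A : C) {X Y : D} (f : X ⟶ Y) :
    G.map (R.map f ▷ A) ≫ rtr adj Y A = rtr adj X A ≫ f ▷ G.obj A := by
  simp only [rtr, ← δ_natural_left_assoc, Category.assoc, ← comp_whiskerRight, cu_nat]

theorem reassoc_aux {E : Type*} [Category* E] {X₁ X₂ X₃ X₄ X₅ X₆ X₇ : E} {f₁ : X₁ ⟶ X₂}
    {f₂ : X₂ ⟶ X₃} {f₃ : X₃ ⟶ X₄} {g₁ : X₁ ⟶ X₅} {g₂ : X₅ ⟶ X₆} {g₃ : X₆ ⟶ X₄}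
    (h : f₁ ≫ f₂ ≫ f₃ = g₁ ≫ g₂ ≫ g₃) (k : X₄ ⟶ X₇) :
    f₁ ≫ f₂ ≫ f₃ ≫ k = g₁ ≫ g₂ ≫ g₃ ≫ k := by
  simpa using congrArg (· ≫ k) h

theorem ltr_tensor (A A' : C) (X : D) :
    ltr adj (A ⊗ A') X ≫ δ G A A' ▷ X ≫ (α_ _ _ _).hom =
      G.map (α_ _ _ _).hom ≫ δ G A (A' ⊗ R.obj X) ≫ G.obj A ◁ ltr adj A' X := by
  have h := Functor.OplaxMonoidal.associativity (F := G) A A' (R.obj X)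
  simp only [ltr, whiskerLeft_comp, Category.assoc]
  rw [← reassoc_aux h]
  rw [whisker_exchange_assoc]
  simp

theorem rtr_tensor (A A' : C) (X : D) :
    rtr adj X (A ⊗ A') ≫ X ◁ δ G A A' ≫ (α_ _ _ _).inv =
      G.map (α_ _ _ _).inv ≫ δ G (R.obj X ⊗ A) A' ≫ rtr adj X A ▷ G.obj A' := by
  have h := Functor.OplaxMonoidal.associativity_inv (F := G) (R.obj X) A A'
  simp only [rtr, comp_whiskerRight, Category.assoc]
  rw [← reassoc_aux h]
  rw [← whisker_exchange_assoc]
  simp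

theorem ltr_rtr (A A' : C) (X : D) :
    δ G (A ⊗ R.obj X) A' ≫ ltr adj A X ▷ G.obj A' ≫ (α_ _ _ _).hom =
      G.map (α_ _ _ _).hom ≫ δ G A (R.obj X ⊗ A') ≫ G.obj A ◁ rtr adj X A' := by
  have h := Functor.OplaxMonoidal.associativity (F := G) A (R.obj X) A'
  simp only [ltr, rtr, comp_whiskerRight, whiskerLeft_comp, Category.assoc]
  rw [← reassoc_aux h]
  simp

/-- The half-braiding on `R X` induced by one on `X`. -/
def halfBraiding {X : D} (c : HalfBraiding X) : HalfBraiding (R.obj X) where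
  β := swapIso adj c
  naturality f := ltr_ext adj (by
    rw [G.map_comp, G.map_comp, Category.assoc, Category.assoc, swapIso_ltr, ltr_nat_left,
      ← Category.assoc, rtr_nat_right, swapIso_ltr_assoc, Category.assoc, c.naturality])
  monoidal A A' := ltr_ext adj (by
    rw [← cancel_mono (δ G A A' ▷ X ≫ (α_ _ _ _).hom), Category.assoc, Category.assoc,
      swapIso_ltr_assoc, ← HalfBraiding.naturality_assoc, HalfBraiding.monoidal, ltr_tensor]
    simp only [Category.assoc, Iso.inv_hom_id, Category.comp_id, G.map_comp]
    rw [reassoc_aux (rtr_tensor adj A A' X), ← G.map_comp_assoc (α_ _ _ _).inv (α_ _ _ _).hom,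
      Iso.inv_hom_id, G.map_id, Category.id_comp, ← δ_natural_right_assoc, ← whiskerLeft_comp,
      swapIso_ltr, whiskerLeft_comp, ← reassoc_aux (ltr_rtr adj A A' X), ← δ_natural_left_assoc,
      ← comp_whiskerRight_assoc, ← comp_whiskerRight_assoc, swapIso_ltr])

/-- The functor on objects. -/
def obj (X : Center D) : Center C := ⟨R.obj X.1, halfBraiding adj X.2⟩

theorem map_comm {X Y : D} {c : HalfBraiding X} {d : HalfBraiding Y} (f : X ⟶ Y)
    (w : ∀ U, f ▷ U ≫ (d.β U).hom = (c.β U).hom ≫ U ◁ f) (A : C) :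
    R.map f ▷ A ≫ (swapIso adj d A).hom = (swapIso adj c A).hom ≫ A ◁ R.map f :=
  ltr_ext adj (by
    rw [G.map_comp, G.map_comp, Category.assoc, Category.assoc, swapIso_ltr, ltr_nat_right,
      ← Category.assoc, rtr_nat_left, swapIso_ltr_assoc, Category.assoc, w])

/-- The functor on morphisms. -/
def map {X Y : Center D} (f : X ⟶ Y) : obj adj X ⟶ obj adj Y where
  f := R.map f.f
  comm A := map_comm adj f.f f.comm A

/-! ### The lax monoidal structure -/

theorem cu_ε : G.map (ε R) ≫ cu adj (𝟙_ D) = η G := adj.map_ε_comp_counit_app_unit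

/-- The transpose of the structure morphism `R X ⊗ R Y ⟶ R (X ⊗ Y)`. -/
def mtr (X Y : D) : G.obj (R.obj X ⊗ R.obj Y) ⟶ X ⊗ Y :=
  δ G _ _ ≫ cu adj X ▷ _ ≫ X ◁ cu adj Y

theorem cu_μ (X Y : D) : G.map (μ R X Y) ≫ cu adj (X ⊗ Y) = mtr adj X Y :=
  (adj.map_μ_comp_counit_app_tensor X Y).trans
    (congrArg (δ G _ _ ≫ ·) (MonoidalCategory.tensorHom_def (cu adj X) (cu adj Y)))

theorem ltr_cu (X Y : D) : ltr adj (R.obj Y) X ≫ cu adj Y ▷ X = mtr adj Y X := by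
  rw [ltr, mtr, Category.assoc, whisker_exchange]

theorem rtr_cu (X Y : D) : rtr adj X (R.obj Y) ≫ X ◁ cu adj Y = mtr adj X Y := by
  rw [rtr, mtr, Category.assoc]

theorem rtr_ε (U : C) : G.map (ε R ▷ U) ≫ rtr adj (𝟙_ D) U =
    G.map (λ_ U).hom ≫ (λ_ (G.obj U)).inv := by
  rw [rtr, ← δ_natural_left_assoc, ← comp_whiskerRight, cu_ε]
  have h := Functor.OplaxMonoidal.left_unitality_hom G U
  rw [Iso.eq_comp_inv, Category.assoc, h]

theorem ltr_ε (U : C) : G.map (U ◁ ε R) ≫ ltr adj U (𝟙_ D) =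
    G.map (ρ_ U).hom ≫ (ρ_ (G.obj U)).inv := by
  rw [ltr, ← δ_natural_right_assoc, ← whiskerLeft_comp, cu_ε]
  have h := Functor.OplaxMonoidal.right_unitality_hom G U
  rw [Iso.eq_comp_inv, Category.assoc, h]

theorem rtr_μ (X Y : D) (U : C) : G.map (μ R X Y ▷ U) ≫ rtr adj (X ⊗ Y) U =
    δ G (R.obj X ⊗ R.obj Y) U ≫ mtr adj X Y ▷ G.obj U := by
  rw [rtr, ← δ_natural_left_assoc, ← comp_whiskerRight, cu_μ]

theorem ltr_μ (X Y : D) (U : C) : G.map (U ◁ μ R X Y) ≫ ltr adj U (X ⊗ Y) =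
    δ G U (R.obj X ⊗ R.obj Y) ≫ G.obj U ◁ mtr adj X Y := by
  rw [ltr, ← δ_natural_right_assoc, ← whiskerLeft_comp, cu_μ]

theorem mtr_rtr (X Y : D) (U : C) :
    δ G (R.obj X ⊗ R.obj Y) U ≫ mtr adj X Y ▷ G.obj U ≫ (α_ _ _ _).hom =
      G.map (α_ _ _ _).hom ≫ δ G (R.obj X) (R.obj Y ⊗ U) ≫ G.obj (R.obj X) ◁ rtr adj Y U ≫
        cu adj X ▷ _ := by
  have h := Functor.OplaxMonoidal.associativity (F := G) (R.obj X) (R.obj Y) U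
  simp only [mtr, rtr, comp_whiskerRight, whiskerLeft_comp, Category.assoc]
  rw [← reassoc_aux h, whisker_exchange]
  simp

theorem ltr_mtr (X Y : D) (U : C) :
    δ G (U ⊗ R.obj X) (R.obj Y) ≫ ltr adj U X ▷ _ ≫ _ ◁ cu adj Y ≫ (α_ _ _ _).hom =
      G.map (α_ _ _ _).hom ≫ δ G U (R.obj X ⊗ R.obj Y) ≫ G.obj U ◁ mtr adj X Y := by
  have h := Functor.OplaxMonoidal.associativity (F := G) U (R.obj X) (R.obj Y)
  simp only [mtr, ltr, comp_whiskerRight, whiskerLeft_comp, Category.assoc]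
  rw [← reassoc_aux h]
  simp

theorem rtr_ltr (X Y : D) (U : C) :
    δ G (R.obj X) (U ⊗ R.obj Y) ≫ G.obj (R.obj X) ◁ ltr adj U Y ≫ cu adj X ▷ _ ≫
      (α_ _ _ _).inv =
    G.map (α_ _ _ _).inv ≫ δ G (R.obj X ⊗ U) (R.obj Y) ≫ rtr adj X U ▷ _ ≫ _ ◁ cu adj Y := by
  have h := Functor.OplaxMonoidal.associativity_inv (F := G) (R.obj X) U (R.obj Y)
  simp only [rtr, ltr, comp_whiskerRight, whiskerLeft_comp, Category.assoc]
  rw [← reassoc_aux h, whisker_exchange_assoc]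
  simp

/-- The half-braiding on the unit. -/
def unitHB : HalfBraiding (𝟙_ D) := (Center.tensorUnit (C := D)).2

theorem unitHB_β (V : D) : (unitHB.β V).hom = (λ_ V).hom ≫ (ρ_ V).inv := rfl

theorem ε_comm (U : C) : ε R ▷ U ≫ (swapIso adj unitHB U).hom =
    ((λ_ U).hom ≫ (ρ_ U).inv) ≫ U ◁ ε R := ltr_ext adj (by
  rw [G.map_comp, Category.assoc, swapIso_ltr, unitHB_β, ← Category.assoc, rtr_ε, G.map_comp,
    Category.assoc, Category.assoc, ltr_ε, G.map_comp]
  simp only [Category.assoc, Iso.inv_hom_id_assoc]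
  rw [← G.map_comp_assoc (ρ_ U).inv, Iso.inv_hom_id, G.map_id, Category.id_comp])

/-- The half-braiding on a tensor product. -/
def tensorHB {X Y : D} (c : HalfBraiding X) (d : HalfBraiding Y) : HalfBraiding (X ⊗ Y) :=
  (Center.tensorObj ⟨X, c⟩ ⟨Y, d⟩).2

theorem tensorHB_β {X Y : D} (c : HalfBraiding X) (d : HalfBraiding Y) (V : D) :
    ((tensorHB c d).β V).hom = (α_ _ _ _).hom ≫ X ◁ (d.β V).hom ≫ (α_ _ _ _).inv ≫
      (c.β V).hom ▷ Y ≫ (α_ _ _ _).hom := rfl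

theorem μ_comm {X Y : D} (c : HalfBraiding X) (d : HalfBraiding Y) (U : C) :
    μ R X Y ▷ U ≫ (swapIso adj (tensorHB c d) U).hom =
      ((α_ _ _ _).hom ≫ R.obj X ◁ (swapIso adj d U).hom ≫ (α_ _ _ _).inv ≫
        (swapIso adj c U).hom ▷ R.obj Y ≫ (α_ _ _ _).hom) ≫ U ◁ μ R X Y := ltr_ext adj (by
  have e₁ : δ G (R.obj X ⊗ R.obj Y) U ≫ mtr adj X Y ▷ G.obj U ≫ (α_ _ _ _).hom ≫
      X ◁ (d.β (G.obj U)).hom = G.map (α_ _ _ _).hom ≫ G.map (R.obj X ◁ (swapIso adj d U).hom) ≫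
      δ G (R.obj X) (U ⊗ R.obj Y) ≫ G.obj (R.obj X) ◁ ltr adj U Y ≫ cu adj X ▷ _ := by
    rw [← δ_natural_right_assoc, ← whiskerLeft_comp_assoc, swapIso_ltr, whiskerLeft_comp_assoc,
      whisker_exchange]
    have h := congrArg (· ≫ X ◁ (d.β (G.obj U)).hom) (mtr_rtr adj X Y U)
    simpa only [Category.assoc] using h
  have e₂ : δ G (R.obj X ⊗ U) (R.obj Y) ≫ rtr adj X U ▷ _ ≫ (X ⊗ G.obj U) ◁ cu adj Y ≫
      (c.β (G.obj U)).hom ▷ Y ≫ (α_ _ _ _).hom = G.map ((swapIso adj c U).hom ▷ R.obj Y) ≫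
        G.map (α_ _ _ _).hom ≫ δ G U (R.obj X ⊗ R.obj Y) ≫ G.obj U ◁ mtr adj X Y := by
    rw [← ltr_mtr, ← δ_natural_left_assoc, ← comp_whiskerRight_assoc, swapIso_ltr,
      comp_whiskerRight_assoc, whisker_exchange_assoc]
  have h := congrArg (· ≫ (α_ _ _ _).inv ≫ (c.β (G.obj U)).hom ▷ Y ≫ (α_ _ _ _).hom) e₁
  have h' := congrArg (fun t => G.map (α_ _ _ _).hom ≫ G.map (R.obj X ◁ (swapIso adj d U).hom) ≫
    t ≫ (c.β (G.obj U)).hom ▷ Y ≫ (α_ _ _ _).hom) (rtr_ltr adj X Y U)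
  simp only [Category.assoc] at h h'
  rw [e₂] at h'
  rw [G.map_comp, G.map_comp, Category.assoc, Category.assoc, ltr_μ, swapIso_ltr, tensorHB_β,
    ← Category.assoc, rtr_μ, Category.assoc, h, h']
  simp only [G.map_comp, Category.assoc])

theorem μ_braided {X : D} (c : HalfBraiding X) (Y : D) :
    μ R X Y ≫ R.map (c.β Y).hom = (swapIso adj c (R.obj Y)).hom ≫ μ R Y X := by
  apply (adj.homEquiv _ _).symm.injective
  rw [Adjunction.homEquiv_counit, Adjunction.homEquiv_counit, G.map_comp, G.map_comp,
    Category.assoc, Category.assoc]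
  change _ ≫ _ ≫ cu adj _ = _ ≫ _ ≫ cu adj _
  rw [cu_nat, cu_μ, ← ltr_cu, swapIso_ltr_assoc, ← c.naturality, ← Category.assoc, cu_μ,
    ← Category.assoc, rtr_cu]

end CenterFunctor

open CenterFunctor in
/-- The functor `Z(R) : Z(D) ⥤ Z(C)` induced by the right adjoint `R` of a monoidal functor `G`
satisfying the projection formula. It sends `(X, c)` to `R X` with the half-braiding
`R X ⊗ A ≅ R (X ⊗ G A) ≅ R (G A ⊗ X) ≅ A ⊗ R X`. -/
def centerFunctor {C : Type u₁} [Category.{v₁} C] [MonoidalCategory C]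
    {D : Type u₂} [Category.{v₂} D] [MonoidalCategory D]
    {G : C ⥤ D} {R : D ⥤ C} [G.Monoidal] [R.LaxMonoidal] (adj : G ⊣ R) [adj.IsMonoidal]
    [ProjectionFormula adj] : Center D ⥤ Center C where
  obj := obj adj
  map := map adj
  map_id X := Center.ext _ _ (R.map_id X.1)
  map_comp f g := Center.ext _ _ (R.map_comp f.f g.f)

open CenterFunctor in
instance centerFunctorLax {C : Type u₁} [Category.{v₁} C] [MonoidalCategory C]
    {D : Type u₂} [Category.{v₂} D] [MonoidalCategory D]
    {G : C ⥤ D} {R : D ⥤ C} [G.Monoidal] [R.LaxMonoidal] (adj : G ⊣ R) [adj.IsMonoidal]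
    [ProjectionFormula adj] : (centerFunctor adj).LaxMonoidal where
  ε := ⟨Functor.LaxMonoidal.ε R, ε_comm adj⟩
  μ X Y := ⟨Functor.LaxMonoidal.μ R X.1 Y.1, μ_comm adj X.2 Y.2⟩
  μ_natural_left f X := Center.ext _ _ (Functor.LaxMonoidal.μ_natural_left R f.f X.1)
  μ_natural_right X f := Center.ext _ _ (Functor.LaxMonoidal.μ_natural_right R X.1 f.f)
  associativity X Y Z := Center.ext _ _ (Functor.LaxMonoidal.associativity R X.1 Y.1 Z.1)
  left_unitality X := Center.ext _ _ (Functor.LaxMonoidal.left_unitality R X.1)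
  right_unitality X := Center.ext _ _ (Functor.LaxMonoidal.right_unitality R X.1)

open CenterFunctor in
instance centerFunctorBraided {C : Type u₁} [Category.{v₁} C] [MonoidalCategory C]
    {D : Type u₂} [Category.{v₂} D] [MonoidalCategory D]
    {G : C ⥤ D} {R : D ⥤ C} [G.Monoidal] [R.LaxMonoidal] (adj : G ⊣ R) [adj.IsMonoidal]
    [ProjectionFormula adj] : (centerFunctor adj).LaxBraided where
  braided X Y := Center.ext _ _ (μ_braided adj X.2 Y.1)

/-! ## Restriction and coinduction -/

section Conv

variable {k C Z : Type*} [CommRing k] [AddCommGroup C] [Module k C] [AddCommGroup Z] [Module k Z]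

/-- The map `h ↦ ∑ A(h₁) F(h₂)` for a given comultiplication. -/
def conv (Δ : C →ₗ[k] C ⊗[k] C) (A : C →ₗ[k] Module.End k Z) (F : C →ₗ[k] Z) : C →ₗ[k] Z :=
  TensorProduct.lift ((LinearMap.lcomp k Z F).comp A) ∘ₗ Δ

theorem conv_cancel (Δ : C →ₗ[k] C ⊗[k] C) (ε : C →ₗ[k] k)
    (hΔ : ∀ x, TensorProduct.assoc k C C C (Δ.rTensor C (Δ x)) = Δ.lTensor C (Δ x))
    (hε : ∀ x, TensorProduct.lid k C (ε.rTensor C (Δ x)) = x)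
    (A B : C →ₗ[k] Module.End k Z)
    (hAB : ∀ x, LinearMap.mul' k _ (TensorProduct.map A B (Δ x)) = ε x • 1) (F : C →ₗ[k] Z) :
    conv Δ A (conv Δ B F) = F := by
  let T : (C ⊗[k] C) ⊗[k] C →ₗ[k] Z := TensorProduct.lift
    ((LinearMap.lcomp k Z F).comp (LinearMap.mul' k _ ∘ₗ TensorProduct.map A B))
  have h1 : ∀ (a : C) (t : C ⊗[k] C), T ((TensorProduct.assoc k C C C).symm (a ⊗ₜ t)) =
      A a (TensorProduct.lift ((LinearMap.lcomp k Z F).comp B) t) := by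
    intro a t
    induction t with
    | zero => simp
    | add x y hx hy => simp only [TensorProduct.tmul_add, map_add, hx, hy]
    | tmul x y => simp [T]
  have h2 : ∀ y : C ⊗[k] C, TensorProduct.lift ((LinearMap.lcomp k Z (conv Δ B F)).comp A) y =
      T ((TensorProduct.assoc k C C C).symm (Δ.lTensor C y)) := by
    intro y
    induction y with
    | zero => simp
    | add x y hx hy => simp only [map_add, hx, hy]
    | tmul a b => rw [LinearMap.lTensor_tmul, h1]; rfl
  have h3 : ∀ y : C ⊗[k] C, T (Δ.rTensor C y) = F (TensorProduct.lid k C (ε.rTensor C y)) := by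
    intro y
    induction y with
    | zero => simp
    | add x y hx hy => simp only [map_add, hx, hy]
    | tmul a b => simp [T, hAB]
  ext x
  change TensorProduct.lift ((LinearMap.lcomp k Z (conv Δ B F)).comp A) (Δ x) = F x
  rw [h2, ← hΔ, LinearEquiv.symm_apply_apply, h3, hε]

variable {K H : Type*} [Ring K] [Algebra k K] [Ring H] [Algebra k H]

theorem conv_equivariant (ΔH : H →ₗ[k] H ⊗[k] H) (ΔK : K →ₗ[k] K ⊗[k] K) (ε : K →ₗ[k] k)
    (hΔ : ∀ x, TensorProduct.assoc k K K K (ΔK.rTensor K (ΔK x)) = ΔK.lTensor K (ΔK x))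
    (hε : ∀ x, TensorProduct.lid k K (ε.rTensor K (ΔK x)) = x)
    (ι : K →ₐ[k] H)
    (hι : ∀ x h, ΔH (ι x * h) = TensorProduct.map ι.toLinearMap ι.toLinearMap (ΔK x) * ΔH h)
    (a : H →ₐ[k] Module.End k Z) (b : K →ₐ[k] Module.End k Z)
    (hab : ∀ x y z, a x (b y z) = b y (a x z)) (S : H →ₗ[k] H)
    (hS : ∀ x y, S (x * y) = S y * S x)
    (hSι : ∀ x, LinearMap.mul' k _ (TensorProduct.map
      (a.toLinearMap ∘ₗ S ∘ₗ ι.toLinearMap) (a.toLinearMap ∘ₗ ι.toLinearMap) (ΔK x)) = ε x • 1)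
    (d : K →ₗ[k] Module.End k Z)
    (hd : ∀ x z, d x z = conv ΔK (a.toLinearMap ∘ₗ ι.toLinearMap) (b.toLinearMap.flip z) x)
    (F : H →ₗ[k] Z) (hF : ∀ x h, F (ι x * h) = d x (F h)) (x : K) (h : H) :
    conv ΔH (a.toLinearMap ∘ₗ S) F (ι x * h) = b x (conv ΔH (a.toLinearMap ∘ₗ S) F h) := by
  let Q : H ⊗[k] H →ₗ[k] Z := TensorProduct.lift
    ((LinearMap.lcomp k Z F).comp (a.toLinearMap ∘ₗ S))
  have h1 : ∀ (c e : H) (t : K ⊗[k] K),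
      Q (TensorProduct.map ι.toLinearMap ι.toLinearMap t * (c ⊗ₜ e)) =
      a (S c) (TensorProduct.lift ((LinearMap.lcomp k Z
        (conv ΔK (a.toLinearMap ∘ₗ ι.toLinearMap) (b.toLinearMap.flip (F e)))).comp
          (a.toLinearMap ∘ₗ S ∘ₗ ι.toLinearMap)) t) := by
    intro c e t
    induction t with
    | zero => simp
    | add x y hx hy => simp only [map_add, add_mul, hx, hy]
    | tmul p q =>
      simp [Q, hS, hF, hd]
  have h2 : ∀ (u : H ⊗[k] H),
      Q (TensorProduct.map ι.toLinearMap ι.toLinearMap (ΔK x) * u) = b x (Q u) := by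
    intro u
    induction u with
    | zero => simp
    | add x y hx hy => simp only [map_add, mul_add, hx, hy]
    | tmul c e =>
      have h3 := LinearMap.congr_fun (conv_cancel ΔK ε hΔ hε
        (a.toLinearMap ∘ₗ S ∘ₗ ι.toLinearMap) (a.toLinearMap ∘ₗ ι.toLinearMap) hSι
          (b.toLinearMap.flip (F e))) x
      rw [h1]
      refine (congrArg (a (S c)) h3).trans ?_
      simp [Q, hab]
  change Q (ΔH (ι x * h)) = b x (Q (ΔH h))
  rw [hι, h2]

/-- If functions on `H` with trivially twisted equivariance are given by `M`, then so are those with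
diagonally twisted equivariance. -/
theorem conv_bijective (ΔH : H →ₗ[k] H ⊗[k] H) (εH : H →ₗ[k] k)
    (hΔH : ∀ x, TensorProduct.assoc k H H H (ΔH.rTensor H (ΔH x)) = ΔH.lTensor H (ΔH x))
    (hεH : ∀ x, TensorProduct.lid k H (εH.rTensor H (ΔH x)) = x)
    (ΔK : K →ₗ[k] K ⊗[k] K) (ε : K →ₗ[k] k)
    (hΔ : ∀ x, TensorProduct.assoc k K K K (ΔK.rTensor K (ΔK x)) = ΔK.lTensor K (ΔK x))
    (hε : ∀ x, TensorProduct.lid k K (ε.rTensor K (ΔK x)) = x)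
    (ι : K →ₐ[k] H)
    (hι : ∀ x h, ΔH (ι x * h) = TensorProduct.map ι.toLinearMap ι.toLinearMap (ΔK x) * ΔH h)
    (a : H →ₐ[k] Module.End k Z) (b : K →ₐ[k] Module.End k Z)
    (hab : ∀ x y z, a x (b y z) = b y (a x z)) (S : H →ₗ[k] H)
    (hS : ∀ x y, S (x * y) = S y * S x)
    (hS₁ : ∀ x, LinearMap.mul' k _ (S.rTensor H (ΔH x)) = algebraMap k H (εH x))
    (hS₂ : ∀ x, LinearMap.mul' k _ (S.lTensor H (ΔH x)) = algebraMap k H (εH x))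
    (hιΔ : ∀ x, TensorProduct.map ι.toLinearMap ι.toLinearMap (ΔK x) = ΔH (ι x))
    (hιε : ∀ x, εH (ι x) = ε x)
    (d : K →ₗ[k] Module.End k Z)
    (hd : ∀ x z, d x z = conv ΔK (a.toLinearMap ∘ₗ ι.toLinearMap) (b.toLinearMap.flip z) x)
    {M : Type*} (α : M → (H →ₗ[k] Z)) (hα : Function.Injective α)
    (hr : ∀ G : H →ₗ[k] Z, (∀ x h, G (ι x * h) = b x (G h)) → ∃ m, α m = G)
    {N : Type*} (Φ : M → N) (β : N → (H →ₗ[k] Z)) (hβ : Function.Injective β)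
    (hN : ∀ n x h, β n (ι x * h) = d x (β n h))
    (hΦ : ∀ m, β (Φ m) = conv ΔH a.toLinearMap (α m)) : Function.Bijective Φ := by
  have key : ∀ (f g : H →ₗ[k] H) (t : H ⊗[k] H), LinearMap.mul' k _ (TensorProduct.map
      (a.toLinearMap ∘ₗ f) (a.toLinearMap ∘ₗ g) t) =
      a (LinearMap.mul' k _ (TensorProduct.map f g t)) := by
    intro f g t
    induction t with
    | zero => simp
    | add x y hx hy => simp only [map_add, hx, hy]
    | tmul p q => simp
  have s₁ : ∀ x, LinearMap.mul' k _ (TensorProduct.map (a.toLinearMap ∘ₗ S) a.toLinearMap (ΔH x))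
      = εH x • 1 := by
    intro x
    refine (key S LinearMap.id (ΔH x)).trans ?_
    refine (congrArg a (hS₁ x)).trans ?_
    rw [AlgHom.commutes, Algebra.algebraMap_eq_smul_one]
  have s₂ : ∀ x, LinearMap.mul' k _ (TensorProduct.map a.toLinearMap (a.toLinearMap ∘ₗ S) (ΔH x))
      = εH x • 1 := by
    intro x
    refine (key LinearMap.id S (ΔH x)).trans ?_
    refine (congrArg a (hS₂ x)).trans ?_
    rw [AlgHom.commutes, Algebra.algebraMap_eq_smul_one]
  constructor
  · intro m m' h
    apply hα
    rw [← conv_cancel ΔH εH hΔH hεH _ _ s₁ (α m), ← conv_cancel ΔH εH hΔH hεH _ _ s₁ (α m'),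
      ← hΦ, ← hΦ, h]
  · intro n
    obtain ⟨m, hm⟩ := hr (conv ΔH (a.toLinearMap ∘ₗ S) (β n))
      (conv_equivariant ΔH ΔK ε hΔ hε ι hι a b hab S hS (by
        intro x
        have e : TensorProduct.map (a.toLinearMap ∘ₗ S ∘ₗ ι.toLinearMap)
            (a.toLinearMap ∘ₗ ι.toLinearMap) (ΔK x) = TensorProduct.map (a.toLinearMap ∘ₗ S)
              a.toLinearMap (TensorProduct.map ι.toLinearMap ι.toLinearMap (ΔK x)) := by
          rw [← LinearMap.comp_apply (TensorProduct.map _ _) (TensorProduct.map _ _),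
            ← TensorProduct.map_comp]
          rfl
        rw [e, hιΔ, s₁, hιε]) d hd (β n) (hN n))
    refine ⟨m, hβ ?_⟩
    rw [hΦ, hm, conv_cancel ΔH εH hΔH hεH _ _ s₂]

end Conv

section ResCoInd

variable {k K H : Type u} [CommRing k] [Ring K] [Ring H] [Bialgebra k K] [Bialgebra k H]
  (ι : K →ₐc[k] H)

/-- The underlying algebra morphism. -/
abbrev toAlg : K →ₐ[k] H := (ι : K →ₐ[k] H)

/-- Restriction of modules. -/
def res : LMod k H ⥤ LMod k K where
  obj X := ⟨X.V, X.ρ.comp (toAlg ι)⟩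
  map f := ⟨f.f, fun x => f.comm (ι x)⟩

theorem map_comul (x : K) : TensorProduct.map (toAlg ι).toLinearMap (toAlg ι).toLinearMap
    (Coalgebra.comul (R := k) x) = Coalgebra.comul (R := k) (ι x) :=
  LinearMap.congr_fun ι.map_comp_comul x

theorem map_counit (x : K) : Coalgebra.counit (R := k) (ι x) = Coalgebra.counit (R := k) x :=
  LinearMap.congr_fun ι.counit_comp x

/-- Restriction strictly preserves tensor products. -/
def resCore : (res ι).CoreMonoidal where
  εIso := LMod.isoMk (Iso.refl (𝟙_ (ModuleCat k))) (fun x y => by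
    change trivAct k K x y = trivAct k H (ι x) y
    rw [trivAct_apply, trivAct_apply, map_counit])
  μIso X Y := LMod.isoMk (Iso.refl (X.V ⊗ Y.V)) (fun x y => by
    change tensorAct (X.ρ.comp (toAlg ι)) (Y.ρ.comp (toAlg ι)) x y = tensorAct X.ρ Y.ρ (ι x) y
    rw [tensorAct_apply, tensorAct_apply, actT_comp, map_comul])
  μIso_hom_natural_left f Y := LMod.hom_ext ((Category.comp_id _).trans (Category.id_comp _).symm)
  μIso_hom_natural_right X f := LMod.hom_ext ((Category.comp_id _).trans (Category.id_comp _).symm)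
  associativity X Y Z := LMod.hom_ext (by
    change 𝟙 (X.V ⊗ Y.V) ▷ Z.V ≫ 𝟙 _ ≫ (α_ X.V Y.V Z.V).hom = (α_ X.V Y.V Z.V).hom ≫
      X.V ◁ 𝟙 (Y.V ⊗ Z.V) ≫ 𝟙 _
    simp)
  left_unitality X := LMod.hom_ext (by
    change (λ_ X.V).hom = 𝟙 (𝟙_ (ModuleCat k)) ▷ X.V ≫ 𝟙 _ ≫ (λ_ X.V).hom
    simp)
  right_unitality X := LMod.hom_ext (by
    change (ρ_ X.V).hom = X.V ◁ 𝟙 (𝟙_ (ModuleCat k)) ≫ 𝟙 _ ≫ (ρ_ X.V).hom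
    simp)

instance : (res ι).Monoidal := (resCore ι).toMonoidal

theorem res_μ (X Y : LMod k H) : (Functor.LaxMonoidal.μ (res ι) X Y).f = 𝟙 (X.V ⊗ Y.V) := rfl
theorem res_δ (X Y : LMod k H) : (Functor.OplaxMonoidal.δ (res ι) X Y).f = 𝟙 (X.V ⊗ Y.V) := rfl

/-- `K`-linear maps `H → V`. -/
def coIndSub (X : LMod k K) : Submodule k (H →ₗ[k] X.V) where
  carrier := {f | ∀ (x : K) (h : H), f (ι x * h) = X.ρ x (f h)}
  add_mem' hf hg x h := by rw [LinearMap.add_apply, LinearMap.add_apply, hf, hg, map_add]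
  zero_mem' x h := by simp
  smul_mem' c f hf x h := by rw [LinearMap.smul_apply, LinearMap.smul_apply, hf, map_smul]

/-- The action `(h · f)(g) = f(g h)`. -/
def coIndAct (X : LMod k K) : H →ₐ[k] Module.End k (coIndSub ι X) :=
  AlgHom.ofLinearMap
    { toFun := fun h =>
        { toFun := fun f => ⟨f.1.comp (LinearMap.mulRight k h), fun x g => by
            change f.1 (ι x * g * h) = X.ρ x (f.1 (g * h))
            rw [mul_assoc]; exact f.2 x (g * h)⟩
          map_add' := fun _ _ => rfl
          map_smul' := fun _ _ => rfl }
      map_add' := fun a b => LinearMap.ext fun f => Subtype.ext (LinearMap.ext fun g => by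
        change f.1 (g * (a + b)) = f.1 (g * a) + f.1 (g * b)
        rw [mul_add, map_add])
      map_smul' := fun c a => LinearMap.ext fun f => Subtype.ext (LinearMap.ext fun g => by
        change f.1 (g * (c • a)) = c • f.1 (g * a)
        rw [mul_smul_comm, map_smul]) }
    (LinearMap.ext fun f => Subtype.ext (LinearMap.ext fun g => congrArg f.1 (mul_one g)))
    (fun a b => LinearMap.ext fun f => Subtype.ext (LinearMap.ext fun g =>
      congrArg f.1 (mul_assoc g a b).symm))

theorem coIndAct_apply (X : LMod k K) (h g : H) (f : coIndSub ι X) :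
    (coIndAct ι X h f).1 g = f.1 (g * h) := rfl

/-- Coinduction of modules. -/
def coInd : LMod k K ⥤ LMod k H where
  obj X := ⟨ModuleCat.of k (coIndSub ι X), coIndAct ι X⟩
  map {X Y} t := ⟨ModuleCat.ofHom
    { toFun := fun f => ⟨t.f.hom ∘ₗ f.1, fun x h =>
        (congrArg t.f.hom (f.2 x h)).trans (t.comm x (f.1 h))⟩
      map_add' := fun f g => Subtype.ext (LinearMap.ext fun h => map_add t.f.hom (f.1 h) (g.1 h))
      map_smul' := fun c f => Subtype.ext (LinearMap.ext fun h => map_smul t.f.hom c (f.1 h)) },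
    fun _ _ => rfl⟩

/-- The unit `w ↦ (h ↦ h w)`. -/
def coIndUnit (X : LMod k H) : X ⟶ (coInd ι).obj ((res ι).obj X) :=
  ⟨ModuleCat.ofHom
    { toFun := fun w => ⟨X.ρ.toLinearMap.flip w, fun x h => by
        change X.ρ (ι x * h) w = X.ρ (ι x) (X.ρ h w)
        rw [map_mul]; rfl⟩
      map_add' := fun f g => Subtype.ext (LinearMap.ext fun h => map_add (X.ρ h) f g)
      map_smul' := fun c f => Subtype.ext (LinearMap.ext fun h => map_smul (X.ρ h) c f) },
    fun h w => Subtype.ext (LinearMap.ext fun g => by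
      change X.ρ g (X.ρ h w) = X.ρ (g * h) w
      rw [map_mul]; rfl)⟩

/-- The counit `f ↦ f(1)`. -/
def coIndCounit (X : LMod k K) : (res ι).obj ((coInd ι).obj X) ⟶ X :=
  ⟨ModuleCat.ofHom
    { toFun := fun f => f.1 1
      map_add' := fun _ _ => rfl
      map_smul' := fun _ _ => rfl },
    fun x f => by
      have h := f.2 x 1
      rw [mul_one] at h
      change f.1 (1 * ι x) = X.ρ x (f.1 1)
      rw [one_mul]; exact h⟩

theorem coInd_triangle₁ (X : LMod k H) :
    (res ι).map (coIndUnit ι X) ≫ coIndCounit ι ((res ι).obj X) = 𝟙 ((res ι).obj X) := by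
  have h : ∀ w : X.V, X.ρ 1 w = w := fun w => by rw [map_one]; rfl
  exact LMod.hom_ext (ModuleCat.hom_ext (LinearMap.ext h))

theorem coInd_triangle₂ (X : LMod k K) :
    coIndUnit ι ((coInd ι).obj X) ≫ (coInd ι).map (coIndCounit ι X) = 𝟙 ((coInd ι).obj X) := by
  have h : ∀ f : coIndSub ι X, (⟨f.1.comp (LinearMap.mulLeft k 1), fun x g => by
      change f.1 (1 * (ι x * g)) = X.ρ x (f.1 (1 * g))
      rw [one_mul, one_mul]; exact f.2 x g⟩ : coIndSub ι X) = f := fun f =>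
    Subtype.ext (LinearMap.ext fun g => congrArg f.1 (one_mul g))
  exact LMod.hom_ext (ModuleCat.hom_ext (LinearMap.ext h))

/-- Coinduction is right adjoint to restriction. -/
def coIndAdj : res ι ⊣ coInd ι where
  unit := { app := coIndUnit ι
            naturality := fun X Y t => LMod.hom_ext (ModuleCat.hom_ext (LinearMap.ext fun w =>
              Subtype.ext (LinearMap.ext fun g => (t.comm g w).symm))) }
  counit := { app := coIndCounit ι
              naturality := fun _ _ _ => rfl }
  left_triangle_components := coInd_triangle₁ ι
  right_triangle_components := coInd_triangle₂ ι

/-- The lax monoidal structure `f ⊗ g ↦ (h ↦ f(h₁) ⊗ g(h₂))` on coinduction. -/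
instance : (coInd ι).LaxMonoidal := (coIndAdj ι).rightAdjointLaxMonoidal

instance : (coIndAdj ι).IsMonoidal :=
  inferInstanceAs (letI := (coIndAdj ι).rightAdjointLaxMonoidal; (coIndAdj ι).IsMonoidal)

open CenterFunctor

theorem coInd_ltr (A : LMod k H) (X : LMod k K) (z : A.V ⊗[k] coIndSub ι X) :
    (ltr (coIndAdj ι) A X).f.hom z = TensorProduct.map LinearMap.id (coIndCounit ι X).f.hom z := rfl

end ResCoInd

/-- The antipode is bijective. -/
class BijectiveAntipode (k H : Type u) [CommRing k] [Ring H] [HopfAlgebra k H] : Prop where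
  bijective : Function.Bijective (HopfAlgebra.antipode k (A := H))

/-- `H` is finitely generated and projective as a left `K`-module through `ι : K → H`. -/
class FGProjective {k K H : Type u} [CommRing k] [Ring K] [Ring H] [Bialgebra k K] [Bialgebra k H]
    (ι : K →ₐc[k] H) : Prop where
  finite : letI := Module.compHom H (ι : K →ₐ[k] H).toRingHom; Module.Finite K H
  projective : letI := Module.compHom H (ι : K →ₐ[k] H).toRingHom; Module.Projective K H

section Cop

variable {k C : Type*} [CommRing k] [AddCommGroup C] [Module k C] [Coalgebra k C]

variable (k C) in
/-- The opposite comultiplication. -/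
def cop : C →ₗ[k] C ⊗[k] C := (TensorProduct.comm k C C).toLinearMap ∘ₗ Coalgebra.comul

theorem cop_apply (x : C) : cop k C x = TensorProduct.comm k C C (Coalgebra.comul (R := k) x) := rfl

theorem cop_coassoc (x : C) : TensorProduct.assoc k C C C ((cop k C).rTensor C (cop k C x)) =
    (cop k C).lTensor C (cop k C x) := by
  let P : C ⊗[k] (C ⊗[k] C) →ₗ[k] C ⊗[k] (C ⊗[k] C) :=
    (TensorProduct.assoc k C C C).toLinearMap ∘ₗ (TensorProduct.comm k C (C ⊗[k] C)).toLinearMap ∘ₗ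
      (TensorProduct.comm k C C).toLinearMap.lTensor C
  have h1 : ∀ y : C ⊗[k] C, TensorProduct.assoc k C C C ((cop k C).rTensor C
      (TensorProduct.comm k C C y)) = P ((Coalgebra.comul (R := k)).lTensor C y) := by
    intro y
    induction y with
    | zero => simp
    | add a b ha hb => simp only [map_add, ha, hb]
    | tmul a b => simp [P, cop_apply]
  have h2 : ∀ (t : C ⊗[k] C) (b : C), b ⊗ₜ (TensorProduct.comm k C C t) =
      P (TensorProduct.assoc k C C C (t ⊗ₜ b)) := by
    intro t b
    induction t with
    | zero => simp
    | add x y hx hy => simp only [map_add, TensorProduct.tmul_add, TensorProduct.add_tmul, hx, hy]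
    | tmul x y => simp [P]
  have h3 : ∀ y : C ⊗[k] C, (cop k C).lTensor C (TensorProduct.comm k C C y) =
      P (TensorProduct.assoc k C C C ((Coalgebra.comul (R := k)).rTensor C y)) := by
    intro y
    induction y with
    | zero => simp
    | add a b ha hb => simp only [map_add, ha, hb]
    | tmul a b =>
      rw [TensorProduct.comm_tmul, LinearMap.lTensor_tmul, cop_apply, h2, LinearMap.rTensor_tmul]
  rw [cop_apply, h1, h3, Coalgebra.coassoc_apply]

theorem cop_counit (x : C) :
    TensorProduct.lid k C ((Coalgebra.counit (R := k)).rTensor C (cop k C x)) = x := by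
  have h1 : ∀ y : C ⊗[k] C, TensorProduct.lid k C ((Coalgebra.counit (R := k)).rTensor C
      (TensorProduct.comm k C C y)) = TensorProduct.rid k C
        ((Coalgebra.counit (R := k)).lTensor C y) := by
    intro y
    induction y with
    | zero => simp
    | add a b ha hb => simp only [map_add, ha, hb]
    | tmul a b => simp
  rw [cop_apply, h1, Coalgebra.lTensor_counit_comul]
  simp

theorem counit_lid (x : C) : TensorProduct.lid k C ((Coalgebra.counit (R := k)).rTensor C
    (Coalgebra.comul (R := k) x)) = x := by
  rw [Coalgebra.rTensor_counit_comul]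
  simp

end Cop

section Antipode

variable {k H : Type u} [CommRing k] [Ring H] [HopfAlgebra k H] [BijectiveAntipode k H]

variable (k H) in
/-- The antipode as a linear equivalence. -/
def antipodeEquiv : H ≃ₗ[k] H :=
  LinearEquiv.ofBijective (HopfAlgebra.antipode k (A := H)) BijectiveAntipode.bijective

variable (k H) in
/-- The inverse of the antipode. -/
def antipodeInv : H →ₗ[k] H := (antipodeEquiv k H).symm.toLinearMap

theorem antipode_antipodeInv (h : H) : HopfAlgebra.antipode k (antipodeInv k H h) = h :=
  (antipodeEquiv k H).apply_symm_apply h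

theorem antipodeInv_mul (x y : H) :
    antipodeInv k H (x * y) = antipodeInv k H y * antipodeInv k H x := by
  apply (antipodeEquiv k H).injective
  change HopfAlgebra.antipode k _ = HopfAlgebra.antipode k _
  rw [antipode_antipodeInv, HopfAlgebra.antipode_mul_antidistrib, antipode_antipodeInv,
    antipode_antipodeInv]

theorem antipodeInv_algebraMap (c : k) : antipodeInv k H (algebraMap k H c) = algebraMap k H c := by
  apply (antipodeEquiv k H).injective
  change HopfAlgebra.antipode k _ = HopfAlgebra.antipode k _
  rw [antipode_antipodeInv, Algebra.algebraMap_eq_smul_one, map_smul, HopfAlgebra.antipode_one]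

theorem antipodeInv_rTensor (x : H) : LinearMap.mul' k H ((antipodeInv k H).rTensor H (cop k H x)) =
    algebraMap k H (Coalgebra.counit (R := k) x) := by
  have h1 : ∀ y : H ⊗[k] H, LinearMap.mul' k H ((antipodeInv k H).rTensor H
      (TensorProduct.comm k H H y)) = antipodeInv k H (LinearMap.mul' k H
        ((HopfAlgebra.antipode k (A := H)).rTensor H y)) := by
    intro y
    induction y with
    | zero => simp
    | add a b ha hb => simp only [map_add, ha, hb]
    | tmul a b =>
      have : antipodeInv k H (HopfAlgebra.antipode k a) = a :=
        (antipodeEquiv k H).symm_apply_apply a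
      simp [antipodeInv_mul, this]
  rw [cop_apply, h1, HopfAlgebra.mul_antipode_rTensor_comul_apply, antipodeInv_algebraMap]

theorem antipodeInv_lTensor (x : H) : LinearMap.mul' k H ((antipodeInv k H).lTensor H (cop k H x)) =
    algebraMap k H (Coalgebra.counit (R := k) x) := by
  have h1 : ∀ y : H ⊗[k] H, LinearMap.mul' k H ((antipodeInv k H).lTensor H
      (TensorProduct.comm k H H y)) = antipodeInv k H (LinearMap.mul' k H
        ((HopfAlgebra.antipode k (A := H)).lTensor H y)) := by
    intro y
    induction y with
    | zero => simp
    | add a b ha hb => simp only [map_add, ha, hb]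
    | tmul a b =>
      have : antipodeInv k H (HopfAlgebra.antipode k b) = b :=
        (antipodeEquiv k H).symm_apply_apply b
      simp [antipodeInv_mul, this]
  rw [cop_apply, h1, HopfAlgebra.mul_antipode_lTensor_comul_apply, antipodeInv_algebraMap]

end Antipode

section Projection

variable {k K H : Type u} [CommRing k] [Ring K] [Ring H]

theorem exists_dualBasis [Bialgebra k K] [Bialgebra k H] (ι : K →ₐc[k] H) [h : FGProjective ι] :
    ∃ (n : ℕ) (x : Fin n → H) (φ : Fin n → (H →ₗ[k] K)),
      (∀ i c g, φ i (ι c * g) = c * φ i g) ∧ ∀ g, ∑ i, ι (φ i g) * x i = g := by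
  let r : K →+* H := (ι : K →ₐ[k] H).toRingHom
  let m : Module K H := Module.compHom H r
  have : Module.Finite K H := h.finite
  have : Module.Projective K H := h.projective
  have hs : ∀ (c : K) (g : H), c • g = ι c * g := fun _ _ => rfl
  obtain ⟨n, f, g, -, -, hfg⟩ := Module.Finite.exists_comp_eq_id_of_projective K H
  refine ⟨n, fun i => f (fun j => if i = j then 1 else 0), fun i =>
    { toFun := fun a => g a i
      map_add' := fun a b => by rw [map_add]; rfl
      map_smul' := fun c a => ?_ }, ?_, ?_⟩
  · have e : c • a = (algebraMap k K c) • a := by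
      rw [hs]
      have : ι (algebraMap k K c) = algebraMap k H c := (toAlg ι).commutes c
      rw [this, Algebra.smul_def]
    rw [e, map_smul]
    change algebraMap k K c * g a i = c • g a i
    rw [Algebra.smul_def]
  · intro i c a
    change g (c • a) i = c * g a i
    rw [map_smul]; rfl
  · intro a
    have e : f (g a) = a := LinearMap.congr_fun hfg a
    conv_rhs => rw [← e, LinearMap.pi_apply_eq_sum_univ f (g a)]
    rfl

variable [Bialgebra k K] [HopfAlgebra k H] (ι : K →ₐc[k] H)

section

variable (W : ModuleCat.{u} k) (X : LMod k K)

/-- The canonical map `W ⊗ Hom_K(H, X) → Hom(H, W ⊗ X)`. -/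
def tensorHomMap : W ⊗[k] coIndSub ι X →ₗ[k] (H →ₗ[k] W ⊗[k] X.V) :=
  TensorProduct.lift (LinearMap.mk₂ k (fun w f => (TensorProduct.mk k W X.V w).comp f.1)
    (fun _ _ _ => LinearMap.ext fun _ => TensorProduct.add_tmul _ _ _)
    (fun _ _ _ => LinearMap.ext fun _ => rfl)
    (fun _ _ _ => LinearMap.ext fun _ => TensorProduct.tmul_add _ _ _)
    (fun _ _ _ => LinearMap.ext fun _ => TensorProduct.tmul_smul _ _ _))

theorem tensorHomMap_tmul (w : W) (f : coIndSub ι X) (h : H) :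
    tensorHomMap ι W X (w ⊗ₜ f) h = w ⊗ₜ f.1 h := rfl

/-- The map `X → Hom_K(H, X)` induced by a `K`-linear form. -/
def formMap (φ : H →ₗ[k] K) (hφ : ∀ c g, φ (ι c * g) = c * φ g) : X.V →ₗ[k] coIndSub ι X where
  toFun x := ⟨(X.ρ.toLinearMap.flip x).comp φ, fun c g => by
    change X.ρ (φ (ι c * g)) x = X.ρ c (X.ρ (φ g) x)
    rw [hφ, map_mul]; rfl⟩
  map_add' x y := Subtype.ext (LinearMap.ext fun g => map_add (X.ρ (φ g)) x y)
  map_smul' c x := Subtype.ext (LinearMap.ext fun g => map_smul (X.ρ (φ g)) c x)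

theorem tensorHomMap_form (φ : H →ₗ[k] K) (hφ : ∀ c g, φ (ι c * g) = c * φ g) (z : W ⊗[k] X.V)
    (h : H) : tensorHomMap ι W X ((formMap ι X φ hφ).lTensor W z) h =
      (X.ρ (φ h)).lTensor W z := by
  induction z with
  | zero => simp
  | add a b ha hb => simp only [map_add, LinearMap.add_apply, ha, hb]
  | tmul a b => rfl

variable [FGProjective ι]

theorem tensorHomMap_injective : Function.Injective (tensorHomMap ι W X) := by
  obtain ⟨n, x, φ, hφ, hx⟩ := exists_dualBasis ι
  have key : ∀ z, ∑ i, (formMap ι X (φ i) (hφ i)).lTensor W (tensorHomMap ι W X z (x i)) = z := by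
    intro z
    induction z with
    | zero => simp
    | add a b ha hb =>
      simp only [map_add, LinearMap.add_apply, Finset.sum_add_distrib, ha, hb]
    | tmul w f =>
      simp only [tensorHomMap_tmul, LinearMap.lTensor_tmul]
      rw [← TensorProduct.tmul_sum]
      congr 1
      apply Subtype.ext
      rw [AddSubmonoidClass.coe_finsetSum]
      ext g
      rw [LinearMap.sum_apply]
      have e : ∀ i, X.ρ (φ i g) (f.1 (x i)) = f.1 (ι (φ i g) * x i) := fun i => (f.2 _ _).symm
      refine (Finset.sum_congr rfl fun i _ => e i).trans ?_
      rw [← map_sum, hx]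
  intro z z' h
  rw [← key z, ← key z', h]

theorem tensorHomMap_surj (G : H →ₗ[k] W ⊗[k] X.V)
    (hG : ∀ c h, G (ι c * h) = (X.ρ c).lTensor W (G h)) : ∃ m, tensorHomMap ι W X m = G := by
  obtain ⟨n, x, φ, hφ, hx⟩ := exists_dualBasis ι
  refine ⟨∑ i, (formMap ι X (φ i) (hφ i)).lTensor W (G (x i)), ?_⟩
  ext h
  rw [map_sum, LinearMap.sum_apply]
  simp only [tensorHomMap_form, ← hG]
  rw [← map_sum, hx]

end

open CenterFunctor

variable [FGProjective ι] [BijectiveAntipode k H]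

theorem isIso_of_bijective {X Y : LMod k H} (f : X ⟶ Y) (h : Function.Bijective f.f.hom) :
    IsIso f := by
  have h' : IsIso ((LMod.forgetV k H).map f) :=
    (ConcreteCategory.isIso_iff_bijective ((LMod.forgetV k H).map f)).2 h
  exact isIso_of_reflects_iso f (LMod.forgetV k H)

theorem ι_comul_mul (x : K) (h : H) : Coalgebra.comul (R := k) (ι x * h) =
    TensorProduct.map (toAlg ι).toLinearMap (toAlg ι).toLinearMap (Coalgebra.comul (R := k) x) *
      Coalgebra.comul (R := k) h := by
  rw [Bialgebra.comul_mul, map_comul]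

theorem ι_cop_mul (x : K) (h : H) : cop k H (ι x * h) =
    TensorProduct.map (toAlg ι).toLinearMap (toAlg ι).toLinearMap (cop k K x) *
      cop k H h := by
  have e : ∀ s t : H ⊗[k] H, TensorProduct.comm k H H (s * t) = TensorProduct.comm k H H s *
      TensorProduct.comm k H H t := fun s t => map_mul (Algebra.TensorProduct.comm k H H) s t
  have e' : ∀ t : K ⊗[k] K, TensorProduct.comm k H H
      (TensorProduct.map (toAlg ι).toLinearMap (toAlg ι).toLinearMap t) =
      TensorProduct.map (toAlg ι).toLinearMap (toAlg ι).toLinearMap (TensorProduct.comm k K K t) :=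
    fun t => (TensorProduct.map_comm _ _ _).symm
  rw [cop_apply, ι_comul_mul, e, e']
  rfl

/-- The action on the left factor. -/
abbrev actL {L : Type u} [Ring L] [Algebra k L] {V : ModuleCat.{u} k} (a : L →ₐ[k] Module.End k V)
    (W : ModuleCat.{u} k) : L →ₐ[k] Module.End k (V ⊗[k] W) :=
  (Module.End.rTensorAlgHom k V W).comp a

/-- The action on the right factor. -/
abbrev actR {L : Type u} [Ring L] [Algebra k L] {V : ModuleCat.{u} k} (a : L →ₐ[k] Module.End k V)
    (W : ModuleCat.{u} k) : L →ₐ[k] Module.End k (W ⊗[k] V) :=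
  (Module.End.lTensorAlgHom k V W).comp a

theorem actL_actR {L L' : Type u} [Ring L] [Algebra k L] [Ring L'] [Algebra k L']
    {V W : ModuleCat.{u} k} (a : L →ₐ[k] Module.End k V) (b : L' →ₐ[k] Module.End k W) (x : L)
    (y : L') (z : V ⊗[k] W) : actL a W x (actR b V y z) = actR b V y (actL a W x z) := by
  induction z with
  | zero => simp
  | add p q hp hq => simp only [map_add, hp, hq]
  | tmul p q => rfl

theorem conv_actL_actR {L L' : Type u} [Ring L] [Algebra k L] [Ring L'] [Algebra k L']
    {V W : ModuleCat.{u} k} (a : L →ₐ[k] Module.End k V) (b : L' →ₐ[k] Module.End k W)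
    (t : L ⊗[k] L') (z : V ⊗[k] W) : actT a b t z = TensorProduct.lift
      ((LinearMap.lcomp k _ ((actR b V).toLinearMap.flip z)).comp (actL a W).toLinearMap) t := by
  induction t with
  | zero => simp
  | add p q hp hq => simp only [map_add, LinearMap.add_apply, hp, hq]
  | tmul p q =>
    change actT a b (p ⊗ₜ q) z = actL a W p (actR b V q z)
    induction z with
    | zero => simp
    | add x y hx hy => simp only [map_add, hx, hy]
    | tmul x y => rfl

theorem conv_actR_actL {L L' : Type u} [Ring L] [Algebra k L] [Ring L'] [Algebra k L']
    {V W : ModuleCat.{u} k} (a : L →ₐ[k] Module.End k V) (b : L' →ₐ[k] Module.End k W)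
    (t : L ⊗[k] L') (z : V ⊗[k] W) : actT a b t z = TensorProduct.lift
      ((LinearMap.lcomp k _ ((actL a W).toLinearMap.flip z)).comp (actR b V).toLinearMap)
        (TensorProduct.comm k L L' t) := by
  induction t with
  | zero => simp
  | add p q hp hq => simp only [map_add, LinearMap.add_apply, hp, hq]
  | tmul p q =>
    change actT a b (p ⊗ₜ q) z = actR b V q (actL a W p z)
    induction z with
    | zero => simp
    | add x y hx hy => simp only [map_add, hx, hy]
    | tmul x y => rfl

/-- Evaluation at the unit. -/
def evOne (X : LMod k K) : coIndSub ι X →ₗ[k] X.V :=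
  (LinearMap.applyₗ (1 : H)).comp (coIndSub ι X).subtype

theorem coInd_lproj_bijective (A : LMod k H) (X : LMod k K) :
    Function.Bijective (lproj (coIndAdj ι) A X).f.hom := by
  refine conv_bijective (Coalgebra.comul (R := k) (A := H)) (Coalgebra.counit (R := k) (A := H))
    Coalgebra.coassoc_apply counit_lid (Coalgebra.comul (R := k) (A := K))
    (Coalgebra.counit (R := k) (A := K)) Coalgebra.coassoc_apply counit_lid (toAlg ι)
    (ι_comul_mul ι) (actL A.ρ X.V) (actR X.ρ A.V) (actL_actR A.ρ X.ρ)
    (HopfAlgebra.antipode k (A := H)) HopfAlgebra.antipode_mul_antidistrib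
    HopfAlgebra.mul_antipode_rTensor_comul_apply HopfAlgebra.mul_antipode_lTensor_comul_apply
    (map_comul ι) (map_counit ι) (tensorAct (A.ρ.comp (toAlg ι)) X.ρ).toLinearMap
    (fun x z => conv_actL_actR (A.ρ.comp (toAlg ι)) X.ρ _ z)
    (tensorHomMap ι A.V X) (tensorHomMap_injective ι A.V X) (tensorHomMap_surj ι A.V X) _
    (fun f => Subtype.val (p := (· ∈ coIndSub ι ((res ι).obj A ⊗ X))) f) Subtype.val_injective (fun n => n.2) ?_
  intro m
  have e : (lproj (coIndAdj ι) A X).f = ((coIndAdj ι).homEquiv _ _ (ltr (coIndAdj ι) A X)).f :=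
    congrArg LMod.Hom.f (homEquiv_ltr (coIndAdj ι) A X).symm
  rw [e]
  refine LinearMap.ext fun h => ?_
  have key : ∀ (t : H ⊗[k] H) (m : A.V ⊗[k] coIndSub ι X),
      TensorProduct.map LinearMap.id (evOne ι X) (actT A.ρ (coIndAct ι X) t m) =
      TensorProduct.lift ((LinearMap.lcomp k _ (tensorHomMap ι A.V X m)).comp
        (actL A.ρ X.V).toLinearMap) t := by
    intro t m
    induction t with
    | zero => simp
    | add p q hp hq => simp only [map_add, LinearMap.add_apply, hp, hq]
    | tmul p q =>
      change TensorProduct.map LinearMap.id (evOne ι X) (actT A.ρ (coIndAct ι X) (p ⊗ₜ q) m) =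
        actL A.ρ X.V p (tensorHomMap ι A.V X m q)
      induction m with
      | zero => simp
      | add x y hx hy => simp only [map_add, LinearMap.add_apply, hx, hy]
      | tmul w f =>
        change A.ρ p w ⊗ₜ[k] f.1 (1 * q) = A.ρ p w ⊗ₜ[k] f.1 q
        rw [one_mul]
  exact key (Coalgebra.comul (R := k) h) m

/-- The canonical map `Hom_K(H, X) ⊗ W → Hom(H, X ⊗ W)`. -/
def tensorHomMap' (W : ModuleCat.{u} k) (X : LMod k K) (z : coIndSub ι X ⊗[k] W) :
    H →ₗ[k] X.V ⊗[k] W :=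
  (TensorProduct.comm k W X.V).toLinearMap ∘ₗ
    tensorHomMap ι W X (TensorProduct.comm k (coIndSub ι X) W z)

theorem coInd_rproj_bijective (X : LMod k K) (A : LMod k H) :
    Function.Bijective (rproj (coIndAdj ι) X A).f.hom := by
  refine conv_bijective (cop k H) (Coalgebra.counit (R := k) (A := H))
    cop_coassoc cop_counit (cop k K)
    (Coalgebra.counit (R := k) (A := K)) cop_coassoc cop_counit (toAlg ι)
    (ι_cop_mul ι) (actR A.ρ X.V) (actL X.ρ A.V) (fun x y z => (actL_actR X.ρ A.ρ y x z).symm)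
    (antipodeInv k H) antipodeInv_mul antipodeInv_rTensor antipodeInv_lTensor
    ?_ (map_counit ι) (tensorAct X.ρ (A.ρ.comp (toAlg ι))).toLinearMap
    (fun x z => conv_actR_actL X.ρ (A.ρ.comp (toAlg ι)) _ z)
    (tensorHomMap' ι A.V X) ?_ ?_ _
    (fun f => Subtype.val (p := (· ∈ coIndSub ι (X ⊗ (res ι).obj A))) f) Subtype.val_injective (fun n => n.2) ?_
  · intro x
    rw [cop_apply, TensorProduct.map_comm, map_comul]; rfl
  · intro z z' h
    apply (TensorProduct.comm k (coIndSub ι X) A.V).injective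
    apply tensorHomMap_injective ι A.V X
    refine LinearMap.ext fun g => (TensorProduct.comm k A.V X.V).injective ?_
    exact LinearMap.congr_fun h g
  · intro G hG
    obtain ⟨m, hm⟩ := tensorHomMap_surj ι A.V X
      ((TensorProduct.comm k X.V A.V).toLinearMap ∘ₗ G) (fun c h => by
        change TensorProduct.comm k X.V A.V (G (toAlg ι c * h)) = _
        rw [hG]
        exact (TensorProduct.map_comm _ _ _).symm)
    refine ⟨TensorProduct.comm k A.V (coIndSub ι X) m, LinearMap.ext fun h => ?_⟩
    change TensorProduct.comm k A.V X.V (tensorHomMap ι A.V X (TensorProduct.comm k (coIndSub ι X) A.V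
      (TensorProduct.comm k A.V (coIndSub ι X) m)) h) = _
    rw [TensorProduct.comm_comm, hm]
    exact TensorProduct.comm_comm k A.V X.V _
  intro m
  have e : (rproj (coIndAdj ι) X A).f = ((coIndAdj ι).homEquiv _ _ (rtr (coIndAdj ι) X A)).f :=
    congrArg LMod.Hom.f (homEquiv_rtr (coIndAdj ι) X A).symm
  rw [e]
  refine LinearMap.ext fun h => ?_
  have key : ∀ (t : H ⊗[k] H) (m : coIndSub ι X ⊗[k] A.V),
      TensorProduct.map (evOne ι X) LinearMap.id (actT (coIndAct ι X) A.ρ t m) =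
      TensorProduct.lift ((LinearMap.lcomp k _ (tensorHomMap' ι A.V X m)).comp
        (actR A.ρ X.V).toLinearMap) (TensorProduct.comm k H H t) := by
    intro t m
    induction t with
    | zero => simp
    | add p q hp hq => simp only [map_add, LinearMap.add_apply, hp, hq]
    | tmul p q =>
      change TensorProduct.map (evOne ι X) LinearMap.id (actT (coIndAct ι X) A.ρ (p ⊗ₜ q) m) =
        actR A.ρ X.V q (tensorHomMap' ι A.V X m p)
      induction m with
      | zero => simp [tensorHomMap']
      | add x y hx hy =>
        have e : tensorHomMap' ι A.V X (x + y) p = tensorHomMap' ι A.V X x p +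
            tensorHomMap' ι A.V X y p := by simp [tensorHomMap']
        rw [e]
        simp only [map_add, hx, hy]
      | tmul f w =>
        change f.1 (1 * p) ⊗ₜ[k] A.ρ q w = f.1 p ⊗ₜ[k] A.ρ q w
        rw [one_mul]
  exact key (Coalgebra.comul (R := k) h) m

instance : ProjectionFormula (coIndAdj ι) where
  isIso_lproj A X := isIso_of_bijective _ (coInd_lproj_bijective ι A X)
  isIso_rproj X A := isIso_of_bijective _ (coInd_rproj_bijective ι X A)

end Projection

/-! ## The Kleisli category of a monoidal monad -/

namespace KleisliMonoidal

open Functor.LaxMonoidal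

variable {C : Type u₁} [Category.{v₁} C] [MonoidalCategory C] (T : Monad C)
  [T.toFunctor.LaxMonoidal]

/-- The free functor. -/
abbrev free : C ⥤ Kleisli T := Kleisli.Adjunction.toKleisli T

/-- The tensor product of Kleisli morphisms. -/
def tensorHom {X Y X' Y' : Kleisli T} (f : X ⟶ Y) (g : X' ⟶ Y') :
    Kleisli.mk T (X.of ⊗ X'.of) ⟶ Kleisli.mk T (Y.of ⊗ Y'.of) :=
  ⟨(f.of ⊗ₘ g.of) ≫ μ T.toFunctor Y.of Y'.of⟩

variable {T}

theorem comp_of {X Y Z : Kleisli T} (f : X ⟶ Y) (g : Y ⟶ Z) :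
    (f ≫ g).of = f.of ≫ T.map g.of ≫ T.μ.app Z.of := rfl

theorem free_comp_of {X Y : C} {Z : Kleisli T} (f : X ⟶ Y) (g : Kleisli.mk T Y ⟶ Z) :
    Kleisli.Hom.of ((free T).map f ≫ g) = f ≫ g.of := by
  change (f ≫ T.η.app Y) ≫ T.map g.of ≫ T.μ.app Z.of = _
  have h : T.η.app Y ≫ T.map g.of = g.of ≫ T.η.app (T.obj Z.of) := (T.η.naturality g.of).symm
  rw [Category.assoc, ← Category.assoc (T.η.app Y), h, Category.assoc, T.left_unit]
  exact congrArg (f ≫ ·) (Category.comp_id _)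

theorem comp_free_of {X : Kleisli T} {Y Z : C} (f : X ⟶ Kleisli.mk T Y) (g : Y ⟶ Z) :
    Kleisli.Hom.of (f ≫ (free T).map g) = f.of ≫ T.map g := by
  change f.of ≫ T.map (g ≫ T.η.app Z) ≫ T.μ.app Z = _
  rw [T.map_comp, Category.assoc, T.right_unit]
  exact congrArg (f.of ≫ ·) (Category.comp_id _)

variable [NatTrans.IsMonoidal T.η] [NatTrans.IsMonoidal T.μ]

theorem η_tensor (X Y : C) : T.η.app (X ⊗ Y) = (T.η.app X ⊗ₘ T.η.app Y) ≫ μ T.toFunctor X Y :=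
  (Category.id_comp _).symm.trans (NatTrans.IsMonoidal.tensor (τ := T.η) X Y)

theorem μ_tensor (X Y : C) : μ T.toFunctor (T.obj X) (T.obj Y) ≫ T.map (μ T.toFunctor X Y) ≫
    T.μ.app (X ⊗ Y) = (T.μ.app X ⊗ₘ T.μ.app Y) ≫ μ T.toFunctor X Y :=
  (Category.assoc _ _ _).symm.trans (NatTrans.IsMonoidal.tensor (τ := T.μ) X Y)

instance : MonoidalCategoryStruct (Kleisli T) where
  tensorObj X Y := Kleisli.mk T (X.of ⊗ Y.of)
  tensorHom f g := tensorHom T f g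
  whiskerLeft X _ _ f := tensorHom T (𝟙 X) f
  whiskerRight f X := tensorHom T f (𝟙 X)
  tensorUnit := Kleisli.mk T (𝟙_ C)
  associator X Y Z := (free T).mapIso (α_ X.of Y.of Z.of)
  leftUnitor X := (free T).mapIso (λ_ X.of)
  rightUnitor X := (free T).mapIso (ρ_ X.of)

theorem free_tensorHom {X Y X' Y' : C} (f : X ⟶ Y) (g : X' ⟶ Y') :
    tensorHom T ((free T).map f) ((free T).map g) = (free T).map (f ⊗ₘ g) := by
  apply Kleisli.hom_ext
  change ((f ≫ T.η.app Y) ⊗ₘ (g ≫ T.η.app Y')) ≫ μ T.toFunctor Y Y' = (f ⊗ₘ g) ≫ T.η.app (Y ⊗ Y')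
  rw [η_tensor, ← tensorHom_comp_tensorHom, Category.assoc]

theorem tensor_id (X Y : Kleisli T) : tensorHom T (𝟙 X) (𝟙 Y) = 𝟙 (Kleisli.mk T (X.of ⊗ Y.of)) :=
  Kleisli.hom_ext (η_tensor X.of Y.of).symm

theorem tensor_comp {X₁ Y₁ Z₁ X₂ Y₂ Z₂ : Kleisli T} (f₁ : X₁ ⟶ Y₁) (f₂ : X₂ ⟶ Y₂) (g₁ : Y₁ ⟶ Z₁)
    (g₂ : Y₂ ⟶ Z₂) : tensorHom T f₁ f₂ ≫ tensorHom T g₁ g₂ = tensorHom T (f₁ ≫ g₁) (f₂ ≫ g₂) := by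
  apply Kleisli.hom_ext
  change ((f₁.of ⊗ₘ f₂.of) ≫ μ T.toFunctor Y₁.of Y₂.of) ≫ T.map ((g₁.of ⊗ₘ g₂.of) ≫
    μ T.toFunctor Z₁.of Z₂.of) ≫ T.μ.app _ = ((f₁.of ≫ T.map g₁.of ≫ T.μ.app Z₁.of) ⊗ₘ
      (f₂.of ≫ T.map g₂.of ≫ T.μ.app Z₂.of)) ≫ μ T.toFunctor Z₁.of Z₂.of
  have h := μ_natural T.toFunctor g₁.of g₂.of
  rw [T.map_comp, Category.assoc, Category.assoc, ← Category.assoc (μ T.toFunctor Y₁.of Y₂.of), ← h,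
    Category.assoc, μ_tensor, ← tensorHom_comp_tensorHom, ← tensorHom_comp_tensorHom,
    Category.assoc, Category.assoc]

theorem associator_nat {X₁ Y₁ X₂ Y₂ X₃ Y₃ : Kleisli T} (f₁ : X₁ ⟶ Y₁) (f₂ : X₂ ⟶ Y₂)
    (f₃ : X₃ ⟶ Y₃) : tensorHom T (tensorHom T f₁ f₂) f₃ ≫ (free T).map (α_ _ _ _).hom =
      (free T).map (α_ _ _ _).hom ≫ tensorHom T f₁ (tensorHom T f₂ f₃) := by
  apply Kleisli.hom_ext
  rw [comp_free_of, free_comp_of]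
  have h := associativity T.toFunctor Y₁.of Y₂.of Y₃.of
  have e₁ : (((f₁.of ⊗ₘ f₂.of) ≫ μ T.toFunctor Y₁.of Y₂.of) ⊗ₘ f₃.of) =
      ((f₁.of ⊗ₘ f₂.of) ⊗ₘ f₃.of) ≫ μ T.toFunctor Y₁.of Y₂.of ▷ T.obj Y₃.of := by
    rw [← tensorHom_id, tensorHom_comp_tensorHom, Category.comp_id]
  have e₂ : (f₁.of ⊗ₘ ((f₂.of ⊗ₘ f₃.of) ≫ μ T.toFunctor Y₂.of Y₃.of)) =
      (f₁.of ⊗ₘ (f₂.of ⊗ₘ f₃.of)) ≫ T.obj Y₁.of ◁ μ T.toFunctor Y₂.of Y₃.of := by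
    rw [← id_tensorHom, tensorHom_comp_tensorHom, Category.comp_id]
  change ((((f₁.of ⊗ₘ f₂.of) ≫ μ T.toFunctor Y₁.of Y₂.of) ⊗ₘ f₃.of) ≫
    μ T.toFunctor (Y₁.of ⊗ Y₂.of) Y₃.of) ≫ T.map (α_ Y₁.of Y₂.of Y₃.of).hom =
    (α_ X₁.of X₂.of X₃.of).hom ≫ (f₁.of ⊗ₘ ((f₂.of ⊗ₘ f₃.of) ≫ μ T.toFunctor Y₂.of Y₃.of)) ≫
      μ T.toFunctor Y₁.of (Y₂.of ⊗ Y₃.of)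
  rw [e₁, e₂, Category.assoc, Category.assoc, h, Category.assoc, associator_naturality_assoc]

theorem ε_eq : T.η.app (𝟙_ C) = ε T.toFunctor :=
  (Category.id_comp _).symm.trans (NatTrans.IsMonoidal.unit (τ := T.η))

theorem leftUnitor_nat {X Y : Kleisli T} (f : X ⟶ Y) :
    tensorHom T (𝟙 (Kleisli.mk T (𝟙_ C))) f ≫ (free T).map (λ_ _).hom =
      (free T).map (λ_ _).hom ≫ f := by
  apply Kleisli.hom_ext
  rw [comp_free_of]
  refine Eq.trans ?_ (free_comp_of (λ_ X.of).hom f).symm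
  change ((T.η.app (𝟙_ C) ⊗ₘ f.of) ≫ μ T.toFunctor (𝟙_ C) Y.of) ≫ T.map (λ_ Y.of).hom =
    (λ_ X.of).hom ≫ f.of
  rw [← leftUnitor_naturality, left_unitality T.toFunctor Y.of, ε_eq, tensorHom_def']
  simp only [Category.assoc]
  rfl

theorem rightUnitor_nat {X Y : Kleisli T} (f : X ⟶ Y) :
    tensorHom T f (𝟙 (Kleisli.mk T (𝟙_ C))) ≫ (free T).map (ρ_ _).hom =
      (free T).map (ρ_ _).hom ≫ f := by
  apply Kleisli.hom_ext
  rw [comp_free_of]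
  refine Eq.trans ?_ (free_comp_of (ρ_ X.of).hom f).symm
  change ((f.of ⊗ₘ T.η.app (𝟙_ C)) ≫ μ T.toFunctor Y.of (𝟙_ C)) ≫ T.map (ρ_ Y.of).hom =
    (ρ_ X.of).hom ≫ f.of
  rw [← rightUnitor_naturality, right_unitality T.toFunctor Y.of, ε_eq, MonoidalCategory.tensorHom_def]
  simp only [Category.assoc]
  rfl

theorem free_whisker₁ {X Y : C} (f : X ⟶ Y) (Z : C) :
    tensorHom T ((free T).map f) (𝟙 ((free T).obj Z)) = (free T).map (f ▷ Z) := by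
  rw [← (free T).map_id, free_tensorHom, tensorHom_id]

theorem free_whisker₂ {X Y : C} (Z : C) (f : X ⟶ Y) :
    tensorHom T (𝟙 ((free T).obj Z)) ((free T).map f) = (free T).map (Z ◁ f) := by
  rw [← (free T).map_id, free_tensorHom, id_tensorHom]

/-- The Kleisli category of a monoidal monad is monoidal. On objects, the tensor product is that of
`C`; on morphisms, it is composed with the lax monoidal structure of the monad. -/
instance monoidalKleisli : MonoidalCategory (Kleisli T) := MonoidalCategory.ofTensorHom
  (id_tensorHom_id := tensor_id)
  (tensorHom_comp_tensorHom := tensor_comp)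
  (associator_naturality := associator_nat)
  (leftUnitor_naturality := leftUnitor_nat)
  (rightUnitor_naturality := rightUnitor_nat)
  (id_tensorHom := fun _ _ _ _ => rfl)
  (tensorHom_id := fun _ _ => rfl)
  (pentagon := fun W X Y Z => (congrArg (· ≫ (free T).map (α_ W.of (X.of ⊗ Y.of) Z.of).hom ≫ _)
      (free_whisker₁ (α_ W.of X.of Y.of).hom Z.of)).trans <|
    (congrArg (fun t => _ ≫ (free T).map (α_ W.of (X.of ⊗ Y.of) Z.of).hom ≫ t)
      (free_whisker₂ W.of (α_ X.of Y.of Z.of).hom)).trans <| by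
    have h := congrArg (free T).map (MonoidalCategory.pentagon W.of X.of Y.of Z.of)
    rw [(free T).map_comp, (free T).map_comp, (free T).map_comp] at h
    exact h)
  (triangle := fun X Y => (congrArg ((free T).map (α_ X.of (𝟙_ C) Y.of).hom ≫ ·)
      (free_whisker₂ X.of (λ_ Y.of).hom)).trans <| by
    have h := congrArg (free T).map (MonoidalCategory.triangle X.of Y.of)
    rw [(free T).map_comp] at h
    exact h.trans (free_whisker₁ (ρ_ X.of).hom Y.of).symm)

/-- The free functor strictly preserves tensor products. -/
def freeCore : (free T).CoreMonoidal where
  εIso := Iso.refl _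
  μIso X Y := Iso.refl ((free T).obj (X ⊗ Y))
  μIso_hom_natural_left f Y := (Category.comp_id _).trans
    ((free_whisker₁ f Y).trans (Category.id_comp _).symm)
  μIso_hom_natural_right X f := (Category.comp_id _).trans
    ((free_whisker₂ X f).trans (Category.id_comp _).symm)
  associativity X Y Z := by
    have h₁ : 𝟙 ((free T).obj (X ⊗ Y)) ▷ (free T).obj Z = 𝟙 _ := id_whiskerRight _ _
    have h₂ : (free T).obj X ◁ 𝟙 ((free T).obj (Y ⊗ Z)) = 𝟙 _ := whiskerLeft_id _ _
    refine (congrArg (· ≫ _) h₁).trans ?_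
    refine ((Category.id_comp _).trans (Category.id_comp _)).trans ?_
    refine Eq.trans ?_ (congrArg (fun t => _ ≫ t ≫ _) h₂).symm
    exact ((Category.comp_id _).symm.trans (congrArg (_ ≫ ·) (Category.comp_id _).symm))
  left_unitality X := by
    have h₁ : 𝟙 ((free T).obj (𝟙_ C)) ▷ (free T).obj X = 𝟙 _ := id_whiskerRight _ _
    refine Eq.trans ?_ (congrArg (· ≫ _) h₁).symm
    exact ((Category.id_comp _).trans (Category.id_comp _)).symm
  right_unitality X := by
    have h₁ : (free T).obj X ◁ 𝟙 ((free T).obj (𝟙_ C)) = 𝟙 _ := whiskerLeft_id _ _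
    refine Eq.trans ?_ (congrArg (· ≫ _) h₁).symm
    exact ((Category.id_comp _).trans (Category.id_comp _)).symm

instance monoidalFree : (free T).Monoidal := freeCore.toMonoidal

end KleisliMonoidal

/-! ### The monad of a commutative central monoid -/

section FreeMonad

variable {C : Type u₁} [Category.{v₁} C] [MonoidalCategory C] (M : CommMon (Center C))

/-- The unit of `M`. -/
abbrev oneM : 𝟙_ C ⟶ (mon M).X := MonObj.one

/-- The multiplication of `M`. -/
abbrev mulM : (mon M).X ⊗ (mon M).X ⟶ (mon M).X := MonObj.mul

/-- The monad `X ↦ X ⊗ M`. -/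
def freeMonad : Monad C where
  toFunctor := tensorRight (mon M).X
  η := { app := fun X => (ρ_ X).inv ≫ X ◁ oneM M
         naturality := fun X Y f => by
          change f ≫ (ρ_ Y).inv ≫ Y ◁ oneM M = ((ρ_ X).inv ≫ X ◁ oneM M) ≫ f ▷ _
          rw [Category.assoc, whisker_exchange, rightUnitor_inv_naturality_assoc] }
  μ := { app := fun X => (α_ X (mon M).X (mon M).X).hom ≫ X ◁ mulM M
         naturality := fun X Y f => by
          change f ▷ _ ▷ _ ≫ (α_ Y (mon M).X (mon M).X).hom ≫ Y ◁ mulM M =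
            ((α_ X (mon M).X (mon M).X).hom ≫ X ◁ mulM M) ≫ f ▷ _
          rw [Category.assoc, whisker_exchange, associator_naturality_left_assoc] }
  left_unit X := by
    change ((ρ_ (X ⊗ (mon M).X)).inv ≫ (X ⊗ (mon M).X) ◁ oneM M) ≫
      (α_ X (mon M).X (mon M).X).hom ≫ X ◁ mulM M = 𝟙 (X ⊗ (mon M).X)
    have h := MonObj.mul_one (mon M).X
    simp only [Category.assoc, associator_naturality_right_assoc, ← whiskerLeft_comp, h]
    simp
  right_unit X := by
    change ((ρ_ X).inv ≫ X ◁ oneM M) ▷ _ ≫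
      (α_ X (mon M).X (mon M).X).hom ≫ X ◁ mulM M = 𝟙 (X ⊗ (mon M).X)
    have h := MonObj.one_mul (mon M).X
    simp only [Category.assoc, comp_whiskerRight, associator_naturality_middle_assoc,
      ← whiskerLeft_comp, h]
    simp
  assoc X := by
    change ((α_ X (mon M).X (mon M).X).hom ≫ X ◁ mulM M) ▷ _ ≫
      (α_ X (mon M).X (mon M).X).hom ≫ X ◁ mulM M =
      ((α_ (X ⊗ (mon M).X) (mon M).X (mon M).X).hom ≫ (X ⊗ (mon M).X) ◁ mulM M) ≫
      (α_ X (mon M).X (mon M).X).hom ≫ X ◁ mulM M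
    have h := MonObj.mul_assoc (mon M).X
    simp only [Category.assoc, comp_whiskerRight, associator_naturality_middle_assoc,
      associator_naturality_right_assoc, ← whiskerLeft_comp, h]
    simp

/-- The lax monoidal structure `X ⊗ M ⊗ Y ⊗ M → X ⊗ Y ⊗ M ⊗ M → X ⊗ Y ⊗ M`. -/
def freeMu (X Y : C) : (X ⊗ (mon M).X) ⊗ (Y ⊗ (mon M).X) ⟶ (X ⊗ Y) ⊗ (mon M).X :=
  (α_ X (mon M).X (Y ⊗ (mon M).X)).hom ≫ X ◁ ((α_ _ Y _).inv ≫ (swap M Y).hom ▷ (mon M).X ≫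
    (α_ Y _ _).hom ≫ Y ◁ mulM M) ≫ (α_ X Y _).inv

theorem freeMu_eq (X Y : C) : freeMu M X Y = 𝟙 _ ⊗≫ X ◁ (swap M Y).hom ▷ (mon M).X ⊗≫
    (X ⊗ Y) ◁ mulM M := by
  unfold freeMu
  monoidal

theorem freeMu_nat_left {X X' : C} (f : X ⟶ X') (Y : C) :
    f ▷ (mon M).X ▷ (Y ⊗ (mon M).X) ≫ freeMu M X' Y = freeMu M X Y ≫ f ▷ Y ▷ (mon M).X := by
  rw [freeMu_eq, freeMu_eq]
  calc
    _ = 𝟙 _ ⊗≫ (f ▷ ((mon M).X ⊗ Y) ≫ X' ◁ (swap M Y).hom) ▷ (mon M).X ⊗≫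
      (X' ⊗ Y) ◁ mulM M := by monoidal
    _ = 𝟙 _ ⊗≫ X ◁ (swap M Y).hom ▷ (mon M).X ⊗≫
      (f ▷ (Y ⊗ (mon M).X ⊗ (mon M).X) ≫ X' ◁ (Y ◁ mulM M)) ⊗≫ 𝟙 _ := by
        rw [← whisker_exchange]; monoidal
    _ = _ := by rw [← whisker_exchange]; monoidal

theorem freeMu_nat_right (X : C) {Y Y' : C} (f : Y ⟶ Y') :
    (X ⊗ (mon M).X) ◁ f ▷ (mon M).X ≫ freeMu M X Y' = freeMu M X Y ≫ (X ◁ f) ▷ (mon M).X := by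
  rw [freeMu_eq, freeMu_eq]
  calc
    _ = 𝟙 _ ⊗≫ X ◁ ((mon M).X ◁ f ≫ (swap M Y').hom) ▷ (mon M).X ⊗≫
      (X ⊗ Y') ◁ mulM M := by monoidal
    _ = 𝟙 _ ⊗≫ X ◁ (swap M Y).hom ▷ (mon M).X ⊗≫
      X ◁ (f ▷ ((mon M).X ⊗ (mon M).X) ≫ Y' ◁ mulM M) ⊗≫ 𝟙 _ := by
        rw [swap_nat]; monoidal
    _ = _ := by rw [← whisker_exchange]; monoidal

theorem freeMu_assoc (X Y Z : C) :
    freeMu M X Y ▷ (Z ⊗ (mon M).X) ≫ freeMu M (X ⊗ Y) Z ≫ (α_ X Y Z).hom ▷ (mon M).X =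
      (α_ _ _ _).hom ≫ (X ⊗ (mon M).X) ◁ freeMu M Y Z ≫ freeMu M X (Y ⊗ Z) := by
  have hs := swap_mul M Z
  have ht := swap_tensor M Y Z
  have hm := MonObj.mul_assoc (mon M).X
  rw [freeMu_eq, freeMu_eq, freeMu_eq, freeMu_eq]
  calc
    _ = 𝟙 _ ⊗≫ X ◁ (swap M Y).hom ▷ ((mon M).X ⊗ Z ⊗ (mon M).X) ⊗≫
        (X ⊗ Y) ◁ (mulM M ▷ Z ≫ (swap M Z).hom) ▷ (mon M).X ⊗≫
          (X ⊗ Y ⊗ Z) ◁ mulM M ⊗≫ 𝟙 _ := by monoidal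
    _ = 𝟙 _ ⊗≫ X ◁ ((swap M Y).hom ▷ ((mon M).X ⊗ Z) ≫ (Y ⊗ (mon M).X) ◁ (swap M Z).hom) ▷
          (mon M).X ⊗≫ (X ⊗ Y) ◁ ((swap M Z).hom ▷ ((mon M).X ⊗ (mon M).X)) ⊗≫
            (X ⊗ Y ⊗ Z) ◁ (mulM M ▷ (mon M).X ≫ mulM M) ⊗≫ 𝟙 _ := by
        rw [hs]; monoidal
    _ = 𝟙 _ ⊗≫ X ◁ (((mon M).X ⊗ Y) ◁ (swap M Z).hom) ▷ (mon M).X ⊗≫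
          X ◁ (swap M Y).hom ▷ (Z ⊗ (mon M).X ⊗ (mon M).X) ⊗≫
          (X ⊗ Y) ◁ ((swap M Z).hom ▷ ((mon M).X ⊗ (mon M).X) ≫ (Z ⊗ (mon M).X) ◁ mulM M)
            ⊗≫ (X ⊗ Y ⊗ Z) ◁ mulM M ⊗≫ 𝟙 _ := by
        rw [hm, ← whisker_exchange]; monoidal
    _ = 𝟙 _ ⊗≫ X ◁ (((mon M).X ⊗ Y) ◁ (swap M Z).hom) ▷ (mon M).X ⊗≫
          X ◁ ((swap M Y).hom ▷ (Z ⊗ (mon M).X ⊗ (mon M).X) ≫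
            (Y ⊗ (mon M).X) ◁ (Z ◁ mulM M)) ⊗≫
          (X ⊗ Y) ◁ ((swap M Z).hom ▷ (mon M).X)
            ⊗≫ (X ⊗ Y ⊗ Z) ◁ mulM M ⊗≫ 𝟙 _ := by
        rw [← whisker_exchange]; monoidal
    _ = _ := by
        rw [← whisker_exchange, ht]; monoidal

theorem freeMu_lunit (X : C) : (λ_ (X ⊗ (mon M).X)).hom =
    ((ρ_ (𝟙_ C)).inv ≫ 𝟙_ C ◁ oneM M) ▷ (X ⊗ (mon M).X) ≫ freeMu M (𝟙_ C) X ≫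
      (λ_ X).hom ▷ (mon M).X := by
  have hs := swap_one M X
  have hm := MonObj.one_mul (mon M).X
  rw [freeMu_eq]
  symm
  calc
    _ = 𝟙 _ ⊗≫ (oneM M ▷ X ≫ (swap M X).hom) ▷ (mon M).X ⊗≫ X ◁ mulM M := by monoidal
    _ = 𝟙 _ ⊗≫ X ◁ (oneM M ▷ (mon M).X ≫ mulM M) := by rw [hs]; monoidal
    _ = _ := by rw [hm]; monoidal

theorem swap_unit : (swap M (𝟙_ C)).hom = (ρ_ _).hom ≫ (λ_ _).inv := by
  have h₁ := swap_nat M (λ_ (𝟙_ C)).hom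
  rw [swap_tensor] at h₁
  have h₂ : (mon M).X ◁ (λ_ (𝟙_ C)).hom ≫ (swap M (𝟙_ C)).hom =
      (α_ _ _ _).inv ≫ ((swap M (𝟙_ C)).hom ≫ (λ_ _).hom) ▷ 𝟙_ C ≫ (swap M (𝟙_ C)).hom := by
    rw [h₁]
    have h₃ : 𝟙_ C ◁ (swap M (𝟙_ C)).hom ≫ (λ_ _).hom = (λ_ _).hom ≫ (swap M (𝟙_ C)).hom :=
      leftUnitor_naturality _
    have h₄ : (α_ (𝟙_ C) (𝟙_ C) (mon M).X).inv ≫ (λ_ (𝟙_ C)).hom ▷ (mon M).X =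
      (λ_ (𝟙_ C ⊗ (mon M).X)).hom := by monoidal
    have h₅ : (λ_ (mon M).X).hom ▷ 𝟙_ C = (α_ _ _ _).hom ≫ (λ_ ((mon M).X ⊗ 𝟙_ C)).hom := by
      monoidal
    simp only [Category.assoc, comp_whiskerRight]
    rw [h₄, h₃, h₅, Category.assoc]
  rw [← Category.assoc, cancel_mono, Iso.eq_inv_comp, MonoidalCategory.triangle] at h₂
  rw [Iso.eq_comp_inv]
  exact ((whiskerRight_iff _ _).1 h₂).symm

theorem freeMu_runit (X : C) : (ρ_ (X ⊗ (mon M).X)).hom =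
    (X ⊗ (mon M).X) ◁ ((ρ_ (𝟙_ C)).inv ≫ 𝟙_ C ◁ oneM M) ≫ freeMu M X (𝟙_ C) ≫
      (ρ_ X).hom ▷ (mon M).X := by
  have hs : (swap M (𝟙_ C)).hom = (ρ_ _).hom ≫ (λ_ _).inv := swap_unit M
  have hm := MonObj.mul_one (mon M).X
  rw [freeMu_eq, hs]
  symm
  calc
    _ = 𝟙 _ ⊗≫ X ◁ ((mon M).X ◁ oneM M ≫ mulM M) := by monoidal
    _ = _ := by rw [hm]; monoidal

theorem freeMu_one (X Y : C) : (ρ_ (X ⊗ Y)).inv ≫ (X ⊗ Y) ◁ oneM M =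
    (((ρ_ X).inv ≫ X ◁ oneM M) ⊗ₘ ((ρ_ Y).inv ≫ Y ◁ oneM M)) ≫ freeMu M X Y := by
  have hs := swap_one M Y
  have hm := MonObj.mul_one (mon M).X
  rw [freeMu_eq]
  symm
  calc
    _ = 𝟙 _ ⊗≫ X ◁ (oneM M ▷ Y ≫ (swap M Y).hom) ⊗≫ (X ⊗ Y) ◁ ((mon M).X ◁ oneM M ≫ mulM M) := by
      rw [MonoidalCategory.tensorHom_def]
      calc
        _ = 𝟙 _ ⊗≫ X ◁ oneM M ▷ Y ⊗≫ X ◁ (((mon M).X ⊗ Y) ◁ oneM M ≫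
          (swap M Y).hom ▷ (mon M).X) ⊗≫ (X ⊗ Y) ◁ mulM M := by monoidal
        _ = _ := by rw [whisker_exchange]; monoidal
    _ = 𝟙 _ ⊗≫ (X ⊗ Y) ◁ oneM M ⊗≫ 𝟙 _ := by rw [hs, hm]; monoidal
    _ = _ := by monoidal

theorem mul_swap_mul : 𝟙 _ ⊗≫ (mon M).X ◁ (swap M (mon M).X).hom ▷ (mon M).X ⊗≫
    ((mon M).X ⊗ (mon M).X) ◁ mulM M ⊗≫ mulM M ▷ (mon M).X ≫ mulM M =
    𝟙 (((mon M).X ⊗ (mon M).X) ⊗ ((mon M).X ⊗ (mon M).X)) ⊗≫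
      mulM M ▷ ((mon M).X ⊗ (mon M).X) ⊗≫ (mon M).X ◁ mulM M ≫ mulM M := by
  have hc : (swap M (mon M).X).hom ≫ mulM M = mulM M := swap_comm M
  have hm : mulM M ▷ (mon M).X ≫ mulM M = (α_ _ _ _).hom ≫ (mon M).X ◁ mulM M ≫ mulM M :=
    MonObj.mul_assoc (mon M).X
  have h₁ : ((mon M).X ⊗ (mon M).X) ◁ mulM M ⊗≫ mulM M ▷ (mon M).X ≫ mulM M =
      𝟙 _ ⊗≫ (mon M).X ◁ mulM M ▷ (mon M).X ⊗≫ mulM M ▷ (mon M).X ≫ mulM M := by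
    calc
      _ = 𝟙 _ ⊗≫ (mon M).X ◁ ((mon M).X ◁ mulM M ≫ mulM M) ⊗≫ mulM M := by rw [hm]; monoidal
      _ = 𝟙 _ ⊗≫ (mon M).X ◁ (𝟙 ((mon M).X ⊗ (mon M).X ⊗ (mon M).X) ⊗≫ mulM M ▷ (mon M).X ≫ mulM M) ⊗≫ mulM M := by
        rw [hm]; monoidal
      _ = _ := by
        have e : 𝟙 (((mon M).X ⊗ (mon M).X) ⊗ ((mon M).X ⊗ (mon M).X)) ⊗≫
          (mon M).X ◁ mulM M ▷ (mon M).X ⊗≫ mulM M ▷ (mon M).X ≫ mulM M =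
          𝟙 _ ⊗≫ (mon M).X ◁ mulM M ▷ (mon M).X ⊗≫ (mon M).X ◁ mulM M ≫ mulM M := by
            rw [hm]; monoidal
        rw [e]; monoidal
  have h₂ : ((mon M).X ⊗ (mon M).X) ◁ mulM M ⊗≫ mulM M ▷ (mon M).X ≫ mulM M =
      𝟙 _ ⊗≫ mulM M ▷ ((mon M).X ⊗ (mon M).X) ⊗≫ (mon M).X ◁ mulM M ≫ mulM M := by
    calc
      _ = (((mon M).X ⊗ (mon M).X) ◁ mulM M ≫ mulM M ▷ (mon M).X) ⊗≫ mulM M := by monoidal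
      _ = _ := by rw [whisker_exchange]; monoidal
  calc
    _ = 𝟙 _ ⊗≫ (mon M).X ◁ (swap M (mon M).X).hom ▷ (mon M).X ⊗≫
      (((mon M).X ⊗ (mon M).X) ◁ mulM M ⊗≫ mulM M ▷ (mon M).X ≫ mulM M) := by monoidal
    _ = 𝟙 _ ⊗≫ (mon M).X ◁ ((swap M (mon M).X).hom ≫ mulM M) ▷ (mon M).X ⊗≫
      mulM M ▷ (mon M).X ≫ mulM M := by rw [h₁]; monoidal
    _ = 𝟙 _ ⊗≫ (mon M).X ◁ mulM M ▷ (mon M).X ⊗≫ mulM M ▷ (mon M).X ≫ mulM M := by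
      rw [hc]
    _ = _ := h₁.symm.trans h₂

theorem freeMu_mul (X Y : C) : freeMu M (X ⊗ (mon M).X) (Y ⊗ (mon M).X) ≫
    freeMu M X Y ▷ (mon M).X ≫ (α_ (X ⊗ Y) _ _).hom ≫ (X ⊗ Y) ◁ mulM M =
    (((α_ X _ _).hom ≫ X ◁ mulM M) ⊗ₘ ((α_ Y _ _).hom ≫ Y ◁ mulM M)) ≫ freeMu M X Y := by
  have hs := swap_mul M Y
  have ht := swap_tensor M Y (mon M).X
  have ha := mul_swap_mul M
  rw [freeMu_eq, freeMu_eq, MonoidalCategory.tensorHom_def]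
  calc
    _ = 𝟙 _ ⊗≫ (X ⊗ (mon M).X) ◁ (swap M Y).hom ▷ ((mon M).X ⊗ (mon M).X) ⊗≫
        (X ⊗ (mon M).X ⊗ Y) ◁ (swap M (mon M).X).hom ▷ (mon M).X ⊗≫
        X ◁ (((mon M).X ⊗ Y) ◁ ((mon M).X ◁ mulM M) ≫ (swap M Y).hom ▷ ((mon M).X ⊗ (mon M).X)) ⊗≫
        (X ⊗ Y) ◁ (mulM M ▷ (mon M).X ≫ mulM M) := by rw [ht]; monoidal
    _ = 𝟙 _ ⊗≫ (X ⊗ (mon M).X) ◁ (swap M Y).hom ▷ ((mon M).X ⊗ (mon M).X) ⊗≫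
        X ◁ (((mon M).X ⊗ Y) ◁ ((swap M (mon M).X).hom ▷ (mon M).X) ≫
          (swap M Y).hom ▷ (((mon M).X ⊗ (mon M).X) ⊗ (mon M).X)) ⊗≫
        (X ⊗ Y) ◁ (((mon M).X ⊗ (mon M).X) ◁ mulM M ⊗≫ mulM M ▷ (mon M).X ≫ mulM M) := by
      rw [whisker_exchange]; monoidal
    _ = 𝟙 _ ⊗≫ (X ⊗ (mon M).X) ◁ (swap M Y).hom ▷ ((mon M).X ⊗ (mon M).X) ⊗≫
        X ◁ (swap M Y).hom ▷ ((mon M).X ⊗ (mon M).X ⊗ (mon M).X) ⊗≫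
        (X ⊗ Y) ◁ (𝟙 (((mon M).X ⊗ (mon M).X) ⊗ ((mon M).X ⊗ (mon M).X)) ⊗≫ (mon M).X ◁ (swap M (mon M).X).hom ▷ (mon M).X ⊗≫
          ((mon M).X ⊗ (mon M).X) ◁ mulM M ⊗≫ mulM M ▷ (mon M).X ≫ mulM M) := by
      rw [whisker_exchange]; monoidal
    _ = 𝟙 _ ⊗≫ X ◁ (𝟙 (((mon M).X ⊗ (mon M).X) ⊗ Y) ⊗≫ (mon M).X ◁ (swap M Y).hom ⊗≫ (swap M Y).hom ▷ (mon M).X ⊗≫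
          Y ◁ mulM M) ▷ ((mon M).X ⊗ (mon M).X) ⊗≫
        (X ⊗ Y) ◁ ((mon M).X ◁ mulM M ≫ mulM M) := by
      rw [ha]; monoidal
    _ = 𝟙 _ ⊗≫ X ◁ (mulM M ▷ Y ≫ (swap M Y).hom) ▷ ((mon M).X ⊗ (mon M).X) ⊗≫
        (X ⊗ Y) ◁ ((mon M).X ◁ mulM M ≫ mulM M) := by
      rw [hs]; monoidal
    _ = 𝟙 _ ⊗≫ X ◁ mulM M ▷ (Y ⊗ (mon M).X ⊗ (mon M).X) ⊗≫ X ◁ ((swap M Y).hom ▷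
          ((mon M).X ⊗ (mon M).X) ≫ (Y ⊗ (mon M).X) ◁ mulM M) ⊗≫ (X ⊗ Y) ◁ mulM M := by
      monoidal
    _ = _ := by rw [← whisker_exchange]; monoidal

instance freeMonadLax : (freeMonad M).toFunctor.LaxMonoidal where
  ε := (ρ_ (𝟙_ C)).inv ≫ 𝟙_ C ◁ oneM M
  μ X Y := freeMu M X Y
  μ_natural_left f Y := freeMu_nat_left M f Y
  μ_natural_right X f := freeMu_nat_right M X f
  associativity X Y Z := freeMu_assoc M X Y Z
  left_unitality X := freeMu_lunit M X
  right_unitality X := freeMu_runit M X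

instance freeMonad_η : NatTrans.IsMonoidal (freeMonad M).η where
  unit := Category.id_comp _
  tensor X Y := (Category.id_comp _).trans (freeMu_one M X Y)

instance freeMonad_μ : NatTrans.IsMonoidal (freeMonad M).μ where
  unit := by
    have h := MonObj.one_mul (mon M).X
    change (((ρ_ (𝟙_ C)).inv ≫ 𝟙_ C ◁ oneM M) ≫ ((ρ_ (𝟙_ C)).inv ≫ 𝟙_ C ◁ oneM M) ▷ (mon M).X) ≫
      (α_ _ _ _).hom ≫ 𝟙_ C ◁ mulM M = (ρ_ (𝟙_ C)).inv ≫ 𝟙_ C ◁ oneM M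
    simp only [Category.assoc, comp_whiskerRight, associator_naturality_middle_assoc,
      ← whiskerLeft_comp]
    erw [h]
    simp
  tensor X Y := (Category.assoc _ _ _).trans (freeMu_mul M X Y)

end FreeMonad

/-! ## Yetter-Drinfeld modules -/

section RawYD

variable {k H V W U W' : Type*} [CommRing k] [Ring H] [Bialgebra k H]
  [AddCommGroup V] [Module k V] [AddCommGroup W] [Module k W] [AddCommGroup U] [Module k U]
  [AddCommGroup W'] [Module k W']

/-- The map `v ⊗ w ↦ v₍₋₁₎ w ⊗ v₍₀₎`. -/
def coSwap (δ : V →ₗ[k] H ⊗[k] V) (b : H →ₐ[k] Module.End k W) : V ⊗[k] W →ₗ[k] W ⊗[k] V :=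
  TensorProduct.lift (LinearMap.flip
    { toFun := fun w => (b.toLinearMap.flip w).rTensor V ∘ₗ δ
      map_add' := fun w w' => by rw [map_add, LinearMap.rTensor_add, LinearMap.add_comp]
      map_smul' := fun c w => by
        rw [map_smul, LinearMap.rTensor_smul, LinearMap.smul_comp, RingHom.id_apply] })

theorem coSwap_tmul (δ : V →ₗ[k] H ⊗[k] V) (b : H →ₐ[k] Module.End k W) (v : V) (w : W) :
    coSwap δ b (v ⊗ₜ w) = (b.toLinearMap.flip w).rTensor V (δ v) := rfl

variable (k H) in
/-- The left regular representation. -/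
abbrev lmul : H →ₐ[k] Module.End k H := Algebra.lmul k H

theorem coSwap_one (δ : V →ₗ[k] H ⊗[k] V) (v : V) : coSwap δ (lmul k H) (v ⊗ₜ 1) = δ v := by
  rw [coSwap_tmul]
  have : (lmul k H).toLinearMap.flip 1 = LinearMap.id := LinearMap.ext fun x => mul_one x
  rw [this, LinearMap.rTensor_id]; rfl

theorem coSwap_nat (δ : V →ₗ[k] H ⊗[k] V) (b : H →ₐ[k] Module.End k W)
    (b' : H →ₐ[k] Module.End k W') (f : W →ₗ[k] W') (hf : ∀ h w, f (b h w) = b' h (f w))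
    (z : V ⊗[k] W) : coSwap δ b' (f.lTensor V z) = f.rTensor V (coSwap δ b z) := by
  induction z with
  | zero => simp
  | add x y hx hy => simp only [map_add, hx, hy]
  | tmul v w =>
    have e : b'.toLinearMap.flip (f w) = f ∘ₗ b.toLinearMap.flip w :=
      LinearMap.ext fun h => (hf h w).symm
    rw [LinearMap.lTensor_tmul, coSwap_tmul, coSwap_tmul, e, LinearMap.rTensor_comp]
    rfl

theorem coSwap_linear (δ : V →ₗ[k] H ⊗[k] V) (a : H →ₐ[k] Module.End k V)
    (hδ : ∀ h v, tensorAct (lmul k H) a h (δ v) =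
      coSwap δ (lmul k H) (tensorAct a (lmul k H) h (v ⊗ₜ 1)))
    (b : H →ₐ[k] Module.End k W) (h : H) (z : V ⊗[k] W) :
    coSwap δ b (tensorAct a b h z) = tensorAct b a h (coSwap δ b z) := by
  induction z with
  | zero => simp
  | add x y hx hy => simp only [map_add, hx, hy]
  | tmul v w =>
    let r : H →ₗ[k] W := b.toLinearMap.flip w
    have hr : ∀ h x, r (lmul k H h x) = b h (r x) := fun h x => by
      change b (h * x) w = b h (b x w)
      rw [map_mul]; rfl
    have e : v ⊗ₜ[k] w = r.lTensor V (v ⊗ₜ[k] (1 : H)) := by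
      change v ⊗ₜ[k] w = v ⊗ₜ[k] (b 1 w)
      rw [map_one]; rfl
    have e₁ : ∀ t z, r.lTensor V (actT a (lmul k H) t z) = actT a b t (r.lTensor V z) :=
      actT_map a (lmul k H) a b LinearMap.id r (fun _ _ => rfl) hr
    have e₂ : ∀ t z, r.rTensor V (actT (lmul k H) a t z) = actT b a t (r.rTensor V z) :=
      actT_map (lmul k H) a b a r LinearMap.id hr (fun _ _ => rfl)
    rw [e, tensorAct_apply, ← e₁, coSwap_nat δ (lmul k H) b r hr, coSwap_nat δ (lmul k H) b r hr,
      coSwap_one, ← tensorAct_apply, ← hδ, tensorAct_apply, e₂]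
    rfl

theorem coSwap_tensor (δ : V →ₗ[k] H ⊗[k] V)
    (hδ : ∀ v, δ.lTensor H (δ v) = TensorProduct.assoc k H H V
      ((Coalgebra.comul (R := k)).rTensor V (δ v)))
    (b : H →ₐ[k] Module.End k W) (b' : H →ₐ[k] Module.End k W') (v : V) (w : W) (w' : W') :
    coSwap δ (tensorAct b b') (v ⊗ₜ (w ⊗ₜ w')) = (TensorProduct.assoc k W W' V).symm
      ((coSwap δ b').lTensor W (TensorProduct.assoc k W V W' ((coSwap δ b).rTensor W'
        ((TensorProduct.assoc k V W W').symm (v ⊗ₜ (w ⊗ₜ w')))))) := by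
  have h1 : ∀ (a : H) (t : H ⊗[k] V), (TensorProduct.assoc k W W' V).symm
      ((b a w) ⊗ₜ ((b'.toLinearMap.flip w').rTensor V t)) =
      (TensorProduct.map (b.toLinearMap.flip w) (b'.toLinearMap.flip w')).rTensor V
        ((TensorProduct.assoc k H H V).symm (a ⊗ₜ t)) := by
    intro a t
    induction t with
    | zero => simp
    | add x y hx hy => simp only [map_add, TensorProduct.tmul_add, hx, hy]
    | tmul x y => rfl
  have h2 : ∀ y : H ⊗[k] V, (TensorProduct.assoc k W W' V).symm
      ((coSwap δ b').lTensor W (TensorProduct.assoc k W V W'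
        (((b.toLinearMap.flip w).rTensor V y) ⊗ₜ w'))) =
      (TensorProduct.map (b.toLinearMap.flip w) (b'.toLinearMap.flip w')).rTensor V
        ((TensorProduct.assoc k H H V).symm (δ.lTensor H y)) := by
    intro y
    induction y with
    | zero => simp
    | add x y hx hy => simp only [map_add, TensorProduct.add_tmul, hx, hy]
    | tmul a x => exact h1 a (δ x)
  have h3 : ∀ y : H ⊗[k] V, ((tensorAct b b').toLinearMap.flip (w ⊗ₜ w')).rTensor V y =
      (TensorProduct.map (b.toLinearMap.flip w) (b'.toLinearMap.flip w')).rTensor V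
        ((Coalgebra.comul (R := k)).rTensor V y) := by
    intro y
    rw [← LinearMap.comp_apply, ← LinearMap.rTensor_comp]
    congr 2
    ext h
    have h4 : ∀ t : H ⊗[k] H, actT b b' t (w ⊗ₜ w') =
        TensorProduct.map (b.toLinearMap.flip w) (b'.toLinearMap.flip w') t := by
      intro t
      induction t with
      | zero => simp
      | add x y hx hy => simp only [map_add, LinearMap.add_apply, hx, hy]
      | tmul x y => rfl
    exact h4 _
  rw [coSwap_tmul, h3]
  refine Eq.trans ?_ (h2 (δ v)).symm
  rw [hδ, LinearEquiv.symm_apply_apply]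

theorem coact_cancel (δ : V →ₗ[k] H ⊗[k] V)
    (hε : ∀ v, TensorProduct.lid k V ((Coalgebra.counit (R := k)).rTensor V (δ v)) = v)
    (hδ : ∀ v, δ.lTensor H (δ v) = TensorProduct.assoc k H H V
      ((Coalgebra.comul (R := k)).rTensor V (δ v))) (P : H ⊗[k] H →ₗ[k] W) (w : W)
    (hP : ∀ h, P (Coalgebra.comul (R := k) h) = Coalgebra.counit (R := k) h • w) (v : V) :
    P.rTensor V ((TensorProduct.assoc k H H V).symm (δ.lTensor H (δ v))) = w ⊗ₜ v := by
  have h1 : ∀ y : H ⊗[k] V, P.rTensor V ((Coalgebra.comul (R := k)).rTensor V y) =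
      w ⊗ₜ TensorProduct.lid k V ((Coalgebra.counit (R := k)).rTensor V y) := by
    intro y
    induction y with
    | zero => simp
    | add x y hx hy => simp only [map_add, TensorProduct.tmul_add, hx, hy]
    | tmul a x => simp [hP, TensorProduct.smul_tmul]
  rw [hδ, LinearEquiv.symm_apply_apply, h1, hε]

end RawYD

section RawYD₂

variable {k H V W : Type*} [CommRing k] [Ring H] [Bialgebra k H]
  [AddCommGroup V] [Module k V] [AddCommGroup W] [Module k W]

/-- The map `w ⊗ v ↦ v₍₀₎ ⊗ S(v₍₋₁₎) w`. -/
def coSwapInv (δ : V →ₗ[k] H ⊗[k] V) (S : H →ₗ[k] H) (b : H →ₐ[k] Module.End k W) :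
    W ⊗[k] V →ₗ[k] V ⊗[k] W :=
  TensorProduct.lift
    { toFun := fun w => (TensorProduct.comm k W V).toLinearMap ∘ₗ
        ((b.toLinearMap.flip w) ∘ₗ S).rTensor V ∘ₗ δ
      map_add' := fun w w' => by
        rw [map_add, LinearMap.add_comp, LinearMap.rTensor_add, LinearMap.add_comp,
          LinearMap.comp_add]
      map_smul' := fun c w => by
        rw [map_smul, LinearMap.smul_comp, LinearMap.rTensor_smul, LinearMap.smul_comp,
          LinearMap.comp_smul, RingHom.id_apply] }

theorem coSwapInv_tmul (δ : V →ₗ[k] H ⊗[k] V) (S : H →ₗ[k] H) (b : H →ₐ[k] Module.End k W)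
    (w : W) (v : V) : coSwapInv δ S b (w ⊗ₜ v) = TensorProduct.comm k W V
      (((b.toLinearMap.flip w) ∘ₗ S).rTensor V (δ v)) := rfl

variable (δ : V →ₗ[k] H ⊗[k] V)
    (hε : ∀ v, TensorProduct.lid k V ((Coalgebra.counit (R := k)).rTensor V (δ v)) = v)
    (hδ : ∀ v, δ.lTensor H (δ v) = TensorProduct.assoc k H H V
      ((Coalgebra.comul (R := k)).rTensor V (δ v))) (S : H →ₗ[k] H)

theorem coSwap_coSwapInv
    (hε : ∀ v, TensorProduct.lid k V ((Coalgebra.counit (R := k)).rTensor V (δ v)) = v)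
    (hδ : ∀ v, δ.lTensor H (δ v) = TensorProduct.assoc k H H V
      ((Coalgebra.comul (R := k)).rTensor V (δ v)))
    (hS : ∀ x, LinearMap.mul' k H (S.lTensor H (cop k H x)) =
      algebraMap k H (Coalgebra.counit (R := k) x))
    (b : H →ₐ[k] Module.End k W) (z : W ⊗[k] V) : coSwap δ b (coSwapInv δ S b z) = z := by
  induction z with
  | zero => simp
  | add x y hx hy => simp only [map_add, hx, hy]
  | tmul w v =>
    let P : H ⊗[k] H →ₗ[k] W := (b.toLinearMap.flip w) ∘ₗ LinearMap.mul' k H ∘ₗ S.lTensor H ∘ₗ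
      (TensorProduct.comm k H H).toLinearMap
    have h1 : ∀ (a : H) (t : H ⊗[k] V), (b.toLinearMap.flip (b (S a) w)).rTensor V t =
        P.rTensor V ((TensorProduct.assoc k H H V).symm (a ⊗ₜ t)) := by
      intro a t
      induction t with
      | zero => simp
      | add x y hx hy => simp only [map_add, TensorProduct.tmul_add, hx, hy]
      | tmul x y =>
        change b x (b (S a) w) ⊗ₜ y = b (x * S a) w ⊗ₜ y
        rw [map_mul]; rfl
    have h2 : ∀ y : H ⊗[k] V, coSwap δ b (TensorProduct.comm k W V
        (((b.toLinearMap.flip w) ∘ₗ S).rTensor V y)) =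
        P.rTensor V ((TensorProduct.assoc k H H V).symm (δ.lTensor H y)) := by
      intro y
      induction y with
      | zero => simp
      | add x y hx hy => simp only [map_add, hx, hy]
      | tmul a x => exact h1 a (δ x)
    rw [coSwapInv_tmul, h2, coact_cancel δ hε hδ P w]
    intro h
    change b (LinearMap.mul' k H (S.lTensor H (cop k H h))) w = _
    rw [hS, AlgHom.commutes]
    rfl

theorem coSwapInv_coSwap
    (hε : ∀ v, TensorProduct.lid k V ((Coalgebra.counit (R := k)).rTensor V (δ v)) = v)
    (hδ : ∀ v, δ.lTensor H (δ v) = TensorProduct.assoc k H H V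
      ((Coalgebra.comul (R := k)).rTensor V (δ v)))
    (hS : ∀ x, LinearMap.mul' k H (S.rTensor H (cop k H x)) =
      algebraMap k H (Coalgebra.counit (R := k) x))
    (b : H →ₐ[k] Module.End k W) (z : V ⊗[k] W) : coSwapInv δ S b (coSwap δ b z) = z := by
  induction z with
  | zero => simp
  | add x y hx hy => simp only [map_add, hx, hy]
  | tmul v w =>
    let P : H ⊗[k] H →ₗ[k] W := (b.toLinearMap.flip w) ∘ₗ LinearMap.mul' k H ∘ₗ S.rTensor H ∘ₗ
      (TensorProduct.comm k H H).toLinearMap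
    have h1 : ∀ (a : H) (t : H ⊗[k] V), TensorProduct.comm k W V
        (((b.toLinearMap.flip (b a w)) ∘ₗ S).rTensor V t) = TensorProduct.comm k W V
        (P.rTensor V ((TensorProduct.assoc k H H V).symm (a ⊗ₜ t))) := by
      intro a t
      induction t with
      | zero => simp
      | add x y hx hy => simp only [map_add, TensorProduct.tmul_add, hx, hy]
      | tmul x y =>
        change y ⊗ₜ b (S x) (b a w) = y ⊗ₜ b (S x * a) w
        rw [map_mul]; rfl
    have h2 : ∀ y : H ⊗[k] V, coSwapInv δ S b ((b.toLinearMap.flip w).rTensor V y) =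
        TensorProduct.comm k W V
        (P.rTensor V ((TensorProduct.assoc k H H V).symm (δ.lTensor H y))) := by
      intro y
      induction y with
      | zero => simp
      | add x y hx hy => simp only [map_add, hx, hy]
      | tmul a x => exact h1 a (δ x)
    rw [coSwap_tmul, h2, coact_cancel δ hε hδ P w]
    · rfl
    intro h
    change b (LinearMap.mul' k H (S.rTensor H (cop k H h))) w = _
    rw [hS, AlgHom.commutes]
    rfl

end RawYD₂

/-- Left Yetter-Drinfeld modules: left modules and left comodules `v ↦ v₍₋₁₎ ⊗ v₍₀₎` such that
`h₁ v₍₋₁₎ ⊗ h₂ v₍₀₎ = (h₁ v)₍₋₁₎ h₂ ⊗ (h₁ v)₍₀₎`. -/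
structure YD (k H : Type u) [CommRing k] [Ring H] [Bialgebra k H] where
  /-- the underlying module -/
  X : LMod k H
  /-- the coaction -/
  δ : X.V →ₗ[k] H ⊗[k] X.V
  counit : ∀ v, TensorProduct.lid k X.V ((Coalgebra.counit (R := k)).rTensor X.V (δ v)) = v
  coassoc : ∀ v, δ.lTensor H (δ v) = TensorProduct.assoc k H H X.V
      ((Coalgebra.comul (R := k)).rTensor X.V (δ v))
  compat : ∀ h v, tensorAct (lmul k H) X.ρ h (δ v) =
      coSwap δ (lmul k H) (tensorAct X.ρ (lmul k H) h (v ⊗ₜ 1))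

namespace YD

section

variable {k H : Type u} [CommRing k] [Ring H] [Bialgebra k H]

/-- Morphisms of Yetter-Drinfeld modules: linear and colinear maps. -/
@[ext]
structure Hom (P Q : YD k H) where
  /-- the underlying morphism of modules -/
  f : P.X ⟶ Q.X
  comm : ∀ v, Q.δ (f.f.hom v) = f.f.hom.lTensor H (P.δ v)

instance : Category (YD k H) where
  Hom := Hom
  id P := ⟨𝟙 P.X, fun v => by
    change P.δ v = LinearMap.id.lTensor H (P.δ v)
    rw [LinearMap.lTensor_id]; rfl⟩
  comp {P Q R} f g := ⟨f.f ≫ g.f, fun v => by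
    change R.δ (g.f.f.hom (f.f.f.hom v)) = (g.f.f.hom ∘ₗ f.f.f.hom).lTensor H (P.δ v)
    rw [g.comm, f.comm, LinearMap.lTensor_comp]; rfl⟩

@[ext]
theorem hom_ext {P Q : YD k H} {f g : P ⟶ Q} (w : f.f = g.f) : f = g := Hom.ext w

@[simp] theorem id_f (P : YD k H) : Hom.f (𝟙 P) = 𝟙 P.X := rfl
@[simp] theorem comp_f {P Q R : YD k H} (f : P ⟶ Q) (g : Q ⟶ R) : (f ≫ g).f = f.f ≫ g.f := rfl

variable (k H) in
/-- The functor forgetting the coaction. -/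
def forgetCo : YD k H ⥤ LMod k H where
  obj P := P.X
  map f := f.f

instance : (forgetCo k H).Faithful where
  map_injective w := hom_ext w

end
end YD

/-! ### Yetter-Drinfeld modules and half-braidings -/

section HB

variable {C : Type u₁} [Category.{v₁} C] [MonoidalCategory C]

theorem halfBraiding_unit {X : C} (c : HalfBraiding X) :
    (c.β (𝟙_ C)).hom = (ρ_ X).hom ≫ (λ_ X).inv := by
  have h₁ := c.naturality (λ_ (𝟙_ C)).hom
  rw [c.monoidal] at h₁
  have h₂ : X ◁ (λ_ (𝟙_ C)).hom ≫ (c.β (𝟙_ C)).hom =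
      (α_ _ _ _).inv ≫ ((c.β (𝟙_ C)).hom ≫ (λ_ _).hom) ▷ 𝟙_ C ≫ (c.β (𝟙_ C)).hom := by
    rw [h₁]
    have h₃ : 𝟙_ C ◁ (c.β (𝟙_ C)).hom ≫ (λ_ _).hom = (λ_ _).hom ≫ (c.β (𝟙_ C)).hom :=
      leftUnitor_naturality _
    have h₄ : (α_ (𝟙_ C) (𝟙_ C) X).inv ≫ (λ_ (𝟙_ C)).hom ▷ X =
      (λ_ (𝟙_ C ⊗ X)).hom := by monoidal
    have h₅ : (λ_ X).hom ▷ 𝟙_ C = (α_ _ _ _).hom ≫ (λ_ (X ⊗ 𝟙_ C)).hom := by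
      monoidal
    simp only [Category.assoc, comp_whiskerRight]
    rw [h₄, h₃, h₅, Category.assoc]
  rw [← Category.assoc, cancel_mono, Iso.eq_inv_comp, MonoidalCategory.triangle] at h₂
  rw [Iso.eq_comp_inv]
  exact ((whiskerRight_iff _ _).1 h₂).symm

end HB

section Coac

variable {k H : Type u} [CommRing k] [Ring H] [Bialgebra k H]

variable (k H) in
/-- The left regular module. -/
abbrev reg : LMod k H := ⟨ModuleCat.of k H, lmul k H⟩

/-- The morphism `h ↦ h u`. -/
def orbit (U : LMod k H) (u : U.V) : reg k H ⟶ U :=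
  ⟨ModuleCat.ofHom (U.ρ.toLinearMap.flip u), fun h x => by
    change U.ρ (h * x) u = U.ρ h (U.ρ x u)
    rw [map_mul]; rfl⟩

/-- The coaction `v ↦ c(v ⊗ 1)` obtained from a half-braiding. -/
def coac {X : LMod k H} (c : HalfBraiding X) : X.V →ₗ[k] H ⊗[k] X.V :=
  (c.β (reg k H)).hom.f.hom ∘ₗ (TensorProduct.mk k X.V H).flip 1

theorem coac_apply {X : LMod k H} (c : HalfBraiding X) (v : X.V) :
    coac c v = (c.β (reg k H)).hom.f.hom (v ⊗ₜ[k] (1 : H)) := rfl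

theorem hb_tmul {X : LMod k H} (c : HalfBraiding X) (U : LMod k H) (v : X.V) (w : U.V) :
    (c.β U).hom.f.hom (v ⊗ₜ[k] w) = coSwap (coac c) U.ρ (v ⊗ₜ w) := by
  have h := congrArg (fun t => t.f.hom (v ⊗ₜ[k] (1 : H))) (c.naturality (orbit U w))
  have e : v ⊗ₜ[k] w = (U.ρ.toLinearMap.flip w).lTensor X.V (v ⊗ₜ[k] (1 : H)) := by
    change v ⊗ₜ[k] w = v ⊗ₜ[k] (U.ρ 1 w)
    rw [map_one]; rfl
  rw [coSwap_tmul, e]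
  exact h

theorem hb_apply {X : LMod k H} (c : HalfBraiding X) (U : LMod k H) (z : X.V ⊗[k] U.V) :
    (c.β U).hom.f.hom z = coSwap (coac c) U.ρ z := by
  induction z with
  | zero => exact (map_zero (c.β U).hom.f.hom).trans (map_zero _).symm
  | add x y hx hy =>
    exact (map_add (c.β U).hom.f.hom x y).trans ((congrArg₂ (· + ·) hx hy).trans
      (map_add _ _ _).symm)
  | tmul v w => exact hb_tmul c U v w

theorem coac_counit {X : LMod k H} (c : HalfBraiding X) (v : X.V) :
    TensorProduct.lid k X.V ((Coalgebra.counit (R := k)).rTensor X.V (coac c v)) = v := by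
  have h : (c.β (𝟙_ (LMod k H))).hom.f.hom (v ⊗ₜ[k] (1 : k)) =
      (((ρ_ X).hom ≫ (λ_ X).inv) : X ⊗ 𝟙_ _ ⟶ 𝟙_ _ ⊗ X).f.hom (v ⊗ₜ[k] (1 : k)) :=
    congrArg (fun t => t.f.hom (v ⊗ₜ[k] (1 : k))) (halfBraiding_unit c)
  rw [hb_tmul c (𝟙_ (LMod k H)) v (1 : k), coSwap_tmul] at h
  have e : (LMod.ρ (𝟙_ (LMod k H))).toLinearMap.flip (1 : k) = Coalgebra.counit (R := k) (A := H) :=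
    LinearMap.ext fun x => mul_one _
  rw [e] at h
  rw [h]
  change TensorProduct.lid k X.V ((TensorProduct.lid k X.V).symm
    (TensorProduct.rid k X.V (v ⊗ₜ[k] (1 : k)))) = v
  rw [LinearEquiv.apply_symm_apply, TensorProduct.rid_tmul, one_smul]

theorem coac_coassoc {X : LMod k H} (c : HalfBraiding X) (v : X.V) :
    (coac c).lTensor H (coac c v) = TensorProduct.assoc k H H X.V
      ((Coalgebra.comul (R := k)).rTensor X.V (coac c v)) := by
  have h : (c.β (reg k H ⊗ reg k H)).hom.f.hom (v ⊗ₜ[k] ((1 : H) ⊗ₜ[k] (1 : H))) =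
      (TensorProduct.assoc k H H X.V).symm ((coSwap (coac c) (lmul k H)).lTensor H
        (TensorProduct.assoc k H X.V H ((coac c v) ⊗ₜ[k] (1 : H)))) := by
    have h' := congrArg (fun t => t.f.hom (v ⊗ₜ[k] ((1 : H) ⊗ₜ[k] (1 : H))))
      (c.monoidal (reg k H) (reg k H))
    refine h'.trans ?_
    have e : (c.β (reg k H)).hom.f.hom = coSwap (coac c) (lmul k H) :=
      LinearMap.ext fun z => hb_apply c (reg k H) z
    change (TensorProduct.assoc k H H X.V).symm (((c.β (reg k H)).hom.f.hom).lTensor H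
        (TensorProduct.assoc k H X.V H (coac c v ⊗ₜ[k] (1 : H)))) = _
    rw [e]
  rw [hb_tmul c (reg k H ⊗ reg k H), coSwap_tmul] at h
  have h1 : (LMod.ρ (reg k H ⊗ reg k H)).toLinearMap.flip ((1 : H) ⊗ₜ[k] (1 : H)) =
      Coalgebra.comul (R := k) := by
    have h4 : ∀ t : H ⊗[k] H, actT (lmul k H) (lmul k H) t ((1 : H) ⊗ₜ[k] (1 : H)) = t := by
      intro t
      induction t with
      | zero => simp
      | add x y hx hy => rw [map_add, LinearMap.add_apply, hx, hy]
      | tmul x y => simp [actT_tmul]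
    exact LinearMap.ext fun x => h4 _
  have h2 : ∀ y : H ⊗[k] X.V, (coSwap (coac c) (lmul k H)).lTensor H
      (TensorProduct.assoc k H X.V H (y ⊗ₜ[k] (1 : H))) = (coac c).lTensor H y := by
    intro y
    induction y with
    | zero => simp
    | add x y hx hy => simp only [map_add, TensorProduct.add_tmul, hx, hy]
    | tmul a x =>
      change a ⊗ₜ coSwap (coac c) (lmul k H) (x ⊗ₜ (1 : H)) = a ⊗ₜ coac c x
      rw [coSwap_one]
  rw [h1, h2] at h
  rw [h, LinearEquiv.apply_symm_apply]

theorem coac_compat {X : LMod k H} (c : HalfBraiding X) (h : H) (v : X.V) :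
    tensorAct (lmul k H) X.ρ h (coac c v) =
      coSwap (coac c) (lmul k H) (tensorAct X.ρ (lmul k H) h (v ⊗ₜ 1)) :=
  (((c.β (reg k H)).hom.comm h (v ⊗ₜ[k] (1 : H))).symm).trans
    (hb_apply c (reg k H) (tensorAct X.ρ (lmul k H) h (v ⊗ₜ 1)))

/-- A colinear morphism is compatible with the half-braidings. -/
theorem hb_comm {X Y : LMod k H} (c : HalfBraiding X) (d : HalfBraiding Y) (f : X ⟶ Y)
    (hf : ∀ v, coac d (f.f.hom v) = f.f.hom.lTensor H (coac c v)) (U : LMod k H) :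
    f ▷ U ≫ (d.β U).hom = (c.β U).hom ≫ U ◁ f := by
  have key : ∀ (w : U.V) (t : H ⊗[k] X.V), (U.ρ.toLinearMap.flip w).rTensor Y.V
      (f.f.hom.lTensor H t) = f.f.hom.lTensor U.V ((U.ρ.toLinearMap.flip w).rTensor X.V t) := by
    intro w t
    induction t with
    | zero => simp
    | add x y hx hy => simp only [map_add, hx, hy]
    | tmul x y => rfl
  refine LMod.hom_ext (ModuleCat.hom_ext (TensorProduct.ext' fun v w => ?_))
  refine (hb_tmul d U (f.f.hom v) w).trans (Eq.trans ?_ (congrArg (f.f.hom.lTensor U.V)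
    (hb_tmul c U v w)).symm)
  rw [coSwap_tmul, coSwap_tmul, hf, key]

theorem coac_map {X Y : Center (LMod k H)} (f : X ⟶ Y) (v : X.1.V) :
    coac Y.2 (f.f.f.hom v) = f.f.f.hom.lTensor H (coac X.2 v) :=
  congrArg (fun t => t.f.hom (v ⊗ₜ[k] (1 : H))) (f.comm (reg k H))

variable (k H) in
/-- The Yetter-Drinfeld module defined by an object of the center. -/
def ofCenter : Center (LMod k H) ⥤ YD k H where
  obj X := ⟨X.1, coac X.2, coac_counit X.2, coac_coassoc X.2, coac_compat X.2⟩
  map f := ⟨f.f, coac_map f⟩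

instance : (ofCenter k H).Faithful where
  map_injective w := Center.ext _ _ (congrArg YD.Hom.f w)

instance : (ofCenter k H).Full where
  map_surjective {X Y} f := ⟨⟨f.f, hb_comm X.2 Y.2 f.f f.comm⟩, rfl⟩

/-- Isomorphisms of Yetter-Drinfeld modules with the same underlying module. -/
def YD.isoOfEq {X : LMod k H} {δ δ' : X.V →ₗ[k] H ⊗[k] X.V} (h : δ = δ') (p q r p' q' r') :
    YD.mk X δ p q r ≅ YD.mk X δ' p' q' r' where
  hom := ⟨𝟙 X, fun v => by
    change δ' v = LinearMap.id.lTensor H (δ v)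
    rw [h, LinearMap.lTensor_id]; rfl⟩
  inv := ⟨𝟙 X, fun v => by
    change δ v = LinearMap.id.lTensor H (δ' v)
    rw [h, LinearMap.lTensor_id]; rfl⟩
  hom_inv_id := YD.hom_ext (Category.id_comp _)
  inv_hom_id := YD.hom_ext (Category.id_comp _)

theorem hb_comm_of_eq {X : LMod k H} (c d : HalfBraiding X) (h : coac c = coac d) (U : LMod k H) :
    𝟙 X ▷ U ≫ (d.β U).hom = (c.β U).hom ≫ U ◁ 𝟙 X :=
  hb_comm c d (𝟙 X) (fun v => by
    change coac d v = LinearMap.id.lTensor H (coac c v)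
    rw [h, LinearMap.lTensor_id]; rfl) U

/-- An object of the center. -/
abbrev cmk {X : LMod k H} (c : HalfBraiding X) : Center (LMod k H) := ⟨X, c⟩

/-- Isomorphisms in the center with the same underlying object. -/
def centerIsoOfEq {X : LMod k H} (c d : HalfBraiding X) (h : coac c = coac d) :
    cmk c ≅ cmk d where
  hom := ⟨𝟙 X, hb_comm_of_eq c d h⟩
  inv := ⟨𝟙 X, hb_comm_of_eq d c h.symm⟩
  hom_inv_id := Center.ext _ _ (Category.id_comp _)
  inv_hom_id := Center.ext _ _ (Category.id_comp _)

end Coac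

section ToCenter

variable {k H : Type u} [CommRing k] [Ring H] [HopfAlgebra k H] [BijectiveAntipode k H]

/-- The half-braiding `v ⊗ w ↦ v₍₋₁₎ w ⊗ v₍₀₎` of a Yetter-Drinfeld module. -/
def ydHB (P : YD k H) : HalfBraiding P.X where
  β U := LMod.isoMk
    { hom := ModuleCat.ofHom (coSwap P.δ U.ρ)
      inv := ModuleCat.ofHom (coSwapInv P.δ (antipodeInv k H) U.ρ)
      hom_inv_id := ModuleCat.hom_ext (LinearMap.ext
        (coSwapInv_coSwap P.δ (antipodeInv k H) P.counit P.coassoc antipodeInv_rTensor U.ρ))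
      inv_hom_id := ModuleCat.hom_ext (LinearMap.ext
        (coSwap_coSwapInv P.δ (antipodeInv k H) P.counit P.coassoc antipodeInv_lTensor U.ρ)) }
    (coSwap_linear P.δ P.X.ρ P.compat U.ρ)
  monoidal U U' := LMod.hom_ext (ModuleCat.hom_ext (TensorProduct.ext (LinearMap.ext fun v =>
    TensorProduct.ext' fun w w' => coSwap_tensor P.δ P.coassoc U.ρ U'.ρ v w w')))
  naturality {U U'} f := LMod.hom_ext (ModuleCat.hom_ext (LinearMap.ext
    (coSwap_nat P.δ U.ρ U'.ρ f.f.hom f.comm)))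

theorem coac_ydHB (P : YD k H) : coac (ydHB P) = P.δ :=
  LinearMap.ext fun v => coSwap_one P.δ v

variable (k H) in
/-- The object of the center defined by a Yetter-Drinfeld module. -/
def toCenter : YD k H ⥤ Center (LMod k H) where
  obj P := ⟨P.X, ydHB P⟩
  map {P Q} f := ⟨f.f, hb_comm (ydHB P) (ydHB Q) f.f fun v => by
    rw [coac_ydHB, coac_ydHB]; exact f.comm v⟩

instance : (toCenter k H).Faithful where
  map_injective w := YD.hom_ext (congrArg Center.Hom.f w)

theorem toCenter_comm {P Q : YD k H} (f : (toCenter k H).obj P ⟶ (toCenter k H).obj Q) (v : P.X.V) :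
    Q.δ (f.f.f.hom v) = f.f.f.hom.lTensor H (P.δ v) := by
  have h := coac_map f v
  change coac (ydHB Q) _ = f.f.f.hom.lTensor H (coac (ydHB P) v) at h
  rw [coac_ydHB, coac_ydHB] at h; exact h

instance : (toCenter k H).Full where
  map_surjective f := ⟨⟨f.f, toCenter_comm f⟩, rfl⟩

variable (k H) in
/-- The unit of the equivalence. -/
def centerUnit : 𝟭 (YD k H) ≅ toCenter k H ⋙ ofCenter k H :=
  NatIso.ofComponents (fun P => YD.isoOfEq (coac_ydHB P).symm _ _ _ _ _ _)
    (fun f => YD.hom_ext ((Category.comp_id f.f).trans (Category.id_comp f.f).symm))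

variable (k H) in
/-- The counit of the equivalence. -/
def centerCounit : ofCenter k H ⋙ toCenter k H ≅ 𝟭 (Center (LMod k H)) :=
  NatIso.ofComponents (fun X => centerIsoOfEq _ X.2 (coac_ydHB ((ofCenter k H).obj X)))
    (fun f => Center.ext _ _ ((Category.comp_id f.f).trans (Category.id_comp f.f).symm))

variable (k H) in
/-- The category of Yetter-Drinfeld modules is equivalent to the center. -/
def centerEquiv : YD k H ≌ Center (LMod k H) where
  functor := toCenter k H
  inverse := ofCenter k H
  unitIso := centerUnit k H
  counitIso := centerCounit k H
  functor_unitIso_comp P := Center.ext _ _ (Category.id_comp (𝟙 P.X))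

end ToCenter

/-! ### The braided monoidal category of Yetter-Drinfeld modules -/

section Codiag

variable {k H V W V' W' : Type*} [CommRing k] [Ring H] [Algebra k H]
  [AddCommGroup V] [Module k V] [AddCommGroup W] [Module k W]
  [AddCommGroup V'] [Module k V'] [AddCommGroup W'] [Module k W']

/-- The codiagonal coaction `v ⊗ w ↦ v₍₋₁₎ w₍₋₁₎ ⊗ (v₍₀₎ ⊗ w₍₀₎)`. -/
def codiag (δ : V →ₗ[k] H ⊗[k] V) (δ' : W →ₗ[k] H ⊗[k] W) : V ⊗[k] W →ₗ[k] H ⊗[k] (V ⊗[k] W) :=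
  (LinearMap.mul' k H).rTensor (V ⊗[k] W) ∘ₗ
    (TensorProduct.tensorTensorTensorComm k H V H W).toLinearMap ∘ₗ TensorProduct.map δ δ'

theorem codiag_tmul (δ : V →ₗ[k] H ⊗[k] V) (δ' : W →ₗ[k] H ⊗[k] W) (v : V) (w : W) :
    codiag δ δ' (v ⊗ₜ w) = (LinearMap.mul' k H).rTensor (V ⊗[k] W)
      (TensorProduct.tensorTensorTensorComm k H V H W (δ v ⊗ₜ δ' w)) := rfl

theorem codiag_map (δ : V →ₗ[k] H ⊗[k] V) (δ' : W →ₗ[k] H ⊗[k] W) (γ : V' →ₗ[k] H ⊗[k] V')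
    (γ' : W' →ₗ[k] H ⊗[k] W') (f : V →ₗ[k] V') (g : W →ₗ[k] W')
    (hf : ∀ v, γ (f v) = f.lTensor H (δ v)) (hg : ∀ w, γ' (g w) = g.lTensor H (δ' w))
    (z : V ⊗[k] W) : codiag γ γ' (TensorProduct.map f g z) =
      (TensorProduct.map f g).lTensor H (codiag δ δ' z) := by
  have key : ∀ (s : H ⊗[k] V) (t : H ⊗[k] W), (LinearMap.mul' k H).rTensor (V' ⊗[k] W')
      (TensorProduct.tensorTensorTensorComm k H V' H W' (f.lTensor H s ⊗ₜ g.lTensor H t)) =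
      (TensorProduct.map f g).lTensor H ((LinearMap.mul' k H).rTensor (V ⊗[k] W)
        (TensorProduct.tensorTensorTensorComm k H V H W (s ⊗ₜ t))) := by
    intro s t
    induction s with
    | zero => simp
    | add x y hx hy => simp only [map_add, TensorProduct.add_tmul, hx, hy]
    | tmul a x =>
      induction t with
      | zero => simp
      | add x y hx hy => simp only [map_add, TensorProduct.tmul_add, hx, hy]
      | tmul b y => rfl
  induction z with
  | zero => simp
  | add x y hx hy => simp only [map_add, hx, hy]
  | tmul v w => rw [TensorProduct.map_tmul, codiag_tmul, codiag_tmul, hf, hg, key]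

end Codiag

section Bialg

variable {k H : Type u} [CommRing k] [Ring H] [Bialgebra k H]

theorem codiag_coSwap {V W : Type*} [AddCommGroup V] [Module k V] [AddCommGroup W] [Module k W]
    (δ : V →ₗ[k] H ⊗[k] V) (v : V) (t : H ⊗[k] W) :
    TensorProduct.assoc k H V W ((coSwap δ (lmul k H)).rTensor W
      ((TensorProduct.assoc k V H W).symm (v ⊗ₜ t))) =
    (LinearMap.mul' k H).rTensor (V ⊗[k] W)
      (TensorProduct.tensorTensorTensorComm k H V H W (δ v ⊗ₜ t)) := by
  induction t with
  | zero => simp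
  | add x y hx hy => simp only [map_add, TensorProduct.tmul_add, hx, hy]
  | tmul a x =>
    change TensorProduct.assoc k H V W (((lmul k H).toLinearMap.flip a).rTensor V (δ v) ⊗ₜ x) = _
    induction δ v with
    | zero => simp
    | add x y hx hy => simp only [map_add, TensorProduct.add_tmul, hx, hy]
    | tmul b y => rfl

theorem coac_tensorHB {X Y : LMod k H} (c : HalfBraiding X) (d : HalfBraiding Y) :
    coac (CenterFunctor.tensorHB c d) = codiag (coac c) (coac d) :=
  TensorProduct.ext' fun v w => by
    rw [codiag_tmul, ← codiag_coSwap]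
    have e : (c.β (reg k H)).hom.f.hom = coSwap (coac c) (lmul k H) :=
      LinearMap.ext fun z => hb_apply c (reg k H) z
    rw [← e]
    rfl

variable (k H) in
/-- The half-braiding on the unit. -/
abbrev uHB : HalfBraiding (𝟙_ (LMod k H)) := CenterFunctor.unitHB

theorem coac_unitHB : coac (uHB k H) = (TensorProduct.mk k H k 1 : k →ₗ[k] H ⊗[k] k) :=
  LinearMap.ext fun x => by
    change (TensorProduct.rid k H).symm (TensorProduct.lid k H ((x : k) ⊗ₜ[k] (1 : H))) =
      (1 : H) ⊗ₜ[k] (x : k)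
    rw [TensorProduct.lid_tmul, TensorProduct.rid_symm_apply, TensorProduct.smul_tmul, smul_eq_mul,
      mul_one]

/-- An isomorphism of Yetter-Drinfeld modules from a colinear isomorphism of modules. -/
def YD.isoMk {P Q : YD k H} (e : P.X ≅ Q.X)
    (h : ∀ v, Q.δ (e.hom.f.hom v) = e.hom.f.hom.lTensor H (P.δ v)) : P ≅ Q where
  hom := ⟨e.hom, h⟩
  inv := ⟨e.inv, fun v => by
    have h₁ : e.hom.f.hom (e.inv.f.hom v) = v := congrArg (fun t => t.f.hom v) e.inv_hom_id
    have h₂ : e.inv.f.hom ∘ₗ e.hom.f.hom = LinearMap.id :=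
      congrArg (fun t => t.f.hom) e.hom_inv_id
    have h₃ := congrArg (e.inv.f.hom.lTensor H) (h (e.inv.f.hom v))
    rw [h₁] at h₃
    refine Eq.trans ?_ h₃.symm
    rw [← LinearMap.lTensor_comp_apply, h₂, LinearMap.lTensor_id]
    rfl⟩
  hom_inv_id := YD.hom_ext e.hom_inv_id
  inv_hom_id := YD.hom_ext e.inv_hom_id

end Bialg

namespace YD

variable {k H : Type u} [CommRing k] [Ring H] [HopfAlgebra k H] [BijectiveAntipode k H]

theorem coac_tensor (P Q : YD k H) : coac (CenterFunctor.tensorHB (ydHB P) (ydHB Q)) =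
    codiag P.δ Q.δ := by
  rw [coac_tensorHB, coac_ydHB, coac_ydHB]

/-- The tensor product, with the diagonal action and the codiagonal coaction. -/
abbrev tensorObj (P Q : YD k H) : YD k H where
  X := P.X ⊗ Q.X
  δ := codiag P.δ Q.δ
  counit := by
    rw [← coac_tensor]; exact coac_counit _
  coassoc := by
    rw [← coac_tensor]; exact coac_coassoc _
  compat := by
    rw [← coac_tensor]; exact coac_compat _

variable (k H) in
/-- The unit, with the trivial action and the trivial coaction. -/
abbrev unit : YD k H where
  X := 𝟙_ (LMod k H)
  δ := (TensorProduct.mk k H k 1 : k →ₗ[k] H ⊗[k] k)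
  counit := by
    rw [← coac_unitHB]; exact coac_counit (uHB k H)
  coassoc := by
    rw [← coac_unitHB]; exact coac_coassoc (uHB k H)
  compat := by
    rw [← coac_unitHB]; exact coac_compat (uHB k H)

/-- The object of the center defined by a tensor product. -/
def tensorIso (P Q : YD k H) : (toCenter k H).obj P ⊗ (toCenter k H).obj Q ≅
    (toCenter k H).obj (tensorObj P Q) :=
  centerIsoOfEq (CenterFunctor.tensorHB (ydHB P) (ydHB Q)) (ydHB (tensorObj P Q))
    ((coac_tensor P Q).trans (coac_ydHB (tensorObj P Q)).symm)

variable (k H) in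
/-- The object of the center defined by the unit. -/
def unitIso : 𝟙_ (Center (LMod k H)) ≅ (toCenter k H).obj (unit k H) :=
  centerIsoOfEq (uHB k H) (ydHB (unit k H))
    (coac_unitHB.trans (coac_ydHB (unit k H)).symm)

instance : MonoidalCategoryStruct (YD k H) where
  tensorObj := tensorObj
  whiskerLeft P {Q R} f := ⟨P.X ◁ f.f, codiag_map P.δ Q.δ P.δ R.δ LinearMap.id f.f.f.hom
    (fun v => by rw [LinearMap.lTensor_id]; rfl) f.comm⟩
  whiskerRight {Q R} f P := ⟨f.f ▷ P.X, codiag_map Q.δ P.δ R.δ P.δ f.f.f.hom LinearMap.id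
    f.comm (fun v => by rw [LinearMap.lTensor_id]; rfl)⟩
  tensorHom {P Q R S} f g := ⟨f.f ⊗ₘ g.f, codiag_map P.δ R.δ Q.δ S.δ f.f.f.hom g.f.f.hom
    f.comm g.comm⟩
  tensorUnit := unit k H
  associator P Q R := YD.isoMk (α_ P.X Q.X R.X) (by
    let φ : (toCenter k H).obj (tensorObj (tensorObj P Q) R) ⟶
      (toCenter k H).obj (tensorObj P (tensorObj Q R)) :=
      (tensorIso (tensorObj P Q) R).inv ≫ (tensorIso P Q).inv ▷ _ ≫ (α_ _ _ _).hom ≫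
        _ ◁ (tensorIso Q R).hom ≫ (tensorIso P (tensorObj Q R)).hom
    have e : φ.f = (α_ P.X Q.X R.X).hom := by
      change 𝟙 ((P.X ⊗ Q.X) ⊗ R.X) ≫ 𝟙 (P.X ⊗ Q.X) ▷ R.X ≫ (α_ P.X Q.X R.X).hom ≫
        P.X ◁ 𝟙 (Q.X ⊗ R.X) ≫ 𝟙 (P.X ⊗ Q.X ⊗ R.X) = (α_ P.X Q.X R.X).hom
      simp
    rw [← e]
    exact toCenter_comm φ)
  leftUnitor P := YD.isoMk (λ_ P.X) (by
    let φ : (toCenter k H).obj (tensorObj (unit k H) P) ⟶ (toCenter k H).obj P :=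
      (tensorIso (unit k H) P).inv ≫ (unitIso k H).inv ▷ _ ≫ (λ_ _).hom
    have e : φ.f = (λ_ P.X).hom := by
      change 𝟙 (𝟙_ (LMod k H) ⊗ P.X) ≫ 𝟙 (𝟙_ (LMod k H)) ▷ P.X ≫ (λ_ P.X).hom = (λ_ P.X).hom
      simp
    rw [← e]
    exact toCenter_comm φ)
  rightUnitor P := YD.isoMk (ρ_ P.X) (by
    let φ : (toCenter k H).obj (tensorObj P (unit k H)) ⟶ (toCenter k H).obj P :=
      (tensorIso P (unit k H)).inv ≫ _ ◁ (unitIso k H).inv ≫ (ρ_ _).hom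
    have e : φ.f = (ρ_ P.X).hom := by
      change 𝟙 (P.X ⊗ 𝟙_ (LMod k H)) ≫ P.X ◁ 𝟙 (𝟙_ (LMod k H)) ≫ (ρ_ P.X).hom = (ρ_ P.X).hom
      simp
    rw [← e]
    exact toCenter_comm φ)

@[simp] theorem tensor_X (P Q : YD k H) : (P ⊗ Q).X = P.X ⊗ Q.X := rfl
theorem tensor_δ (P Q : YD k H) : (P ⊗ Q).δ = codiag P.δ Q.δ := rfl

variable (k H) in
/-- The functor to the center preserves tensor products. -/
def inducingData : Monoidal.InducingFunctorData (toCenter k H) where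
  μIso := tensorIso
  εIso := unitIso k H
  whiskerLeft_eq P _ _ f := Center.ext _ _ (strict_aux₁ (P.X ◁ f.f))
  whiskerRight_eq f P := Center.ext _ _ (strict_aux₁ (f.f ▷ P.X))
  tensorHom_eq f g := Center.ext _ _ (strict_aux₁ (f.f ⊗ₘ g.f))
  associator_eq P Q R := Center.ext _ _ (strict_aux₂ P.X Q.X R.X)
  leftUnitor_eq P := Center.ext _ _ (strict_aux₃ P.X)
  rightUnitor_eq P := Center.ext _ _ (strict_aux₄ P.X)

instance : MonoidalCategory (YD k H) := Monoidal.induced (toCenter k H) (inducingData k H)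

instance : (toCenter k H).Monoidal := Monoidal.fromInducedMonoidal (toCenter k H) (inducingData k H)

end YD

namespace YD

variable {k H : Type u} [CommRing k] [Ring H] [HopfAlgebra k H] [BijectiveAntipode k H]

/-- The braiding `v ⊗ w ↦ v₍₋₁₎ w ⊗ v₍₀₎`. -/
def braiding (P Q : YD k H) : P ⊗ Q ≅ Q ⊗ P :=
  YD.isoMk ((ydHB P).β Q.X) (by
    let φ : (toCenter k H).obj (P ⊗ Q) ⟶ (toCenter k H).obj (Q ⊗ P) :=
      (tensorIso P Q).inv ≫ (β_ _ _).hom ≫ (tensorIso Q P).hom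
    have e : φ.f = ((ydHB P).β Q.X).hom := by
      change 𝟙 (P.X ⊗ Q.X) ≫ ((ydHB P).β Q.X).hom ≫ 𝟙 (Q.X ⊗ P.X) = ((ydHB P).β Q.X).hom
      simp
    rw [← e]
    exact toCenter_comm φ)

theorem toCenter_μ (P Q : YD k H) : (Functor.LaxMonoidal.μ (toCenter k H) P Q).f =
    𝟙 (P.X ⊗ Q.X) := rfl

theorem toCenter_braided (P Q : YD k H) : Functor.LaxMonoidal.μ (toCenter k H) P Q ≫
    (toCenter k H).map (braiding P Q).hom = (β_ _ _).hom ≫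
      Functor.LaxMonoidal.μ (toCenter k H) Q P :=
  Center.ext _ _ ((Category.id_comp ((ydHB P).β Q.X).hom).trans
    (Category.comp_id ((ydHB P).β Q.X).hom).symm)

instance : BraidedCategory (YD k H) := .ofFaithful (toCenter k H) braiding toCenter_braided

instance : (toCenter k H).Braided where
  braided P Q := toCenter_braided P Q

theorem braiding_apply (P Q : YD k H) (z : P.X.V ⊗[k] Q.X.V) :
    (β_ P Q).hom.f.f.hom z = coSwap P.δ Q.X.ρ z := rfl

/-- The functor from the center strictly preserves tensor products. -/
def ofCenterCore : (ofCenter k H).CoreMonoidal where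
  εIso := isoOfEq coac_unitHB.symm _ _ _ _ _ _
  μIso X Y := isoOfEq (coac_tensorHB X.2 Y.2).symm _ _ _ _ _ _
  μIso_hom_natural_left {X Y} f Z :=
    YD.hom_ext ((Category.comp_id (f.f ▷ Z.1)).trans (Category.id_comp (f.f ▷ Z.1)).symm)
  μIso_hom_natural_right {X Y} Z f :=
    YD.hom_ext ((Category.comp_id (Z.1 ◁ f.f)).trans (Category.id_comp (Z.1 ◁ f.f)).symm)
  associativity X Y Z := YD.hom_ext (by
    change 𝟙 (X.1 ⊗ Y.1) ▷ Z.1 ≫ 𝟙 _ ≫ (α_ X.1 Y.1 Z.1).hom = (α_ X.1 Y.1 Z.1).hom ≫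
      X.1 ◁ 𝟙 (Y.1 ⊗ Z.1) ≫ 𝟙 _
    simp)
  left_unitality X := YD.hom_ext (by
    change (λ_ X.1).hom = 𝟙 (𝟙_ (LMod k H)) ▷ X.1 ≫ 𝟙 _ ≫ (λ_ X.1).hom
    simp)
  right_unitality X := YD.hom_ext (by
    change (ρ_ X.1).hom = X.1 ◁ 𝟙 (𝟙_ (LMod k H)) ≫ 𝟙 _ ≫ (ρ_ X.1).hom
    simp)

instance : (ofCenter k H).Monoidal := ofCenterCore.toMonoidal

instance : (ofCenter k H).Braided where
  braided X Y := YD.hom_ext (by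
    change 𝟙 (X.1 ⊗ Y.1) ≫ (X.2.β Y.1).hom = ((ydHB ((ofCenter k H).obj X)).β Y.1).hom ≫ 𝟙 _
    rw [Category.id_comp, Category.comp_id]
    exact LMod.hom_ext (ModuleCat.hom_ext (LinearMap.ext fun z => hb_apply X.2 Y.1 z)))

/-- The forgetful functor strictly preserves tensor products. -/
def forgetCore : (forgetCo k H).CoreMonoidal where
  εIso := Iso.refl (𝟙_ (LMod k H))
  μIso P Q := Iso.refl (P.X ⊗ Q.X)
  μIso_hom_natural_left {P Q} f R :=
    (Category.comp_id (f.f ▷ R.X)).trans (Category.id_comp (f.f ▷ R.X)).symm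
  μIso_hom_natural_right {P Q} R f :=
    (Category.comp_id (R.X ◁ f.f)).trans (Category.id_comp (R.X ◁ f.f)).symm
  associativity P Q R := by
    change 𝟙 (P.X ⊗ Q.X) ▷ R.X ≫ 𝟙 _ ≫ (α_ P.X Q.X R.X).hom = (α_ P.X Q.X R.X).hom ≫
      P.X ◁ 𝟙 (Q.X ⊗ R.X) ≫ 𝟙 _
    simp
  left_unitality P := by
    change (λ_ P.X).hom = 𝟙 (𝟙_ (LMod k H)) ▷ P.X ≫ 𝟙 _ ≫ (λ_ P.X).hom
    simp
  right_unitality P := by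
    change (ρ_ P.X).hom = P.X ◁ 𝟙 (𝟙_ (LMod k H)) ≫ 𝟙 _ ≫ (ρ_ P.X).hom
    simp

instance : (forgetCo k H).Monoidal := forgetCore.toMonoidal

end YD

namespace YD

section RawNat

variable {k H V V' W : Type*} [CommRing k] [Ring H] [Bialgebra k H]
  [AddCommGroup V] [Module k V] [AddCommGroup V'] [Module k V'] [AddCommGroup W] [Module k W]

theorem counit_nat (f : V →ₗ[k] V') (y : H ⊗[k] V) :
    TensorProduct.lid k V' ((Coalgebra.counit (R := k)).rTensor V' (f.lTensor H y)) =
      f (TensorProduct.lid k V ((Coalgebra.counit (R := k)).rTensor V y)) := by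
  induction y with
  | zero => simp
  | add a b ha hb => simp only [map_add, ha, hb]
  | tmul a b => simp

theorem comul_nat (f : V →ₗ[k] V') (y : H ⊗[k] V) :
    TensorProduct.assoc k H H V' ((Coalgebra.comul (R := k)).rTensor V' (f.lTensor H y)) =
      (f.lTensor H).lTensor H (TensorProduct.assoc k H H V
        ((Coalgebra.comul (R := k)).rTensor V y)) := by
  have key : ∀ (t : H ⊗[k] H) (b : V), TensorProduct.assoc k H H V' (t ⊗ₜ f b) =
      (f.lTensor H).lTensor H (TensorProduct.assoc k H H V (t ⊗ₜ b)) := by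
    intro t b
    induction t with
    | zero => simp
    | add a b ha hb => simp only [map_add, TensorProduct.add_tmul, ha, hb]
    | tmul a b => rfl
  induction y with
  | zero => simp
  | add a b ha hb => simp only [map_add, ha, hb]
  | tmul a b => exact key _ b

theorem coSwap_nat_left (δ : V →ₗ[k] H ⊗[k] V) (δ' : V' →ₗ[k] H ⊗[k] V') (f : V →ₗ[k] V')
    (hf : ∀ v, δ' (f v) = f.lTensor H (δ v)) (b : H →ₐ[k] Module.End k W) (y : V ⊗[k] W) :
    coSwap δ' b (f.rTensor W y) = f.lTensor W (coSwap δ b y) := by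
  have key : ∀ (w : W) (s : H ⊗[k] V), (b.toLinearMap.flip w).rTensor V' (f.lTensor H s) =
      f.lTensor W ((b.toLinearMap.flip w).rTensor V s) := by
    intro w s
    induction s with
    | zero => simp
    | add a b ha hb => simp only [map_add, ha, hb]
    | tmul a b => rfl
  induction y with
  | zero => simp
  | add a b ha hb => simp only [map_add, ha, hb]
  | tmul v w => rw [LinearMap.rTensor_tmul, coSwap_tmul, coSwap_tmul, hf, key]

end RawNat

section Colimits

variable {k H : Type u} [CommRing k] [Ring H] [Bialgebra k H]
variable {J : Type} [SmallCategory J] (F : J ⥤ YD k H)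
  (c : Cocone (F ⋙ forgetCo k H)) (t : IsColimit c)

/-- The underlying colimit of `k`-modules. -/
def colimV : IsColimit ((LMod.forgetV k H).mapCocone c) := isColimitOfPreserves _ t

/-- The cocone defining the coaction on a colimit. -/
def coactCocone : Cocone ((F ⋙ forgetCo k H) ⋙ LMod.forgetV k H) where
  pt := ModuleCat.of k (H ⊗[k] c.pt.V)
  ι :=
    { app := fun j => ModuleCat.ofHom ((c.ι.app j).f.hom.lTensor H ∘ₗ (F.obj j).δ)
      naturality := fun i j f => ModuleCat.hom_ext (LinearMap.ext fun x => by
        have e : (c.ι.app j).f.hom ∘ₗ (F.map f).f.f.hom = (c.ι.app i).f.hom :=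
          congrArg (fun g => g.f.hom) (c.w f)
        have h : (F.obj j).δ ((F.map f).f.f.hom x) = (F.map f).f.f.hom.lTensor H ((F.obj i).δ x) :=
          (F.map f).comm x
        refine (congrArg ((c.ι.app j).f.hom.lTensor H) h).trans ?_
        exact (LinearMap.lTensor_comp_apply H _ _ _).symm.trans
          (congrArg (fun g => LinearMap.lTensor H g ((F.obj i).δ x)) e)) }

/-- The coaction on a colimit. -/
def colimCoact : c.pt.V →ₗ[k] H ⊗[k] c.pt.V :=
  ((colimV F c t).desc (coactCocone F c)).hom

theorem colimCoact_apply (j : J) (x : (F.obj j).X.V) :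
    colimCoact F c t ((c.ι.app j).f.hom x) = (c.ι.app j).f.hom.lTensor H ((F.obj j).δ x) :=
  congrArg (fun f : ((F ⋙ forgetCo k H) ⋙ LMod.forgetV k H).obj j ⟶ (coactCocone F c).pt =>
    f.hom x) ((colimV F c t).fac (coactCocone F c) j)

theorem colim_ext (t : IsColimit c) {W : Type u} [AddCommGroup W] [Module k W]
    {f g : c.pt.V →ₗ[k] W}
    (w : ∀ (j : J) (x : (F.obj j).X.V), f ((c.ι.app j).f.hom x) = g ((c.ι.app j).f.hom x)) :
    f = g :=
  congrArg ModuleCat.Hom.hom (show ModuleCat.ofHom f = ModuleCat.ofHom g from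
    (colimV F c t).hom_ext fun j => by ext x; exact w j x)

/-- The Yetter-Drinfeld module structure on a colimit. -/
abbrev colimPt : YD k H where
  X := c.pt
  δ := colimCoact F c t
  counit := LinearMap.congr_fun (f := (TensorProduct.lid k c.pt.V).toLinearMap ∘ₗ
      (Coalgebra.counit (R := k)).rTensor c.pt.V ∘ₗ colimCoact F c t) (g := LinearMap.id)
    (colim_ext F c t fun j x => by
      change TensorProduct.lid k c.pt.V ((Coalgebra.counit (R := k)).rTensor c.pt.V
        (colimCoact F c t ((c.ι.app j).f.hom x))) = (c.ι.app j).f.hom x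
      rw [colimCoact_apply]
      exact (counit_nat (c.ι.app j).f.hom ((F.obj j).δ x)).trans
        (congrArg (c.ι.app j).f.hom ((F.obj j).counit x)))
  coassoc := LinearMap.congr_fun (f := (colimCoact F c t).lTensor H ∘ₗ colimCoact F c t)
      (g := (TensorProduct.assoc k H H c.pt.V).toLinearMap ∘ₗ
        (Coalgebra.comul (R := k)).rTensor c.pt.V ∘ₗ colimCoact F c t)
    (colim_ext F c t fun j x => by
      have e : colimCoact F c t ∘ₗ (c.ι.app j).f.hom =
          (c.ι.app j).f.hom.lTensor H ∘ₗ (F.obj j).δ :=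
        LinearMap.ext (colimCoact_apply F c t j)
      have h₁ := comul_nat (c.ι.app j).f.hom ((F.obj j).δ x)
      have h₂ := congrArg (((c.ι.app j).f.hom.lTensor H).lTensor H) ((F.obj j).coassoc x)
      have h₃ : (colimCoact F c t).lTensor H ((c.ι.app j).f.hom.lTensor H ((F.obj j).δ x)) =
          ((c.ι.app j).f.hom.lTensor H).lTensor H ((F.obj j).δ.lTensor H ((F.obj j).δ x)) :=
        (LinearMap.lTensor_comp_apply H _ _ _).symm.trans ((congrArg
          (fun g => LinearMap.lTensor H g ((F.obj j).δ x)) e).trans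
            (LinearMap.lTensor_comp_apply H _ _ _))
      change (colimCoact F c t).lTensor H (colimCoact F c t ((c.ι.app j).f.hom x)) =
        TensorProduct.assoc k H H c.pt.V ((Coalgebra.comul (R := k)).rTensor c.pt.V
          (colimCoact F c t ((c.ι.app j).f.hom x)))
      rw [colimCoact_apply]
      exact h₃.trans (h₂.trans h₁.symm))
  compat h := LinearMap.congr_fun (f := tensorAct (lmul k H) c.pt.ρ h ∘ₗ colimCoact F c t)
      (g := coSwap (colimCoact F c t) (lmul k H) ∘ₗ tensorAct c.pt.ρ (lmul k H) h ∘ₗ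
        (TensorProduct.mk k c.pt.V H).flip 1)
    (colim_ext F c t fun j x => by
      have h₁ := actT_map (lmul k H) (F.obj j).X.ρ (lmul k H) c.pt.ρ LinearMap.id
          (c.ι.app j).f.hom (fun _ _ => rfl) (c.ι.app j).comm (Coalgebra.comul (R := k) h)
          ((F.obj j).δ x)
      have h₂ := actT_map (F.obj j).X.ρ (lmul k H) c.pt.ρ (lmul k H) (c.ι.app j).f.hom
          LinearMap.id (c.ι.app j).comm (fun _ _ => rfl) (Coalgebra.comul (R := k) h)
          (x ⊗ₜ[k] (1 : H))
      have h₃ := coSwap_nat_left (F.obj j).δ (colimCoact F c t) (c.ι.app j).f.hom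
          (colimCoact_apply F c t j) (lmul k H)
          (tensorAct (F.obj j).X.ρ (lmul k H) h (x ⊗ₜ[k] (1 : H)))
      have h₄ := congrArg ((c.ι.app j).f.hom.lTensor H) ((F.obj j).compat h x)
      change tensorAct (lmul k H) c.pt.ρ h (colimCoact F c t ((c.ι.app j).f.hom x)) =
        coSwap (colimCoact F c t) (lmul k H) (tensorAct c.pt.ρ (lmul k H) h
          ((c.ι.app j).f.hom.rTensor H (x ⊗ₜ 1)))
      rw [colimCoact_apply]
      exact h₁.symm.trans (h₄.trans (h₃.symm.trans
        (congrArg (coSwap (colimCoact F c t) (lmul k H)) h₂))))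

/-- The colimit cocone. -/
def colimCocone : Cocone F where
  pt := colimPt F c t
  ι := { app := fun j => ⟨c.ι.app j, colimCoact_apply F c t j⟩
         naturality := fun _ _ f => YD.hom_ext (c.ι.naturality f) }

/-- The colimit cocone is a colimit. -/
def colimIsColimit : IsColimit (colimCocone F c t) where
  desc s := ⟨t.desc ((forgetCo k H).mapCocone s), LinearMap.congr_fun
      (f := s.pt.δ ∘ₗ (t.desc ((forgetCo k H).mapCocone s)).f.hom)
      (g := (t.desc ((forgetCo k H).mapCocone s)).f.hom.lTensor H ∘ₗ colimCoact F c t)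
    (colim_ext F c t fun j x => by
      have e : (t.desc ((forgetCo k H).mapCocone s)).f.hom ∘ₗ (c.ι.app j).f.hom =
          (s.ι.app j).f.f.hom :=
        congrArg (fun f => f.f.hom) (t.fac ((forgetCo k H).mapCocone s) j)
      change s.pt.δ ((t.desc ((forgetCo k H).mapCocone s)).f.hom ((c.ι.app j).f.hom x)) =
        (t.desc ((forgetCo k H).mapCocone s)).f.hom.lTensor H
          (colimCoact F c t ((c.ι.app j).f.hom x))
      rw [colimCoact_apply]
      have h₁ : (t.desc ((forgetCo k H).mapCocone s)).f.hom.lTensor H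
          ((c.ι.app j).f.hom.lTensor H ((F.obj j).δ x)) =
          (s.ι.app j).f.f.hom.lTensor H ((F.obj j).δ x) :=
        (LinearMap.lTensor_comp_apply H _ _ _).symm.trans (congrArg
          (fun g => LinearMap.lTensor H g ((F.obj j).δ x)) e)
      exact (congrArg s.pt.δ (LinearMap.congr_fun e x)).trans
        (((s.ι.app j).comm x).trans h₁.symm))⟩
  fac s j := YD.hom_ext (t.fac ((forgetCo k H).mapCocone s) j)
  uniq s m w := YD.hom_ext (t.uniq ((forgetCo k H).mapCocone s) m.f fun j =>
    congrArg Hom.f (w j))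

instance : (forgetCo k H).ReflectsIsomorphisms where
  reflects {P Q} f hf := by
    have : IsIso f.f := hf
    have e : f = (YD.isoMk (asIso f.f) f.comm).hom := rfl
    rw [e]; infer_instance

instance : CreatesColimitsOfSize.{0, 0} (forgetCo k H) where
  CreatesColimitsOfShape :=
    { CreatesColimit := fun {F} => createsColimitOfReflectsIso fun c t =>
        { liftedCocone := colimCocone F c t
          validLift := Cocone.ext (Iso.refl _) (fun _ => Category.comp_id _)
          makesColimit := colimIsColimit F c t } }

instance : HasColimitsOfSize.{0, 0} (YD k H) :=
  hasColimits_of_hasColimits_createsColimits (forgetCo k H)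

end Colimits

section

variable {k H : Type u} [CommRing k] [Ring H] [HopfAlgebra k H] [BijectiveAntipode k H]

instance (X : YD k H) : PreservesColimitsOfSize.{0, 0} (tensorLeft X) :=
  preserves_tensorLeft_of (forgetCo k H) X

instance (X : YD k H) : PreservesColimitsOfSize.{0, 0} (tensorRight X) :=
  preserves_tensorRight_of (forgetCo k H) X

end

end YD

/-! ### Free modules -/

section FreeModules

variable {C : Type u₁} [Category.{v₁} C] [MonoidalCategory C] (M : CommMon (Center C))

/-- The action on the free right module `X ⊗ M`. -/
def freeAct (X : C) : (X ⊗ (mon M).X) ⊗ (mon M).X ⟶ X ⊗ (mon M).X :=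
  (α_ X (mon M).X (mon M).X).hom ≫ X ◁ mulM M

theorem freeAct_nat {X Y : C} (f : X ⟶ Y ⊗ (mon M).X) :
    freeAct M X ≫ f ▷ (mon M).X = f ▷ (mon M).X ▷ (mon M).X ≫ freeAct M (Y ⊗ (mon M).X) :=
  ((freeMonad M).μ.naturality f).symm

theorem freeAct_assoc (X : C) : freeAct M X ▷ (mon M).X ≫ freeAct M X =
    freeAct M (X ⊗ (mon M).X) ≫ freeAct M X := (freeMonad M).assoc X

/-- The free right module `X ⊗ M`. -/
abbrev freeMod (X : C) : RMod M where
  X := X ⊗ (mon M).X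
  act := freeAct M X
  act_one := by
    have h : ((ρ_ (X ⊗ (mon M).X)).inv ≫ (X ⊗ (mon M).X) ◁ oneM M) ≫ freeAct M X =
      𝟙 (X ⊗ (mon M).X) := (freeMonad M).left_unit X
    rw [Category.assoc] at h
    exact ((Iso.inv_comp_eq _).1 h).trans (Category.comp_id _)
  act_mul := by
    have h : freeAct M X ▷ (mon M).X ≫ freeAct M X =
      ((α_ (X ⊗ (mon M).X) (mon M).X (mon M).X).hom ≫ (X ⊗ (mon M).X) ◁ mulM M) ≫
        freeAct M X := freeAct_assoc M X
    rw [h, Category.assoc, Iso.inv_hom_id_assoc]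

/-- The morphism of free modules extending `f : X ⟶ Y ⊗ M`. -/
def freeExt {X Y : C} (f : X ⟶ Y ⊗ (mon M).X) : freeMod M X ⟶ freeMod M Y where
  f := f ▷ (mon M).X ≫ freeAct M Y
  comm := by
    change freeAct M X ≫ f ▷ (mon M).X ≫ freeAct M Y =
      (f ▷ (mon M).X ≫ freeAct M Y) ▷ (mon M).X ≫ freeAct M Y
    rw [comp_whiskerRight, Category.assoc, freeAct_assoc, ← Category.assoc (freeAct M X),
      freeAct_nat, Category.assoc]

theorem freeExt_comp {X Y Z : C} (f : X ⟶ Y ⊗ (mon M).X) (g : Y ⟶ Z ⊗ (mon M).X) :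
    freeExt M (f ≫ g ▷ (mon M).X ≫ freeAct M Z) = freeExt M f ≫ freeExt M g :=
  RMod.hom_ext (by
    change (f ≫ g ▷ (mon M).X ≫ freeAct M Z) ▷ (mon M).X ≫ freeAct M Z =
      (f ▷ (mon M).X ≫ freeAct M Y) ≫ g ▷ (mon M).X ≫ freeAct M Z
    rw [comp_whiskerRight, comp_whiskerRight, Category.assoc, Category.assoc, Category.assoc,
      freeAct_assoc, ← Category.assoc (freeAct M Y), freeAct_nat, Category.assoc])

/-- The comparison functor from the Kleisli category of `- ⊗ M` to right `M`-modules. It sends `X`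
to the free module `X ⊗ M` and `f : X ⟶ Y ⊗ M` to `X ⊗ M ⟶ Y ⊗ M ⊗ M ⟶ Y ⊗ M`. -/
def kleisliToRMod : Kleisli (freeMonad M) ⥤ RMod M where
  obj X := freeMod M X.of
  map f := freeExt M f.of
  map_id X := RMod.hom_ext ((freeMonad M).right_unit X.of)
  map_comp f g := freeExt_comp M f.of g.of

end FreeModules

/-! ### The commutative algebra `CoInd(1)` and its local modules -/

section Main

variable {k K H : Type u} [CommRing k] [Ring K] [Ring H] [Bialgebra k K] [HopfAlgebra k H]
  [BijectiveAntipode k H] (ι : K →ₐc[k] H) [FGProjective ι]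

/-- The commutative central monoid `CoInd(1)` in `H`-modules: the image of the unit of the center of
`K`-modules under the functor induced by coinduction. -/
def algA : CommMon (Center (LMod k H)) :=
  (centerFunctor (coIndAdj ι)).mapCommMon.obj (CommMon.trivial (Center (LMod k K)))

/-- The commutative monoid `CoInd(1)` in Yetter-Drinfeld modules over `H`. -/
def algYD : CommMon (YD k H) := (ofCenter k H).mapCommMon.obj (algA ι)

theorem oneM_algYD : (oneM (central (algYD ι))).f = oneM (algA ι) := by
  change 𝟙 (𝟙_ (LMod k H)) ≫ 𝟙 (𝟙_ (LMod k H)) ≫ oneM (algA ι) = _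
  rw [Category.id_comp, Category.id_comp]

theorem mulM_algYD : (mulM (central (algYD ι))).f = mulM (algA ι) := by
  change 𝟙 ((mon (algA ι)).X ⊗ (mon (algA ι)).X) ≫ 𝟙 ((mon (algA ι)).X ⊗ (mon (algA ι)).X) ≫
    mulM (algA ι) = _
  rw [Category.id_comp, Category.id_comp]

/-- The functor from (local) modules over `CoInd(1)` in Yetter-Drinfeld modules to modules in
`H`-modules that forgets coactions. -/
def locToRMod : Loc (algYD ι) ⥤ RMod (algA ι) where
  obj X :=
    { X := X.1.X.X
      act := X.1.act.f
      act_one := by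
        have h : X.1.X.X ◁ (oneM (central (algYD ι))).f ≫ X.1.act.f = (ρ_ X.1.X.X).hom :=
          congrArg YD.Hom.f X.1.act_one
        rw [oneM_algYD] at h
        exact h
      act_mul := by
        have h : X.1.X.X ◁ (mulM (central (algYD ι))).f ≫ X.1.act.f =
            (α_ X.1.X.X _ _).inv ≫ X.1.act.f ▷ (mon (algA ι)).X ≫ X.1.act.f :=
          congrArg YD.Hom.f X.1.act_mul
        rw [mulM_algYD] at h
        exact h }
  map f := ⟨f.hom.f.f, congrArg YD.Hom.f f.hom.comm⟩

end Main

section Main₂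

variable {k K H : Type u} [CommRing k] [Ring K] [Ring H] [HopfAlgebra k K] [HopfAlgebra k H]
  [BijectiveAntipode k K] [BijectiveAntipode k H] (ι : K →ₐc[k] H) [FGProjective ι]

/-- The functor on Yetter-Drinfeld modules induced by coinduction through the identification with
the centers. -/
def zCoInd : YD k K ⥤ YD k H := toCenter k K ⋙ centerFunctor (coIndAdj ι) ⋙ ofCenter k H

instance : (zCoInd ι).LaxBraided :=
  inferInstanceAs (toCenter k K ⋙ centerFunctor (coIndAdj ι) ⋙ ofCenter k H).LaxBraided

end Main₂

end HopfCat

end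

open HopfCat

noncomputable section

namespace HopfCat

/-! ## Modules over the image of the unit under a lax monoidal functor -/

section LaxModule

open Functor.LaxMonoidal

variable {C : Type u₁} [Category.{v₁} C] [MonoidalCategory C]
  {D : Type u₂} [Category.{v₂} D] [MonoidalCategory D]

/-- An identification of a commutative central monoid `M` with the monoid `R(𝟙)` for a lax monoidal
functor `R` such that the right and left actions on all `R(W)` correspond to each other under the
half-braiding of `M`. -/
structure UnitComparison (R : D ⥤ C) [R.LaxMonoidal] (M : CommMon (Center C)) where
  /-- the underlying isomorphism -/
  e : (mon M).X ≅ R.obj (𝟙_ D)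
  one : oneM M ≫ e.hom = ε R
  mul : mulM M ≫ e.hom = e.hom ▷ _ ≫ _ ◁ e.hom ≫ μ R (𝟙_ D) (𝟙_ D) ≫ R.map (λ_ (𝟙_ D)).hom
  comm : ∀ W : D, (swap M (R.obj W)).hom ≫ R.obj W ◁ e.hom ≫ μ R W (𝟙_ D) ≫ R.map (ρ_ W).hom =
    e.hom ▷ R.obj W ≫ μ R (𝟙_ D) W ≫ R.map (λ_ W).hom

/-- The action of `R(𝟙)` on `R(V)` from the right. -/
def unitAct (R : D ⥤ C) [R.LaxMonoidal] (V : D) : R.obj V ⊗ R.obj (𝟙_ D) ⟶ R.obj V :=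
  μ R V (𝟙_ D) ≫ R.map (ρ_ V).hom

/-- The action of `R(𝟙)` on `R(V)` from the left. -/
def unitLact (R : D ⥤ C) [R.LaxMonoidal] (V : D) : R.obj (𝟙_ D) ⊗ R.obj V ⟶ R.obj V :=
  μ R (𝟙_ D) V ≫ R.map (λ_ V).hom

section

variable (R : D ⥤ C) [R.LaxMonoidal]

theorem unitAct_nat {V W : D} (f : V ⟶ W) :
    unitAct R V ≫ R.map f = R.map f ▷ _ ≫ unitAct R W := by
  simp only [unitAct, Category.assoc, μ_natural_left_assoc, ← R.map_comp, rightUnitor_naturality]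

theorem ε_unitAct (V : D) : R.obj V ◁ ε R ≫ unitAct R V = (ρ_ (R.obj V)).hom :=
  (right_unitality R V).symm

/-- The structure morphism `R(V) ⊗ R(W) → R(V ⊗ W)` is balanced. -/
theorem unitAct_μ (V W : D) : unitAct R V ▷ R.obj W ≫ μ R V W =
    (α_ _ _ _).hom ≫ R.obj V ◁ unitLact R W ≫ μ R V W := by
  have h := associativity R V (𝟙_ D) W
  simp only [unitAct, unitLact, comp_whiskerRight, whiskerLeft_comp, Category.assoc,
    μ_natural_left, μ_natural_right]
  rw [← reassoc_of% h, ← R.map_comp, MonoidalCategory.triangle]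

/-- The right action on `R(V ⊗ W)` is induced by that on `R(W)`. -/
theorem μ_unitAct (V W : D) : μ R V W ▷ _ ≫ unitAct R (V ⊗ W) =
    (α_ _ _ _).hom ≫ R.obj V ◁ unitAct R W ≫ μ R V W := by
  have h := associativity R V W (𝟙_ D)
  simp only [unitAct, whiskerLeft_comp, Category.assoc, μ_natural_right]
  rw [← reassoc_of% h, ← R.map_comp, rightUnitor_tensor_hom]

theorem unitAct_unit : unitAct R (𝟙_ D) = unitLact R (𝟙_ D) := by
  rw [unitAct, unitLact, unitors_equal]

theorem unitAct_assoc (V : D) : unitAct R V ▷ _ ≫ unitAct R V =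
    (α_ _ _ _).hom ≫ R.obj V ◁ unitAct R (𝟙_ D) ≫ unitAct R V := by
  rw [unitAct_unit]
  nth_rewrite 2 [unitAct]
  rw [reassoc_of% @unitAct_μ]
  rfl

end

/-- An isomorphism of modules from an isomorphism of the underlying objects. -/
@[simps]
def RMod.isoMk {M : CommMon (Center C)} {X Y : RMod M} (e : X.X ≅ Y.X)
    (w : X.act ≫ e.hom = e.hom ▷ _ ≫ Y.act) : X ≅ Y where
  hom := ⟨e.hom, w⟩
  inv := ⟨e.inv, by
    rw [← cancel_mono e.hom, Category.assoc, Category.assoc, w, ← comp_whiskerRight_assoc,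
      Iso.inv_hom_id, id_whiskerRight, Category.comp_id, Category.id_comp]⟩
  hom_inv_id := RMod.hom_ext e.hom_inv_id
  inv_hom_id := RMod.hom_ext e.inv_hom_id

theorem comp_aux₁ {X₁ X₂ X₃ X₄ X₅ X₆ Y₃ : C} {a : X₁ ⟶ X₂} {b : X₂ ⟶ X₃} {c : X₃ ⟶ X₄}
    {d : X₄ ⟶ X₅} {r : X₅ ⟶ X₆} {c' : X₂ ⟶ Y₃} {b' : Y₃ ⟶ X₄} {m : X₁ ⟶ Y₃} {n : Y₃ ⟶ X₅}
    (h₁ : b ≫ c = c' ≫ b') (h₂ : a ≫ c' = m) (h₃ : b' ≫ d = n) :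
    a ≫ b ≫ c ≫ d ≫ r = m ≫ n ≫ r := by
  rw [reassoc_of% h₁, reassoc_of% h₂, reassoc_of% h₃]

theorem comp_aux₂ {X₁ X₂ X₃ X₄ X₅ X₆ Y₁ Y₂ Y₃ : C} {a : X₁ ⟶ X₂} {b : X₂ ⟶ X₃} {c : X₃ ⟶ X₄}
    {t : X₄ ⟶ X₅} {s : X₅ ⟶ X₆} {α : X₁ ⟶ Y₁} {q : Y₁ ⟶ Y₂} {p : Y₂ ⟶ X₄} {t' : Y₂ ⟶ Y₃}
    {p' : Y₃ ⟶ X₅} {n : Y₁ ⟶ Y₃} {m : Y₃ ⟶ X₆}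
    (h₁ : a ≫ b ≫ c = α ≫ q ≫ p) (h₂ : p ≫ t = t' ≫ p') (h₃ : q ≫ t' = n) (h₄ : p' ≫ s = m) :
    a ≫ b ≫ c ≫ t ≫ s = α ≫ n ≫ m := by
  rw [reassoc_of% h₁, reassoc_of% h₂, reassoc_of% h₃, h₄]

namespace UnitComparison

variable {R : D ⥤ C} [R.LaxMonoidal] {M : CommMon (Center C)} (u : UnitComparison R M)

theorem mul' : mulM M ≫ u.e.hom = u.e.hom ▷ _ ≫ _ ◁ u.e.hom ≫ unitAct R (𝟙_ D) := by
  rw [u.mul, unitAct_unit]; rfl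

/-- The module `R(V)`. -/
abbrev modObj (V : D) : RMod M where
  X := R.obj V
  act := R.obj V ◁ u.e.hom ≫ unitAct R V
  act_one := by
    rw [← whiskerLeft_comp_assoc, u.one, ε_unitAct]
  act_mul := by
    rw [← whiskerLeft_comp_assoc, u.mul']
    simp only [comp_whiskerRight, whiskerLeft_comp, Category.assoc]
    rw [← whisker_exchange_assoc, unitAct_assoc]
    simp

theorem lact_modObj (V : D) : (u.modObj V).lact = u.e.hom ▷ R.obj V ≫ unitLact R V := u.comm V

/-- The functor `V ↦ R(V)` to modules. -/
@[simps]
def modFunctor : D ⥤ RMod M where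
  obj := u.modObj
  map f := ⟨R.map f, by
    change (_ ◁ u.e.hom ≫ unitAct R _) ≫ R.map f = R.map f ▷ _ ≫ _ ◁ u.e.hom ≫ unitAct R _
    rw [Category.assoc, unitAct_nat, whisker_exchange_assoc]⟩
  map_id V := RMod.hom_ext (R.map_id V)
  map_comp f g := RMod.hom_ext (R.map_comp f g)

theorem balanced (V W : D) : (u.modObj V).act ▷ R.obj W ≫ μ R V W =
    (α_ _ _ _).hom ≫ R.obj V ◁ (u.modObj W).lact ≫ μ R V W := by
  rw [lact_modObj]
  change (R.obj V ◁ u.e.hom ≫ unitAct R V) ▷ R.obj W ≫ μ R V W = _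
  rw [comp_whiskerRight, Category.assoc, unitAct_μ]
  simp

variable [HasCoequalizers C] [∀ X : C, PreservesColimitsOfSize.{0, 0} (tensorLeft X)]
  [∀ X : C, PreservesColimitsOfSize.{0, 0} (tensorRight X)]

/-- The unit constraint of `modFunctor`. -/
def unitIso : 𝟙_ (RMod M) ≅ u.modFunctor.obj (𝟙_ D) :=
  RMod.isoMk (X := 𝟙_ (RMod M)) (Y := u.modObj (𝟙_ D)) u.e u.mul'

/-- The morphism `R(V) ⊗_M R(W) → R(V ⊗ W)`. -/
def tensorDesc (V W : D) : (u.modObj V ⊗ u.modObj W).X ⟶ R.obj (V ⊗ W) :=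
  RMod.desc (X := u.modObj V) (Y := u.modObj W) (μ R V W) (u.balanced V W)

theorem proj_tensorDesc (V W : D) :
    RMod.proj (u.modObj V) (u.modObj W) ≫ u.tensorDesc V W = μ R V W := RMod.proj_desc _ _

theorem tensorDesc_comm (V W : D) : (u.modObj V ⊗ u.modObj W).act ≫ u.tensorDesc V W =
    u.tensorDesc V W ▷ (mon M).X ≫ (u.modObj (V ⊗ W)).act := by
  apply (cancel_epi (RMod.proj (u.modObj V) (u.modObj W) ▷ (mon M).X)).1
  rw [← Category.assoc, RMod.proj_act, Category.assoc, Category.assoc, proj_tensorDesc,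
    ← comp_whiskerRight_assoc, proj_tensorDesc]
  simp only [whiskerLeft_comp, Category.assoc]
  rw [← whisker_exchange_assoc, μ_unitAct]
  simp

/-- The tensor constraint of `modFunctor`. -/
def tensorMap (V W : D) :
    u.modFunctor.obj V ⊗ u.modFunctor.obj W ⟶ u.modFunctor.obj (V ⊗ W) :=
  ⟨u.tensorDesc V W, u.tensorDesc_comm V W⟩

/-- The maps `R(V) ⊗_M R(W) → R(V ⊗ W)` are isomorphisms. -/
class IsStrong : Prop where
  isIso : ∀ V W, IsIso (u.tensorDesc V W)

attribute [instance] IsStrong.isIso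

variable [u.IsStrong]

/-- The monoidal structure on `modFunctor`. -/
def core : u.modFunctor.CoreMonoidal where
  εIso := u.unitIso
  μIso V W := RMod.isoMk (X := u.modObj V ⊗ u.modObj W) (Y := u.modObj (V ⊗ W))
    (asIso (u.tensorDesc V W)) (u.tensorDesc_comm V W)
  μIso_hom_natural_left {V V'} f W := RMod.hom_ext <| RMod.desc_ext
    (X := u.modObj V) (Y := u.modObj W) <| by
    change _ ≫ RMod.Hom.f (u.modFunctor.map f ▷ u.modFunctor.obj W) ≫ u.tensorDesc V' W =
      _ ≫ u.tensorDesc V W ≫ R.map (f ▷ W)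
    rw [reassoc_of% @proj_tensorDesc, ← μ_natural_left, ← u.proj_tensorDesc V' W]
    exact (reassoc_of% RMod.proj_whiskerRight (u.modFunctor.map f) (u.modObj W)) (u.tensorDesc V' W)
  μIso_hom_natural_right {V V'} W f := RMod.hom_ext <| RMod.desc_ext
    (X := u.modObj W) (Y := u.modObj V) <| by
    change _ ≫ RMod.Hom.f (u.modFunctor.obj W ◁ u.modFunctor.map f) ≫ u.tensorDesc W V' =
      _ ≫ u.tensorDesc W V ≫ R.map (W ◁ f)
    rw [reassoc_of% @proj_tensorDesc, ← μ_natural_right, ← u.proj_tensorDesc W V']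
    exact (reassoc_of% RMod.proj_whiskerLeft (u.modObj W) (u.modFunctor.map f)) (u.tensorDesc W V')
  associativity X Y Z := RMod.hom_ext <| RMod.desc_ext
    (X := u.modObj X ⊗ u.modObj Y) (Y := u.modObj Z) <|
    (cancel_epi (RMod.proj (u.modObj X) (u.modObj Y) ▷ R.obj Z)).1 <| by
    have h₁ := RMod.proj_whiskerRight (u.tensorMap X Y) (u.modObj Z)
    have h₂ := RMod.proj_whiskerLeft (u.modObj X) (u.tensorMap Y Z)
    have h₃ := RMod.proj_associator (u.modObj X) (u.modObj Y) (u.modObj Z)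
    have h₄ : RMod.proj (u.modObj X) (u.modObj Y) ▷ R.obj Z ≫ u.tensorDesc X Y ▷ R.obj Z = _ :=
      (comp_whiskerRight _ _ _).symm.trans (congrArg (· ▷ R.obj Z) (u.proj_tensorDesc X Y))
    have h₅ : R.obj X ◁ RMod.proj (u.modObj Y) (u.modObj Z) ≫ R.obj X ◁ u.tensorDesc Y Z = _ :=
      (whiskerLeft_comp _ _ _).symm.trans (congrArg (R.obj X ◁ ·) (u.proj_tensorDesc Y Z))
    change _ ≫ _ ≫ RMod.Hom.f (u.tensorMap X Y ▷ u.modObj Z) ≫ u.tensorDesc (X ⊗ Y) Z ≫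
      R.map (α_ X Y Z).hom = _ ≫ _ ≫ RMod.Hom.f (α_ (u.modObj X) (u.modObj Y) (u.modObj Z)).hom ≫
        RMod.Hom.f (u.modObj X ◁ u.tensorMap Y Z) ≫ u.tensorDesc X (Y ⊗ Z)
    exact (comp_aux₁ h₁ h₄ (u.proj_tensorDesc (X ⊗ Y) Z)).trans ((associativity R X Y Z).trans
      (comp_aux₂ h₃ h₂ h₅ (u.proj_tensorDesc X (Y ⊗ Z))).symm)
  left_unitality X := RMod.hom_ext <| RMod.desc_ext (X := 𝟙_ (RMod M)) (Y := u.modObj X) <| by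
    have h := RMod.proj_whiskerRight u.unitIso.hom (u.modObj X)
    change _ ≫ RMod.Hom.f (λ_ (u.modObj X)).hom = _ ≫ RMod.Hom.f (u.unitIso.hom ▷ u.modObj X) ≫
      u.tensorDesc (𝟙_ D) X ≫ R.map (λ_ X).hom
    rw [RMod.proj_leftUnitor, lact_modObj, reassoc_of% h]
    exact congrArg (u.e.hom ▷ R.obj X ≫ ·) ((reassoc_of% u.proj_tensorDesc (𝟙_ D) X) _).symm
  right_unitality X := RMod.hom_ext <| RMod.desc_ext (X := u.modObj X) (Y := 𝟙_ (RMod M)) <| by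
    have h := RMod.proj_whiskerLeft (u.modObj X) u.unitIso.hom
    change _ ≫ RMod.Hom.f (ρ_ (u.modObj X)).hom = _ ≫ RMod.Hom.f (u.modObj X ◁ u.unitIso.hom) ≫
      u.tensorDesc X (𝟙_ D) ≫ R.map (ρ_ X).hom
    rw [RMod.proj_rightUnitor, reassoc_of% h]
    exact congrArg (R.obj X ◁ u.e.hom ≫ ·) ((reassoc_of% u.proj_tensorDesc X (𝟙_ D)) _).symm

instance : u.modFunctor.Monoidal := u.core.toMonoidal

/-- The underlying object of the module `R(V)` is `R(V)`. -/
def forgIso : u.modFunctor ⋙ RMod.forg M ≅ R := NatIso.ofComponents (fun V => Iso.refl (R.obj V))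
  (fun f => (Category.comp_id (R.map f)).trans (Category.id_comp (R.map f)).symm)

instance : NatTrans.IsMonoidal u.forgIso.hom where
  unit := (Category.comp_id _).trans u.one
  tensor V W := (Category.comp_id _).trans ((u.proj_tensorDesc V W).trans (by
    change μ R V W = (𝟙 (R.obj V) ⊗ₘ 𝟙 (R.obj W)) ≫ μ R V W
    rw [id_tensorHom_id, Category.id_comp]))

end UnitComparison

end LaxModule

/-! ## Modules over `R(𝟙)` for the right adjoint `R` of a monoidal functor -/

section AdjModules

open Functor.LaxMonoidal Functor.OplaxMonoidal CenterFunctor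

variable {C : Type u₁} [Category.{v₁} C] [MonoidalCategory C]
  {D : Type u₂} [Category.{v₂} D] [MonoidalCategory D]
  {G : C ⥤ D} {R : D ⥤ C} [G.Monoidal] [R.LaxMonoidal] (adj : G ⊣ R) [adj.IsMonoidal]

/-- The transpose of `freeToR`. -/
def evalR (X : C) : G.obj (X ⊗ R.obj (𝟙_ D)) ⟶ G.obj X := ltr adj X (𝟙_ D) ≫ (ρ_ (G.obj X)).hom

/-- The morphism `X ⊗ R(𝟙) → R(G X)`. -/
def freeToR (X : C) : X ⊗ R.obj (𝟙_ D) ⟶ R.obj (G.obj X) := un adj X ▷ _ ≫ unitAct R (G.obj X)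

theorem freeToR_eq (X : C) : freeToR adj X = lproj adj X (𝟙_ D) ≫ R.map (ρ_ (G.obj X)).hom := by
  simp [freeToR, lproj, unitAct]

theorem un_nat {X Y : C} (f : X ⟶ Y) : un adj X ≫ R.map (G.map f) = f ≫ un adj Y :=
  (adj.unit.naturality f).symm

theorem un_evalR (X : C) : un adj (X ⊗ R.obj (𝟙_ D)) ≫ R.map (evalR adj X) = freeToR adj X := by
  rw [freeToR_eq, ← homEquiv_ltr, Adjunction.homEquiv_apply, Category.assoc, ← R.map_comp, evalR]

/-- Morphisms out of `G X` are determined by their transposes. -/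
theorem un_ext {X : C} {Y : D} {f g : G.obj X ⟶ Y} (h : un adj X ≫ R.map f = un adj X ≫ R.map g) :
    f = g := (adj.homEquiv X Y).injective (by simpa [Adjunction.homEquiv_apply] using h)

theorem freeToR_nat {X Y : C} (f : X ⟶ Y) :
    freeToR adj X ≫ R.map (G.map f) = f ▷ _ ≫ freeToR adj Y := by
  rw [freeToR, freeToR, Category.assoc, unitAct_nat, ← comp_whiskerRight_assoc, un_nat,
    comp_whiskerRight_assoc]

theorem ε_freeToR (X : C) : X ◁ ε R ≫ freeToR adj X = (ρ_ X).hom ≫ un adj X := by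
  rw [freeToR, whisker_exchange_assoc, ε_unitAct, rightUnitor_naturality]

theorem freeToR_unitAct (X : C) : freeToR adj X ▷ _ ≫ unitAct R (G.obj X) =
    (α_ _ _ _).hom ≫ X ◁ unitAct R (𝟙_ D) ≫ freeToR adj X := by
  rw [freeToR, comp_whiskerRight_assoc, unitAct_assoc, whisker_exchange_assoc]
  simp

theorem freeToR_evalR (X : C) : freeToR adj (X ⊗ R.obj (𝟙_ D)) ≫ R.map (evalR adj X) =
    (α_ _ _ _).hom ≫ X ◁ unitAct R (𝟙_ D) ≫ freeToR adj X := by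
  rw [freeToR, Category.assoc, unitAct_nat, ← comp_whiskerRight_assoc, un_evalR, freeToR_unitAct]

theorem freeToR_map {X : C} {V : D} (f : G.obj X ⟶ V) :
    freeToR adj X ≫ R.map f = (un adj X ≫ R.map f) ▷ _ ≫ unitAct R V := by
  rw [freeToR, Category.assoc, unitAct_nat, comp_whiskerRight_assoc]

include adj
theorem faithful_of_essSurj [G.EssSurj] : R.Faithful where
  map_injective {V W f g} h := by
    rw [← cancel_epi (G.objObjPreimageIso V).hom]
    apply un_ext adj
    rw [R.map_comp, R.map_comp, h]

variable [ProjectionFormula adj]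

instance (X : C) : IsIso (freeToR adj X) := by
  rw [freeToR_eq]; infer_instance

/-- `R(𝟙)`-linear morphisms out of `R(G X)` are determined by their restriction to `X`. -/
theorem linear_ext {X : C} {Z : C} {z : Z ⊗ R.obj (𝟙_ D) ⟶ Z} {f g : R.obj (G.obj X) ⟶ Z}
    (hf : unitAct R (G.obj X) ≫ f = f ▷ _ ≫ z) (hg : unitAct R (G.obj X) ≫ g = g ▷ _ ≫ z)
    (h : un adj X ≫ f = un adj X ≫ g) : f = g := by
  rw [← cancel_epi (freeToR adj X), freeToR, Category.assoc, Category.assoc, hf, hg,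
    ← comp_whiskerRight_assoc, h, comp_whiskerRight_assoc]

/-- `R(𝟙)`-linear morphisms `R(V) → R(W)` come from morphisms `V → W`. -/
theorem exists_map_eq [G.EssSurj] {V W : D} (φ : R.obj V ⟶ R.obj W)
    (h : unitAct R V ≫ φ = φ ▷ _ ≫ unitAct R W) : ∃ f : V ⟶ W, R.map f = φ := by
  let i := G.objObjPreimageIso V
  refine ⟨i.inv ≫ (adj.homEquiv _ _).symm (un adj _ ≫ R.map i.hom ≫ φ), ?_⟩
  rw [← cancel_epi (R.map i.hom), ← R.map_comp, Iso.hom_inv_id_assoc]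
  apply linear_ext adj (unitAct_nat R _)
  · rw [reassoc_of% @unitAct_nat, h, comp_whiskerRight_assoc]
  · rw [← Adjunction.homEquiv_unit, Equiv.apply_symm_apply]

/-- The structure morphism `R(V) ⊗ R(W) → R(V ⊗ W)` exhibits its target as the relative tensor
product over `R(𝟙)`. -/
theorem isIso_of_balanced [G.EssSurj] {V W : D} {Q : C} (p : R.obj V ⊗ R.obj W ⟶ Q) [Epi p]
    (hp : unitAct R V ▷ R.obj W ≫ p = (α_ _ _ _).hom ≫ R.obj V ◁ unitLact R W ≫ p)
    (m : Q ⟶ R.obj (V ⊗ W)) (hm : p ≫ m = μ R V W) : IsIso m := by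
  have key : ∀ (X : C) (p : R.obj (G.obj X) ⊗ R.obj W ⟶ Q) [Epi p]
      (_ : unitAct R (G.obj X) ▷ R.obj W ≫ p = (α_ _ _ _).hom ≫ _ ◁ unitLact R W ≫ p)
      (m : Q ⟶ R.obj (G.obj X ⊗ W)) (_ : p ≫ m = μ R (G.obj X) W), IsIso m := by
    intro X p _ hp m hm
    have h₁ : (un adj X ▷ R.obj W ≫ p) ≫ m = lproj adj X W := by rw [Category.assoc, hm, lproj]
    have h₂ : freeToR adj X ▷ R.obj W ≫ p =
        ((α_ _ _ _).hom ≫ X ◁ unitLact R W) ≫ un adj X ▷ R.obj W ≫ p := by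
      rw [freeToR, comp_whiskerRight_assoc, hp, Category.assoc, whisker_exchange_assoc]
      simp
    have : Epi (un adj X ▷ R.obj W ≫ p) := by
      have : Epi (((α_ _ _ _).hom ≫ X ◁ unitLact R W) ≫ un adj X ▷ R.obj W ≫ p) := by
        rw [← h₂]; infer_instance
      exact epi_of_epi ((α_ _ _ _).hom ≫ X ◁ unitLact R W) _
    have : IsSplitMono (un adj X ▷ R.obj W ≫ p) :=
      ⟨⟨⟨m ≫ inv (lproj adj X W), by
        rw [← Category.assoc, h₁, IsIso.hom_inv_id]⟩⟩⟩
    have : IsIso (un adj X ▷ R.obj W ≫ p) := isIso_of_epi_of_isSplitMono _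
    exact IsIso.of_isIso_fac_left h₁
  let i := G.objObjPreimageIso V
  have := key (G.objPreimage V) (R.map i.hom ▷ R.obj W ≫ p) (by
    rw [← comp_whiskerRight_assoc, unitAct_nat, comp_whiskerRight_assoc, hp,
      whisker_exchange_assoc]
    simp) (m ≫ R.map (i.inv ▷ W)) (by
    rw [Category.assoc, reassoc_of% hm, ← μ_natural_left, ← comp_whiskerRight_assoc, ← R.map_comp,
      i.hom_inv_id]
    simp)
  exact IsIso.of_isIso_comp_right m (R.map (i.inv ▷ W))

/-- If `R` preserves coequalizers, every module over `R(𝟙)` is of the form `R(V)`. -/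
theorem exists_linear_iso [HasCoequalizers D] [PreservesColimitsOfShape WalkingParallelPair R]
    {X : C} (x : X ⊗ R.obj (𝟙_ D) ⟶ X) (hε : X ◁ ε R ≫ x = (ρ_ X).hom)
    (hx : x ▷ _ ≫ x = (α_ _ _ _).hom ≫ X ◁ unitAct R (𝟙_ D) ≫ x) :
    ∃ (V : D) (e : X ≅ R.obj V), x ≫ e.hom = e.hom ▷ _ ≫ unitAct R V := by
  let q := coequalizer.π (G.map x) (evalR adj X)
  have hq : G.map x ≫ q = evalR adj X ≫ q := coequalizer.condition _ _
  let t := isColimitCoforkMapOfIsColimit R hq (coequalizerIsCoequalizer (G.map x) (evalR adj X))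
  have hc : R.map (G.map x) ≫ inv (freeToR adj X) ≫ x =
      R.map (evalR adj X) ≫ inv (freeToR adj X) ≫ x := by
    rw [← cancel_epi (freeToR adj (X ⊗ R.obj (𝟙_ D))), reassoc_of% @freeToR_nat, reassoc_of% @freeToR_evalR,
      IsIso.hom_inv_id_assoc, hx]
  let k := (Cofork.IsColimit.desc' t (inv (freeToR adj X) ≫ x) hc).1
  have hk : R.map q ≫ k = inv (freeToR adj X) ≫ x :=
    (Cofork.IsColimit.desc' t (inv (freeToR adj X) ≫ x) hc).2
  have h₁ : x ≫ un adj X ≫ R.map q = freeToR adj X ≫ R.map q := by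
    rw [← reassoc_of% @un_nat, ← R.map_comp, hq, R.map_comp, reassoc_of% @un_evalR]
  refine ⟨_, ⟨un adj X ≫ R.map q, k, ?_, ?_⟩, ?_⟩
  · rw [Category.assoc, hk, ← cancel_epi (ρ_ X).hom, ← reassoc_of% @ε_freeToR, IsIso.hom_inv_id_assoc, hε,
      Category.comp_id]
  · apply Cofork.IsColimit.hom_ext t
    change R.map q ≫ k ≫ un adj X ≫ R.map q = R.map q ≫ 𝟙 _
    rw [reassoc_of% hk, h₁, IsIso.inv_hom_id_assoc, Category.comp_id]
  · rw [← freeToR_map]; exact h₁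

/-! ### The commutative central monoid `R(𝟙)` -/

/-- The commutative central monoid `R(𝟙)`. -/
def unitMon : CommMon (Center C) :=
  (centerFunctor adj).mapCommMon.obj (CommMon.trivial (Center D))

theorem oneM_unitMon : oneM (unitMon adj) = ε R := by
  change ε R ≫ R.map (𝟙 (𝟙_ D)) = _
  rw [R.map_id, Category.comp_id]

theorem mulM_unitMon : mulM (unitMon adj) = unitAct R (𝟙_ D) := by
  rw [unitAct_unit]; rfl

theorem swapIso_unitAct (W : D) :
    (swapIso adj unitHB (R.obj W)).hom ≫ unitAct R W = unitLact R W := by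
  have h := μ_braided adj unitHB W
  rw [unitAct, ← reassoc_of% h, unitLact, ← R.map_comp, unitHB_β]
  simp

/-- The comparison of the monoid `R(𝟙)` with itself. -/
def unitComparison : UnitComparison R (unitMon adj) where
  e := Iso.refl (R.obj (𝟙_ D))
  one := (Category.comp_id _).trans (oneM_unitMon adj)
  mul := by
    refine (Category.comp_id _).trans ?_
    change _ = 𝟙 _ ▷ R.obj (𝟙_ D) ≫ R.obj (𝟙_ D) ◁ 𝟙 (R.obj (𝟙_ D)) ≫ unitLact R (𝟙_ D)
    rw [id_whiskerRight, whiskerLeft_id, Category.id_comp, Category.id_comp, ← unitAct_unit]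
    exact mulM_unitMon adj
  comm W := by
    change (swapIso adj unitHB (R.obj W)).hom ≫ R.obj W ◁ 𝟙 _ ≫ unitAct R W = 𝟙 _ ▷ R.obj W ≫ unitLact R W
    rw [whiskerLeft_id, id_whiskerRight, Category.id_comp, Category.id_comp, swapIso_unitAct]

end AdjModules

section AdjEquiv

open Functor.LaxMonoidal Functor.OplaxMonoidal CenterFunctor

variable {C : Type u₁} [Category.{v₁} C] [MonoidalCategory C]
  {D : Type u₂} [Category.{v₂} D] [MonoidalCategory D]
  {G : C ⥤ D} {R : D ⥤ C} [G.Monoidal] [R.LaxMonoidal] (adj : G ⊣ R) [adj.IsMonoidal]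
  [ProjectionFormula adj] [G.EssSurj]

theorem unitComparison_act (V : D) : ((unitComparison adj).modObj V).act = unitAct R V := by
  change R.obj V ◁ 𝟙 (R.obj (𝟙_ D)) ≫ unitAct R V = _
  rw [whiskerLeft_id, Category.id_comp]

theorem unitComparison_lact (V : D) : ((unitComparison adj).modObj V).lact = unitLact R V := by
  rw [UnitComparison.lact_modObj]
  change 𝟙 (R.obj (𝟙_ D)) ▷ R.obj V ≫ unitLact R V = _
  rw [id_whiskerRight, Category.id_comp]

instance [HasCoequalizers C] [∀ X : C, PreservesColimitsOfSize.{0, 0} (tensorLeft X)]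
    [∀ X : C, PreservesColimitsOfSize.{0, 0} (tensorRight X)] :
    (unitComparison adj).IsStrong where
  isIso V W := by
    have h := RMod.proj_condition ((unitComparison adj).modObj V) ((unitComparison adj).modObj W)
    rw [unitComparison_act, unitComparison_lact] at h
    exact isIso_of_balanced adj _ h _ ((unitComparison adj).proj_tensorDesc V W)

instance : (unitComparison adj).modFunctor.Faithful where
  map_injective w := (faithful_of_essSurj adj).map_injective (congrArg RMod.Hom.f w)

instance : (unitComparison adj).modFunctor.Full where
  map_surjective {V W} φ := by
    have h : ((unitComparison adj).modObj V).act ≫ φ.f =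
      φ.f ▷ _ ≫ ((unitComparison adj).modObj W).act := φ.comm
    rw [unitComparison_act, unitComparison_act] at h
    obtain ⟨f, hf⟩ := exists_map_eq adj φ.f h
    exact ⟨f, RMod.hom_ext hf⟩

instance [HasCoequalizers D] [PreservesColimitsOfShape WalkingParallelPair R] :
    (unitComparison adj).modFunctor.EssSurj where
  mem_essImage X := by
    have h₁ := X.act_one
    have h₂ : X.X ◁ mulM (unitMon adj) ≫ X.act = _ := X.act_mul
    change X.X ◁ oneM (unitMon adj) ≫ X.act = (ρ_ X.X).hom at h₁
    rw [oneM_unitMon] at h₁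
    rw [mulM_unitMon, Iso.eq_inv_comp] at h₂
    obtain ⟨V, e, he⟩ := exists_linear_iso adj X.act h₁ h₂.symm
    exact ⟨V, ⟨(RMod.isoMk (X := X) (Y := (unitComparison adj).modObj V) e
      (by rw [unitComparison_act]; exact he)).symm⟩⟩

instance [HasCoequalizers D] [PreservesColimitsOfShape WalkingParallelPair R] :
    (unitComparison adj).modFunctor.IsEquivalence where

/-! ### The Kleisli category -/

theorem G_map_evalR {X Y : C} (f : X ⟶ Y ⊗ R.obj (𝟙_ D)) :
    un adj X ≫ R.map (G.map f ≫ evalR adj Y) = f ≫ freeToR adj Y := by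
  rw [R.map_comp, reassoc_of% @un_nat, un_evalR]

theorem G_map_one (X : C) : G.map ((ρ_ X).inv ≫ X ◁ ε R) ≫ evalR adj X = 𝟙 (G.obj X) := by
  apply un_ext adj
  rw [G_map_evalR, Category.assoc, ε_freeToR, Iso.inv_hom_id_assoc, R.map_id, Category.comp_id]

theorem freeToR_map_evalR {X Y : C} (f : X ⟶ Y ⊗ R.obj (𝟙_ D)) :
    freeToR adj X ≫ R.map (G.map f ≫ evalR adj Y) =
      f ▷ _ ≫ (α_ _ _ _).hom ≫ Y ◁ unitAct R (𝟙_ D) ≫ freeToR adj Y := by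
  rw [freeToR_map, G_map_evalR, comp_whiskerRight_assoc, freeToR_unitAct]

theorem freeToR_map_evalR' {X Y : C} (f : X ⟶ Y ⊗ R.obj (𝟙_ D)) :
    (f ▷ _ ≫ (α_ _ _ _).hom ≫ Y ◁ unitAct R (𝟙_ D)) ≫ freeToR adj Y =
      freeToR adj X ≫ R.map (G.map f ≫ evalR adj Y) := by
  simp only [Category.assoc, freeToR_map_evalR]

theorem G_map_comp {X Y Z : C} (f : X ⟶ Y ⊗ R.obj (𝟙_ D)) (g : Y ⟶ Z ⊗ R.obj (𝟙_ D)) :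
    (G.map f ≫ evalR adj Y) ≫ G.map g ≫ evalR adj Z =
      G.map (f ≫ g ▷ _ ≫ (α_ _ _ _).hom ≫ Z ◁ unitAct R (𝟙_ D)) ≫ evalR adj Z := by
  apply un_ext adj
  rw [R.map_comp, ← Category.assoc, G_map_evalR, G_map_evalR, Category.assoc, freeToR_map_evalR]
  simp only [Category.assoc]

/-- The functor `X ↦ G X` on the Kleisli category. -/
def kleisliFunctor : Kleisli (freeMonad (unitMon adj)) ⥤ D where
  obj X := G.obj X.of
  map {X Y} f := G.map (Y := Y.of ⊗ R.obj (𝟙_ D)) f.of ≫ evalR adj Y.of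
  map_id X := by
    change G.map ((ρ_ X.of).inv ≫ X.of ◁ oneM (unitMon adj)) ≫ evalR adj X.of = 𝟙 _
    rw [oneM_unitMon]
    exact G_map_one adj X.of
  map_comp {X Y Z} f g := by
    have h := G_map_comp adj (Y := Y.of) (Z := Z.of) f.of g.of
    rw [← mulM_unitMon adj] at h
    exact h.symm

instance : (kleisliFunctor adj).Faithful where
  map_injective {X Y f g} w := Kleisli.hom_ext <| (cancel_mono (freeToR adj Y.of)).1 <|
    (G_map_evalR adj f.of).symm.trans
      ((congrArg (fun t => un adj X.of ≫ R.map t) w).trans (G_map_evalR adj g.of))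

theorem exists_G_map_eq {X Y : C} (φ : G.obj X ⟶ G.obj Y) :
    ∃ f : X ⟶ Y ⊗ R.obj (𝟙_ D), G.map f ≫ evalR adj Y = φ :=
  ⟨(un adj X ≫ R.map φ) ≫ inv (freeToR adj Y), un_ext adj <| by
    rw [G_map_evalR, Category.assoc, IsIso.inv_hom_id, Category.comp_id]⟩

instance : (kleisliFunctor adj).Full where
  map_surjective {X Y} φ := by
    obtain ⟨f, hf⟩ := exists_G_map_eq adj (X := X.of) (Y := Y.of) φ
    exact ⟨⟨f⟩, hf⟩

instance : (kleisliFunctor adj).EssSurj where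
  mem_essImage V := ⟨Kleisli.mk _ (G.objPreimage V), ⟨G.objObjPreimageIso V⟩⟩

instance : (kleisliFunctor adj).IsEquivalence where

theorem kleisliFunctor_free {X Y : C} (f : X ⟶ Y) :
    (kleisliFunctor adj).map ((KleisliMonoidal.free _).map f) = G.map f := by
  have h := G_map_one adj Y
  rw [← oneM_unitMon adj] at h
  refine (congrArg (· ≫ evalR adj Y) (G.map_comp f ((ρ_ Y).inv ≫ Y ◁ oneM (unitMon adj)))).trans ?_
  exact (Category.assoc _ _ _).trans ((congrArg (G.map f ≫ ·) h).trans (Category.comp_id _))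

theorem un_swap_freeToR (X : C) : R.obj (𝟙_ D) ◁ un adj X ≫ unitLact R (G.obj X) =
    (swapIso adj unitHB X).hom ≫ freeToR adj X := by
  rw [freeToR, ← swapIso_unitAct adj]
  exact swap_nat_assoc (unitMon adj) (un adj X) (unitAct R (G.obj X))

theorem unitLact_unitAct (V : D) : R.obj (𝟙_ D) ◁ unitAct R V ≫ unitLact R V =
    (α_ _ _ _).inv ≫ unitLact R V ▷ _ ≫ unitAct R V := by
  have h := μ_unitAct R (𝟙_ D) V
  rw [unitLact, Iso.eq_inv_comp, comp_whiskerRight_assoc, ← unitAct_nat, reassoc_of% h]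

theorem lact_freeToR (X : C) : R.obj (𝟙_ D) ◁ freeToR adj X ≫ unitLact R (G.obj X) =
    (α_ _ _ _).inv ≫ (swapIso adj unitHB X).hom ▷ _ ≫ (α_ _ _ _).hom ≫
      X ◁ unitAct R (𝟙_ D) ≫ freeToR adj X := by
  rw [← freeToR_unitAct, ← comp_whiskerRight_assoc, ← un_swap_freeToR, freeToR, whiskerLeft_comp,
    Category.assoc, unitLact_unitAct]
  simp

theorem freeToR_tensor (X Y : C) : freeToR adj (X ⊗ Y) ≫ R.map (δ G X Y) =
    (α_ _ _ _).hom ≫ X ◁ freeToR adj Y ≫ un adj X ▷ _ ≫ μ R (G.obj X) (G.obj Y) := by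
  have h := adj.unit_app_tensor_comp_map_δ X Y
  rw [freeToR_map]
  refine (congrArg (fun t => t ▷ R.obj (𝟙_ D) ≫ _) h).trans ?_
  rw [comp_whiskerRight_assoc, μ_unitAct, freeToR, MonoidalCategory.tensorHom_def']
  simp only [comp_whiskerRight, whiskerLeft_comp, Category.assoc]
  rw [whisker_exchange_assoc]
  simp

/-- The multiplication `(X ⊗ R(𝟙)) ⊗ (Y ⊗ R(𝟙)) → (X ⊗ Y) ⊗ R(𝟙)`. -/
def mergeR (X Y : C) :
    (X ⊗ R.obj (𝟙_ D)) ⊗ (Y ⊗ R.obj (𝟙_ D)) ⟶ (X ⊗ Y) ⊗ R.obj (𝟙_ D) :=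
  (α_ X (R.obj (𝟙_ D)) (Y ⊗ R.obj (𝟙_ D))).hom ≫
    X ◁ ((α_ _ Y _).inv ≫ (swapIso adj unitHB Y).hom ▷ R.obj (𝟙_ D) ≫
      (α_ Y _ _).hom ≫ Y ◁ unitAct R (𝟙_ D)) ≫ (α_ X Y _).inv

theorem freeMu_unitMon (X Y : C) : freeMu (unitMon adj) X Y = mergeR adj X Y :=
  congrArg (fun t : R.obj (𝟙_ D) ⊗ R.obj (𝟙_ D) ⟶ R.obj (𝟙_ D) =>
    (α_ X (R.obj (𝟙_ D)) (Y ⊗ R.obj (𝟙_ D))).hom ≫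
      X ◁ ((α_ _ Y _).inv ≫ (swapIso adj unitHB Y).hom ▷ R.obj (𝟙_ D) ≫
        (α_ Y _ _).hom ≫ Y ◁ t) ≫ (α_ X Y _).inv) (mulM_unitMon adj)

theorem freeToR_μ (X Y : C) : (freeToR adj X ⊗ₘ freeToR adj Y) ≫ μ R (G.obj X) (G.obj Y) =
    mergeR adj X Y ≫ freeToR adj (X ⊗ Y) ≫ R.map (δ G X Y) := by
  have h := lact_freeToR adj Y
  rw [mergeR, freeToR_tensor, MonoidalCategory.tensorHom_def', Category.assoc]
  nth_rewrite 2 [freeToR]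
  rw [comp_whiskerRight_assoc, unitAct_μ]
  simp only [Category.assoc, Iso.inv_hom_id_assoc]
  rw [← whiskerLeft_comp_assoc]
  simp only [Category.assoc]
  rw [← h]
  simp [whisker_exchange_assoc]

theorem δ_kleisli {X X' Y Y' : C} (f : X ⟶ X' ⊗ R.obj (𝟙_ D)) (g : Y ⟶ Y' ⊗ R.obj (𝟙_ D)) :
    δ G X Y ≫ ((G.map f ≫ evalR adj X') ⊗ₘ (G.map g ≫ evalR adj Y')) =
      (G.map ((f ⊗ₘ g) ≫ mergeR adj X' Y') ≫ evalR adj (X' ⊗ Y')) ≫ δ G X' Y' := by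
  apply un_ext adj
  have h := adj.unit_app_tensor_comp_map_δ X Y
  have h' := G_map_evalR adj ((f ⊗ₘ g) ≫ mergeR adj X' Y')
  have hf := G_map_evalR adj f
  have hg := G_map_evalR adj g
  rw [R.map_comp, R.map_comp (G.map _ ≫ _) (δ G X' Y'), reassoc_of% h', ← freeToR_μ,
    tensorHom_comp_tensorHom_assoc, ← hf, ← hg, ← tensorHom_comp_tensorHom_assoc, μ_natural]
  rw [← Category.assoc, ← Category.assoc]
  exact congrArg (· ≫ _) h

theorem μ_kleisli {X X' Y Y' : C} (f : X ⟶ X' ⊗ R.obj (𝟙_ D)) (g : Y ⟶ Y' ⊗ R.obj (𝟙_ D)) :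
    ((G.map f ≫ evalR adj X') ⊗ₘ (G.map g ≫ evalR adj Y')) ≫ Functor.LaxMonoidal.μ G X' Y' =
      Functor.LaxMonoidal.μ G X Y ≫ G.map ((f ⊗ₘ g) ≫ mergeR adj X' Y') ≫ evalR adj (X' ⊗ Y') := by
  have h := δ_kleisli adj f g
  rw [← cancel_epi (δ G X Y), reassoc_of% h, Functor.Monoidal.δ_μ, Functor.Monoidal.δ_μ_assoc,
    Category.comp_id]

theorem kleisli_tensorHom {X X' Y Y' : Kleisli (freeMonad (unitMon adj))} (f : X ⟶ X')
    (g : Y ⟶ Y') :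
    ((kleisliFunctor adj).map f ⊗ₘ (kleisliFunctor adj).map g) ≫
      (Functor.Monoidal.μIso G X'.of Y'.of).hom =
    (Functor.Monoidal.μIso G X.of Y.of).hom ≫ (kleisliFunctor adj).map (f ⊗ₘ g) :=
  (μ_kleisli adj (X' := X'.of) (Y' := Y'.of) f.of g.of).trans
    (congrArg (fun t => Functor.LaxMonoidal.μ G X.of Y.of ≫ G.map ((f.of ⊗ₘ g.of) ≫ t) ≫
      evalR adj (X'.of ⊗ Y'.of)) (freeMu_unitMon adj X'.of Y'.of).symm)

/-- The monoidal structure on the functor from the Kleisli category. -/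
def kleisliCore : (kleisliFunctor adj).CoreMonoidal where
  εIso := Functor.Monoidal.εIso G
  μIso X Y := Functor.Monoidal.μIso G X.of Y.of
  μIso_hom_natural_left {X Y} f Z := (congrArg (· ≫ Functor.LaxMonoidal.μ G Y.of Z.of)
    ((tensorHom_id _ _).symm.trans
      (congrArg (_ ⊗ₘ ·) ((kleisliFunctor adj).map_id Z).symm))).trans
        (kleisli_tensorHom adj f (𝟙 Z))
  μIso_hom_natural_right {X Y} Z f := (congrArg (· ≫ Functor.LaxMonoidal.μ G Z.of Y.of)
    ((id_tensorHom _ _).symm.trans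
      (congrArg (· ⊗ₘ _) ((kleisliFunctor adj).map_id Z).symm))).trans
        (kleisli_tensorHom adj (𝟙 Z) f)
  associativity X Y Z :=
    (congrArg (fun t => _ ≫ _ ≫ t) (kleisliFunctor_free adj (α_ X.of Y.of Z.of).hom)).trans
      (Functor.LaxMonoidal.associativity G X.of Y.of Z.of)
  left_unitality X := (Functor.LaxMonoidal.left_unitality G X.of).trans
    (congrArg (fun t => _ ≫ _ ≫ t) (kleisliFunctor_free adj (λ_ X.of).hom)).symm
  right_unitality X := (Functor.LaxMonoidal.right_unitality G X.of).trans
    (congrArg (fun t => _ ≫ _ ≫ t) (kleisliFunctor_free adj (ρ_ X.of).hom)).symm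

instance : (kleisliFunctor adj).Monoidal := (kleisliCore adj).toMonoidal

/-- The restriction of `kleisliFunctor` to free objects is the given functor. -/
def freeKleisliIso : KleisliMonoidal.free (freeMonad (unitMon adj)) ⋙ kleisliFunctor adj ≅ G :=
  NatIso.ofComponents (fun X => Iso.refl (G.obj X)) (fun f =>
    (Category.comp_id _).trans ((kleisliFunctor_free adj f).trans (Category.id_comp _).symm))

instance : NatTrans.IsMonoidal (freeKleisliIso adj).hom where
  unit := (Category.comp_id _).trans ((congrArg (Functor.LaxMonoidal.ε G ≫ ·)
    ((kleisliFunctor adj).map_id (Kleisli.mk _ (𝟙_ C)))).trans (Category.comp_id _))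
  tensor X Y := (Category.comp_id _).trans (((congrArg (Functor.LaxMonoidal.μ G X Y ≫ ·)
    ((kleisliFunctor adj).map_id (Kleisli.mk _ (X ⊗ Y)))).trans (Category.comp_id _)).trans (by
      change Functor.LaxMonoidal.μ G X Y = (𝟙 (G.obj X) ⊗ₘ 𝟙 (G.obj Y)) ≫ Functor.LaxMonoidal.μ G X Y
      rw [id_tensorHom_id, Category.id_comp]))

theorem freeAct_unitMon (X : C) : freeAct (unitMon adj) X =
    (α_ X (R.obj (𝟙_ D)) (R.obj (𝟙_ D))).hom ≫ X ◁ unitAct R (𝟙_ D) :=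
  congrArg (fun t : R.obj (𝟙_ D) ⊗ R.obj (𝟙_ D) ⟶ R.obj (𝟙_ D) => (α_ X _ _).hom ≫ X ◁ t)
    (mulM_unitMon adj)

/-- The composite of the two equivalences is the comparison functor. -/
def kleisliCompIso :
    kleisliFunctor adj ⋙ (unitComparison adj).modFunctor ≅ kleisliToRMod (unitMon adj) :=
  (NatIso.ofComponents (F := kleisliToRMod (unitMon adj))
    (G := kleisliFunctor adj ⋙ (unitComparison adj).modFunctor)
    (fun X => RMod.isoMk (X := freeMod (unitMon adj) X.of)
      (Y := (unitComparison adj).modObj (G.obj X.of))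
      (asIso (X := X.of ⊗ R.obj (𝟙_ D)) (freeToR adj X.of))
      ((congrArg (· ≫ freeToR adj X.of) (freeAct_unitMon adj X.of)).trans
        (((Category.assoc _ _ _).trans (freeToR_unitAct adj X.of).symm).trans
          (congrArg (freeToR adj X.of ▷ _ ≫ ·) (unitComparison_act adj (G.obj X.of)).symm))))
    (fun {X Y} f => RMod.hom_ext ((congrArg (fun t => (f.of ▷ R.obj (𝟙_ D) ≫ t) ≫
      freeToR adj Y.of) (freeAct_unitMon adj Y.of)).trans (freeToR_map_evalR' adj
      (Y := Y.of) f.of)))).symm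

end AdjEquiv

/-! ## Half-braidings on `V` and on `R(V)` -/

section AdjCenter

open Functor.LaxMonoidal Functor.OplaxMonoidal CenterFunctor

variable {C : Type u₁} [Category.{v₁} C] [MonoidalCategory C]
  {D : Type u₂} [Category.{v₂} D] [MonoidalCategory D]
  {G : C ⥤ D} {R : D ⥤ C} [G.Monoidal] [R.LaxMonoidal] (adj : G ⊣ R) [adj.IsMonoidal]

theorem rproj_nat_left {X Y : D} (f : X ⟶ Y) (A : C) :
    R.map f ▷ A ≫ rproj adj Y A = rproj adj X A ≫ R.map (f ▷ G.obj A) := by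
  rw [rproj, rproj, Category.assoc, ← μ_natural_left, whisker_exchange_assoc]

theorem rproj_nat_right (X : D) {A B : C} (f : A ⟶ B) :
    R.obj X ◁ f ≫ rproj adj X B = rproj adj X A ≫ R.map (X ◁ G.map f) := by
  rw [rproj, rproj, Category.assoc, ← μ_natural_right, ← whiskerLeft_comp_assoc,
    ← whiskerLeft_comp_assoc, un_nat]

theorem lproj_nat_left {A B : C} (f : A ⟶ B) (X : D) :
    f ▷ R.obj X ≫ lproj adj B X = lproj adj A X ≫ R.map (G.map f ▷ X) := by
  rw [lproj, lproj, Category.assoc, ← μ_natural_left, ← comp_whiskerRight_assoc,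
    ← comp_whiskerRight_assoc, un_nat]

theorem lproj_nat_right (A : C) {X Y : D} (f : X ⟶ Y) :
    A ◁ R.map f ≫ lproj adj A Y = lproj adj A X ≫ R.map (G.obj A ◁ f) := by
  rw [lproj, lproj, Category.assoc, ← μ_natural_right, whisker_exchange_assoc]

theorem lproj_unitAct (A : C) (V : D) : lproj adj A V ▷ _ ≫ unitAct R (G.obj A ⊗ V) =
    (α_ _ _ _).hom ≫ A ◁ unitAct R V ≫ lproj adj A V := by
  rw [lproj, comp_whiskerRight_assoc, μ_unitAct, whisker_exchange_assoc]
  simp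

variable [ProjectionFormula adj]

theorem swapIso_lproj {X : D} (c : HalfBraiding X) (A : C) :
    (swapIso adj c A).hom ≫ lproj adj A X = rproj adj X A ≫ R.map (c.β (G.obj A)).hom := by
  simp [swapIso]

variable [G.EssSurj]

theorem rproj_unitAct (V : D) (A : C) : rproj adj V A ▷ _ ≫ unitAct R (V ⊗ G.obj A) =
    (α_ _ _ _).hom ≫ R.obj V ◁ (swapIso adj unitHB A).inv ≫ (α_ _ _ _).inv ≫
      unitAct R V ▷ A ≫ rproj adj V A := by
  have h := un_swap_freeToR adj A
  rw [← Iso.inv_comp_eq] at h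
  rw [rproj, comp_whiskerRight_assoc, μ_unitAct, associator_naturality_middle_assoc,
    ← whiskerLeft_comp_assoc, ← freeToR, ← h, ← whisker_exchange_assoc, unitAct_μ]
  simp

instance (V : D) (A : C) : Epi (rtr adj V A) where
  left_cancellation {Z} x y h := by
    have := faithful_of_essSurj adj
    apply R.map_injective
    rw [← cancel_epi (rproj adj V A), ← homEquiv_rtr, ← Adjunction.homEquiv_naturality_right,
      ← Adjunction.homEquiv_naturality_right, h]

/-- A morphism `f` is compatible with half-braidings if `R(f)` is compatible with the induced
ones. -/
theorem comm_of_map_comm {X Y : D} {c : HalfBraiding X} {d : HalfBraiding Y} (f : X ⟶ Y)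
    (w : ∀ A, R.map f ▷ A ≫ (swapIso adj d A).hom = (swapIso adj c A).hom ≫ A ◁ R.map f) (U : D) :
    f ▷ U ≫ (d.β U).hom = (c.β U).hom ≫ U ◁ f := by
  have := faithful_of_essSurj adj
  have key (A : C) : f ▷ G.obj A ≫ (d.β (G.obj A)).hom = (c.β (G.obj A)).hom ≫ G.obj A ◁ f := by
    apply R.map_injective
    rw [← cancel_epi (rproj adj X A), R.map_comp, R.map_comp, ← reassoc_of% @rproj_nat_left,
      ← swapIso_lproj, ← reassoc_of% @swapIso_lproj, reassoc_of% w A, lproj_nat_right]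
  let i := G.objObjPreimageIso U
  rw [← cancel_epi (X ◁ i.hom), whisker_exchange_assoc, d.naturality, reassoc_of% key,
    c.naturality_assoc, whisker_exchange]

include adj in
/-- `R(𝟙)`-linear isomorphisms `R(V) ≅ R(W)` come from isomorphisms `V ≅ W`. -/
theorem exists_mapIso_eq {V W : D} (φ : R.obj V ≅ R.obj W)
    (h : unitAct R V ≫ φ.hom = φ.hom ▷ _ ≫ unitAct R W) : ∃ f : V ≅ W, R.map f.hom = φ.hom := by
  have := faithful_of_essSurj adj
  obtain ⟨f, hf⟩ := exists_map_eq adj φ.hom h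
  obtain ⟨g, hg⟩ := exists_map_eq adj φ.inv (by
    rw [← cancel_mono φ.hom, Category.assoc, Category.assoc, h]; simp)
  exact ⟨⟨f, g, R.map_injective (by simp [hf, hg]), R.map_injective (by simp [hf, hg])⟩, hf⟩

section

variable {V : D} (c : HalfBraiding (R.obj V))

theorem exists_halfBraiding_obj (A : C)
    (h : unitAct R V ▷ A ≫ (c.β A).hom = ((α_ _ _ _).hom ≫ R.obj V ◁ (swapIso adj unitHB A).hom ≫
      (α_ _ _ _).inv ≫ (c.β A).hom ▷ _ ≫ (α_ _ _ _).hom) ≫ A ◁ unitAct R V) :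
    ∃ d : V ⊗ G.obj A ≅ G.obj A ⊗ V,
      rproj adj V A ≫ R.map d.hom = (c.β A).hom ≫ lproj adj A V := by
  obtain ⟨d, hd⟩ := exists_mapIso_eq adj
    ((asIso (rproj adj V A)).symm ≪≫ c.β A ≪≫ asIso (lproj adj A V)) (by
      rw [← cancel_epi (rproj adj V A ▷ R.obj (𝟙_ D)), reassoc_of% @rproj_unitAct]
      simp only [Iso.trans_hom, Iso.symm_hom, asIso_inv, asIso_hom, IsIso.hom_inv_id_assoc,
        comp_whiskerRight, Category.assoc, lproj_unitAct]
      rw [reassoc_of% h]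
      simp)
  exact ⟨d, by rw [hd]; simp⟩

variable {c} (d : ∀ A, V ⊗ G.obj A ≅ G.obj A ⊗ V)
  (hd : ∀ A, rproj adj V A ≫ R.map (d A).hom = (c.β A).hom ≫ lproj adj A V)

include hd

theorem map_ltr_of_rproj (A : C) :
    G.map (c.β A).hom ≫ ltr adj A V = rtr adj V A ≫ (d A).hom := by
  apply (adj.homEquiv _ _).injective
  rw [homEquiv_map_ltr, Adjunction.homEquiv_naturality_right, homEquiv_rtr, hd]

theorem naturality_of_rproj {A B : C} (f : A ⟶ B) :
    V ◁ G.map f ≫ (d B).hom = (d A).hom ≫ G.map f ▷ V := by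
  have := faithful_of_essSurj adj
  apply R.map_injective
  rw [← cancel_epi (rproj adj V A), R.map_comp, R.map_comp, ← reassoc_of% @rproj_nat_right, hd,
    reassoc_of% hd, c.naturality_assoc, lproj_nat_left]

theorem monoidal_of_rproj (A B : C) : (d (A ⊗ B)).hom ≫ δ G A B ▷ V =
    V ◁ δ G A B ≫ (α_ _ _ _).inv ≫ (d A).hom ▷ G.obj B ≫ (α_ _ _ _).hom ≫
      G.obj A ◁ (d B).hom ≫ (α_ _ _ _).inv := by
  have hl := map_ltr_of_rproj adj d hd
  have h₁ := ltr_tensor adj A B V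
  have h₂ := rtr_tensor adj A B V
  have h₃ := ltr_rtr adj A B V
  rw [← cancel_epi (rtr adj V (A ⊗ B)), ← cancel_mono (α_ _ _ _).hom]
  simp only [Category.assoc, Iso.inv_hom_id, Category.comp_id]
  rw [← reassoc_of% hl, h₁, reassoc_of% h₂, ← comp_whiskerRight_assoc, ← hl, comp_whiskerRight_assoc,
    δ_natural_left_assoc, reassoc_of% h₃, ← whiskerLeft_comp, ← hl, whiskerLeft_comp,
    δ_natural_right_assoc, c.monoidal]
  simp only [← G.map_comp_assoc, Category.assoc, Iso.inv_hom_id, Category.comp_id]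

variable (hl : (c.β (R.obj (𝟙_ D))).hom ≫ unitLact R V = unitAct R V)

include hl

theorem cu_of_rproj : (d (R.obj (𝟙_ D))).hom ≫ cu adj (𝟙_ D) ▷ V ≫ (λ_ V).hom =
    V ◁ cu adj (𝟙_ D) ≫ (ρ_ V).hom := by
  have h := map_ltr_of_rproj adj d hd (R.obj (𝟙_ D))
  rw [← cancel_epi (rtr adj V (R.obj (𝟙_ D))), ← reassoc_of% h, reassoc_of% @ltr_cu,
    reassoc_of% @rtr_cu, ← cu_μ, ← cu_μ, Category.assoc, Category.assoc, ← cu_nat, ← cu_nat,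
    ← G.map_comp_assoc, ← G.map_comp_assoc, ← G.map_comp_assoc, Category.assoc]
  exact congrArg (fun t => G.map t ≫ cu adj V) hl

theorem evalR_of_rproj (A : C) :
    V ◁ evalR adj A ≫ (d A).hom = (d (A ⊗ R.obj (𝟙_ D))).hom ≫ evalR adj A ▷ V := by
  have h := monoidal_of_rproj adj d hd A (R.obj (𝟙_ D))
  have h' := cu_of_rproj adj d hd hl
  have e : evalR adj A ▷ V = δ G A (R.obj (𝟙_ D)) ▷ V ≫ (α_ _ _ _).hom ≫
      G.obj A ◁ (cu adj (𝟙_ D) ▷ V ≫ (λ_ V).hom) := by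
    rw [evalR, ltr, Category.assoc, comp_whiskerRight, comp_whiskerRight, whisker_assoc,
      ← MonoidalCategory.triangle]
    simp only [Category.assoc, Iso.inv_hom_id_assoc, whiskerLeft_comp]
  rw [e, reassoc_of% h, Iso.inv_hom_id_assoc, ← whiskerLeft_comp, h']
  simp only [evalR, ltr, whiskerLeft_comp, Category.assoc]
  rw [← associator_naturality_right_assoc, ← whisker_exchange_assoc, ← rightUnitor_tensor_hom,
    rightUnitor_naturality, rightUnitor_tensor_hom]
  simp only [Category.assoc, ← associator_inv_naturality_right_assoc, Iso.inv_hom_id_assoc]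

theorem naturality_all_of_rproj {A B : C} (g : G.obj A ⟶ G.obj B) :
    V ◁ g ≫ (d B).hom = (d A).hom ≫ g ▷ V := by
  obtain ⟨f, rfl⟩ := exists_G_map_eq adj g
  rw [whiskerLeft_comp_assoc, evalR_of_rproj adj d hd hl, ← Category.assoc,
    naturality_of_rproj adj d hd, Category.assoc, comp_whiskerRight]

omit hd hl in
/-- The components of the half-braiding on `V` determined by those on the objects `G A`. -/
def swapOfRproj (U : D) : V ⊗ U ≅ U ⊗ V :=
  whiskerLeftIso V (G.objObjPreimageIso U).symm ≪≫ d (G.objPreimage U) ≪≫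
    whiskerRightIso (G.objObjPreimageIso U) V

theorem swapOfRproj_nat {A : C} {U : D} (j : G.obj A ⟶ U) :
    V ◁ j ≫ (swapOfRproj d U).hom = (d A).hom ≫ j ▷ V := by
  have h := naturality_all_of_rproj adj d hd hl (j ≫ (G.objObjPreimageIso U).inv)
  simp only [swapOfRproj, Iso.trans_hom, whiskerLeftIso_hom, Iso.symm_hom, whiskerRightIso_hom]
  rw [← whiskerLeft_comp_assoc, reassoc_of% h]
  simp

/-- The half-braiding on `V` determined by its components on the objects `G A`. -/
def halfBraidingOfRproj : HalfBraiding V where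
  β U := swapOfRproj d U
  naturality {U U'} f := by
    have h {A : C} {U : D} (j : G.obj A ⟶ U) := swapOfRproj_nat adj d hd hl j
    rw [← cancel_epi (V ◁ (G.objObjPreimageIso U).hom), ← whiskerLeft_comp_assoc, h,
      reassoc_of% h, comp_whiskerRight]
  monoidal U U' := by
    have h {A : C} {U : D} (j : G.obj A ⟶ U) := swapOfRproj_nat adj d hd hl j
    have hm := monoidal_of_rproj adj d hd (G.objPreimage U) (G.objPreimage U')
    let i := G.objObjPreimageIso U
    let i' := G.objObjPreimageIso U'
    rw [← cancel_epi (V ◁ (δ G (G.objPreimage U) (G.objPreimage U') ≫ i.hom ▷ _ ≫ U ◁ i'.hom)), h]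
    simp only [comp_whiskerRight, whiskerLeft_comp, Category.assoc]
    rw [reassoc_of% hm, associator_inv_naturality_right_assoc, whisker_exchange_assoc,
      associator_inv_naturality_middle_assoc, ← comp_whiskerRight_assoc, h,
      comp_whiskerRight_assoc, associator_naturality_right_assoc, ← whiskerLeft_comp_assoc, h]
    simp only [whiskerLeft_comp, Category.assoc, associator_naturality_left_assoc]
    rw [← whisker_exchange_assoc]
    simp

theorem swapIso_halfBraidingOfRproj (A : C) :
    (swapIso adj (halfBraidingOfRproj adj d hd hl) A).hom = (c.β A).hom := by
  have h := swapOfRproj_nat adj d hd hl (𝟙 (G.obj A))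
  rw [whiskerLeft_id, id_whiskerRight, Category.id_comp, Category.comp_id] at h
  rw [← cancel_mono (lproj adj A V), swapIso_lproj, ← hd]
  exact congrArg (fun t => rproj adj V A ≫ R.map t) h

end

/-- A half-braiding on `R(V)` for which the action of `R(𝟙)` is a local morphism of half-braidings
is induced by a half-braiding on `V`. -/
theorem exists_halfBraiding {V : D} (c : HalfBraiding (R.obj V))
    (h : ∀ A, unitAct R V ▷ A ≫ (c.β A).hom =
      ((α_ _ _ _).hom ≫ R.obj V ◁ (swapIso adj unitHB A).hom ≫
        (α_ _ _ _).inv ≫ (c.β A).hom ▷ _ ≫ (α_ _ _ _).hom) ≫ A ◁ unitAct R V)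
    (hl : (c.β (R.obj (𝟙_ D))).hom ≫ unitLact R V = unitAct R V) :
    ∃ d : HalfBraiding V, ∀ A, (swapIso adj d A).hom = (c.β A).hom := by
  choose d hd using fun A => exists_halfBraiding_obj adj c A (h A)
  exact ⟨halfBraidingOfRproj adj d hd hl, swapIso_halfBraidingOfRproj adj d hd hl⟩

/-- Transport of a half-braiding along an isomorphism. -/
def transportHB {X Y : C} (c : HalfBraiding X) (e : X ≅ Y) : HalfBraiding Y where
  β U := whiskerRightIso e.symm U ≪≫ c.β U ≪≫ whiskerLeftIso U e
  naturality f := by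
    simp only [Iso.trans_hom, whiskerRightIso_hom, whiskerLeftIso_hom, Iso.symm_hom,
      Category.assoc]
    rw [whisker_exchange_assoc, c.naturality_assoc, whisker_exchange]

/-- A half-braiding on an object `X` isomorphic to `R(V)` for which the corresponding action of
`R(𝟙)` is a local morphism of half-braidings is induced by a half-braiding on `V`. -/
theorem exists_halfBraiding_of_iso {V : D} {X : C} (i : R.obj V ≅ X) (c : HalfBraiding X)
    (x : X ⊗ R.obj (𝟙_ D) ⟶ X) (hi : unitAct R V ≫ i.hom = i.hom ▷ _ ≫ x)
    (h : ∀ A, x ▷ A ≫ (c.β A).hom =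
      ((α_ _ _ _).hom ≫ X ◁ (swapIso adj unitHB A).hom ≫
        (α_ _ _ _).inv ≫ (c.β A).hom ▷ _ ≫ (α_ _ _ _).hom) ≫ A ◁ x)
    (hl : (c.β (R.obj (𝟙_ D))).hom ≫ (swapIso adj unitHB X).hom ≫ x = x) :
    ∃ d : HalfBraiding V, ∀ A,
      i.hom ▷ A ≫ (c.β A).hom = (swapIso adj d A).hom ≫ A ◁ i.hom := by
  have hi' : i.inv ▷ R.obj (𝟙_ D) ≫ unitAct R V = x ≫ i.inv := by
    rw [← cancel_mono i.hom, Category.assoc, hi]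
    simp
  obtain ⟨d, hd⟩ := exists_halfBraiding adj (transportHB c i.symm)
    (fun A => by
      rw [← cancel_mono (A ◁ i.hom), Category.assoc _ (A ◁ _) (A ◁ _), ← whiskerLeft_comp, hi]
      simp only [transportHB, Iso.trans_hom, whiskerRightIso_hom, whiskerLeftIso_hom, Iso.symm_hom,
        Iso.symm_inv, Category.assoc, whiskerLeft_inv_hom, Category.comp_id]
      rw [← comp_whiskerRight_assoc, hi, comp_whiskerRight_assoc, h]
      simp only [comp_whiskerRight, whiskerLeft_comp, Category.assoc,
        associator_naturality_left_assoc]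
      rw [← whisker_exchange_assoc]
      simp)
    (by
      have hs := (CenterFunctor.halfBraiding adj unitHB).naturality i.inv
      change _ ◁ i.inv ≫ (swapIso adj unitHB (R.obj V)).hom = (swapIso adj unitHB X).hom ≫ _ at hs
      rw [← swapIso_unitAct adj]
      simp only [transportHB, Iso.trans_hom, whiskerRightIso_hom, whiskerLeftIso_hom, Iso.symm_hom,
        Iso.symm_inv, Category.assoc]
      rw [reassoc_of% hs, hi', reassoc_of% hl, ← hi']
      simp)
  exact ⟨d, fun A => by rw [hd]; simp [transportHB]⟩

end AdjCenter

/-! ## Local modules over the image of the unit under a braided lax monoidal functor -/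

section LocalFunctor

open Functor.LaxMonoidal

variable {C : Type u₁} [Category.{v₁} C] [MonoidalCategory C] [BraidedCategory C]
  {D : Type u₂} [Category.{v₂} D] [MonoidalCategory D] [BraidedCategory D]
  {R : D ⥤ C} [R.LaxBraided]

theorem braiding_unitLact (V : D) :
    (β_ (R.obj V) (R.obj (𝟙_ D))).hom ≫ unitLact R V = unitAct R V := by
  have h := Functor.LaxBraided.braided (F := R) V (𝟙_ D)
  rw [unitLact, ← reassoc_of% h, unitAct, ← R.map_comp, braiding_leftUnitor]

theorem braiding_unitAct (V : D) :
    (β_ (R.obj (𝟙_ D)) (R.obj V)).hom ≫ unitAct R V = unitLact R V := by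
  have h := Functor.LaxBraided.braided (F := R) (𝟙_ D) V
  rw [unitAct, ← reassoc_of% h, unitLact, ← R.map_comp, braiding_rightUnitor]

/-- A comparison of a commutative monoid with `R(𝟙)` for a braided lax monoidal functor `R`. -/
def UnitComparison.ofBraided {N : CommMon C} (e : car N ≅ R.obj (𝟙_ D))
    (one : oneM (central N) ≫ e.hom = ε R)
    (mul : mulM (central N) ≫ e.hom = e.hom ▷ _ ≫ _ ◁ e.hom ≫ unitLact R (𝟙_ D)) :
    UnitComparison R (central N) where
  e := e
  one := one
  mul := mul
  comm W := by
    rw [swap_central, ← unitLact, ← unitAct, ← BraidedCategory.braiding_naturality_left_assoc,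
      braiding_unitAct]

namespace UnitComparison

variable {N : CommMon C} (u : UnitComparison R (central N))

theorem isLocal_modObj (V : D) : isLocal N (u.modObj V) := by
  change (β_ (R.obj V) (car N)).hom ≫ (u.modObj V).lact = R.obj V ◁ u.e.hom ≫ unitAct R V
  rw [lact_modObj, ← BraidedCategory.braiding_naturality_right_assoc, braiding_unitLact]

variable [HasCoequalizers C] [∀ X : C, PreservesColimitsOfSize.{0, 0} (tensorLeft X)]
  [∀ X : C, PreservesColimitsOfSize.{0, 0} (tensorRight X)]

/-- The functor `V ↦ R(V)` to local modules. -/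
def locFunctor : D ⥤ Loc N := (isLocal N).lift u.modFunctor u.isLocal_modObj

variable [u.IsStrong]

/-- The monoidal structure on `locFunctor`. -/
def locCore : u.locFunctor.CoreMonoidal where
  εIso := (isLocal N).isoMk u.core.εIso
  μIso V W := (isLocal N).isoMk (u.core.μIso V W)
  μIso_hom_natural_left f W := ObjectProperty.hom_ext _ (u.core.μIso_hom_natural_left f W)
  μIso_hom_natural_right W f := ObjectProperty.hom_ext _ (u.core.μIso_hom_natural_right W f)
  associativity X Y Z := ObjectProperty.hom_ext _ (u.core.associativity X Y Z)
  left_unitality X := ObjectProperty.hom_ext _ (u.core.left_unitality X)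
  right_unitality X := ObjectProperty.hom_ext _ (u.core.right_unitality X)

instance : u.locFunctor.Monoidal := u.locCore.toMonoidal

instance : u.locFunctor.Braided where
  braided V W := ObjectProperty.hom_ext _ <| RMod.hom_ext <| RMod.desc_ext
    (X := u.modObj V) (Y := u.modObj W) <| by
    have h := Functor.LaxBraided.braided (F := R) V W
    change _ ≫ u.tensorDesc V W ≫ R.map (β_ V W).hom =
      _ ≫ RMod.locHom (u.isLocal_modObj V) (u.modObj W) ≫ u.tensorDesc W V
    rw [reassoc_of% @proj_tensorDesc, h, ← u.proj_tensorDesc W V]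
    exact (RMod.proj_locHom_assoc (u.isLocal_modObj V) (u.modObj W) (u.tensorDesc W V)).symm

/-- The underlying object of the local module `R(V)` is `R(V)`. -/
def locForgIso : u.locFunctor ⋙ Loc.forg N ≅ R := NatIso.ofComponents (fun V => Iso.refl (R.obj V))
  (fun f => (Category.comp_id (R.map f)).trans (Category.id_comp (R.map f)).symm)

instance : NatTrans.IsMonoidal u.locForgIso.hom where
  unit := (Category.comp_id _).trans ((congrArg (· ≫ u.e.hom)
    (Category.comp_id (oneM (central N)))).trans u.one)
  tensor V W := (Category.comp_id _).trans ((congrArg (· ≫ u.tensorDesc V W)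
    (Category.comp_id (RMod.proj (u.modObj V) (u.modObj W)))).trans
      ((u.proj_tensorDesc V W).trans (by
        change μ R V W = (𝟙 (R.obj V) ⊗ₘ 𝟙 (R.obj W)) ≫ μ R V W
        rw [id_tensorHom_id, Category.id_comp])))

end UnitComparison

end LocalFunctor

/-! ## Coinduction along a split morphism of Hopf algebras -/

section Split

variable {k K H : Type u} [CommRing k] [Ring K] [Ring H] [Bialgebra k K] [Bialgebra k H]
  (ι : K →ₐc[k] H) (π : H →ₐ[k] K)

/-- Restriction of modules along an algebra morphism. -/
def resAlg : LMod k K ⥤ LMod k H where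
  obj X := ⟨X.V, X.ρ.comp π⟩
  map f := ⟨f.f, fun x => f.comm (π x)⟩

variable {ι π} (hπ : ∀ x : K, π (ι x) = x)

/-- Restriction along a section followed by restriction is the identity. -/
def resAlgIso : resAlg (k := k) π ⋙ res ι ≅ 𝟭 (LMod k K) :=
  NatIso.ofComponents (fun X => LMod.isoMk (Iso.refl X.V) (fun x y =>
    congrArg (fun t => X.ρ t y) (hπ x)))
    (fun f => LMod.hom_ext ((Category.comp_id f.f).trans (Category.id_comp f.f).symm))

include hπ in
theorem res_essSurj : (res ι).EssSurj := ⟨fun V => ⟨(resAlg π).obj V, ⟨(resAlgIso hπ).app V⟩⟩⟩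

instance : PreservesColimitsOfSize.{0, 0} (resAlg (k := k) π) :=
  have : PreservesColimitsOfSize.{0, 0} (resAlg (k := k) π ⋙ LMod.forgetV k H) :=
    inferInstanceAs (PreservesColimitsOfSize.{0, 0} (LMod.forgetV k K))
  preservesColimits_of_reflects_of_preserves (resAlg (k := k) π) (LMod.forgetV k H)

end Split

section SplitHopf

variable {k K H : Type u} [Field k] [Ring K] [Ring H] [HopfAlgebra k K]
    [HopfAlgebra k H] [BijectiveAntipode k K] [BijectiveAntipode k H] {ι : K →ₐc[k] H}
    [FGProjective ι] {π : H →ₐ[k] K} (hπ : ∀ x : K, π (ι x) = x)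

/-- Coinduction is isomorphic to `V ↦ V ⊗ CoInd(1)` with `V` regarded as an `H`-module along `π`. -/
def coIndTensorIso : resAlg (k := k) π ⋙ tensorRight ((coInd ι).obj (𝟙_ (LMod k K))) ≅ coInd ι :=
  NatIso.ofComponents (fun V => asIso (freeToR (coIndAdj ι) ((resAlg π).obj V)) ≪≫
    (coInd ι).mapIso ((resAlgIso hπ).app V)) (fun {V W} f => by
      have h := freeToR_nat (coIndAdj ι) ((resAlg π).map f)
      have h' := (resAlgIso hπ).hom.naturality f
      change _ ▷ _ ≫ freeToR (coIndAdj ι) _ ≫ (coInd ι).map _ =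
        (freeToR (coIndAdj ι) _ ≫ (coInd ι).map _) ≫ _
      rw [← reassoc_of% h, Category.assoc, ← Functor.map_comp, ← Functor.map_comp]
      exact congrArg (fun t => freeToR (coIndAdj ι) ((resAlg π).obj V) ≫ (coInd ι).map t) h')

include hπ in
theorem coInd_preservesCoequalizers : PreservesColimitsOfShape WalkingParallelPair (coInd ι) :=
  preservesColimitsOfShape_of_natIso (coIndTensorIso hπ)

end SplitHopf

/-! ## Yetter-Drinfeld modules and local modules -/

section YDComparison

open Functor.LaxMonoidal CenterFunctor

variable {k K H : Type u} [CommRing k] [Ring K] [Ring H] [HopfAlgebra k K] [HopfAlgebra k H]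
  [BijectiveAntipode k K] [BijectiveAntipode k H] (ι : K →ₐc[k] H) [FGProjective ι]

theorem zCoInd_ε_f : (ε (zCoInd ι)).f = ε (coInd ι) := by
  change 𝟙 (𝟙_ (LMod k H)) ≫ ε (coInd ι) ≫ (coInd ι).map (𝟙 (𝟙_ (LMod k K))) = _
  rw [CategoryTheory.Functor.map_id, Category.id_comp, Category.comp_id]

theorem zCoInd_μ_f (V W : YD k K) : (μ (zCoInd ι) V W).f = μ (coInd ι) V.X W.X := by
  change 𝟙 ((coInd ι).obj V.X ⊗ (coInd ι).obj W.X) ≫ μ (coInd ι) V.X W.X ≫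
    (coInd ι).map (𝟙 (V.X ⊗ W.X)) = _
  rw [CategoryTheory.Functor.map_id, Category.id_comp, Category.comp_id]

theorem zCoInd_unitAct_f (V : YD k K) : (unitAct (zCoInd ι) V).f = unitAct (coInd ι) V.X := by
  change (μ (zCoInd ι) V (𝟙_ (YD k K))).f ≫ (coInd ι).map (ρ_ V.X).hom = _
  rw [zCoInd_μ_f]; rfl

theorem zCoInd_unitLact_f (V : YD k K) : (unitLact (zCoInd ι) V).f = unitLact (coInd ι) V.X := by
  change (μ (zCoInd ι) (𝟙_ (YD k K)) V).f ≫ (coInd ι).map (λ_ V.X).hom = _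
  rw [zCoInd_μ_f]; rfl

/-- The identification of the algebra `CoInd(1)` with the image of the unit. -/
def algYDIso : car (algYD ι) ≅ (zCoInd ι).obj (𝟙_ (YD k K)) :=
  YD.isoMk (Iso.refl ((coInd ι).obj (𝟙_ (LMod k K)))) (by
    have h := ((ofCenter k H).map ((centerFunctor (coIndAdj ι)).map (ε (toCenter k K)))).comm
    have e : ((ofCenter k H).map ((centerFunctor (coIndAdj ι)).map (ε (toCenter k K)))).f =
      𝟙 ((coInd ι).obj (𝟙_ (LMod k K))) := (coInd ι).map_id (𝟙_ (LMod k K))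
    rw [e] at h
    exact h)

/-- The comparison of the algebra `CoInd(1)` in Yetter-Drinfeld modules with the image of the
unit. -/
def ydComparison : UnitComparison (zCoInd ι) (central (algYD ι)) :=
  UnitComparison.ofBraided (algYDIso ι)
    (YD.hom_ext (by
      have h : (oneM (central (algYD ι))).f = ε (coInd ι) :=
        (oneM_algYD ι).trans (oneM_unitMon (coIndAdj ι))
      refine (Category.comp_id _).trans (h.trans (zCoInd_ε_f ι).symm)))
    (YD.hom_ext (by
      have h : (mulM (central (algYD ι))).f = unitLact (coInd ι) (𝟙_ (LMod k K)) :=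
        (mulM_algYD ι).trans ((mulM_unitMon (coIndAdj ι)).trans (unitAct_unit _))
      refine (Category.comp_id _).trans (h.trans ?_)
      change _ = 𝟙 ((coInd ι).obj (𝟙_ (LMod k K))) ▷ (coInd ι).obj (𝟙_ (LMod k K)) ≫
        (coInd ι).obj (𝟙_ (LMod k K)) ◁ 𝟙 ((coInd ι).obj (𝟙_ (LMod k K))) ≫
          (unitLact (zCoInd ι) (𝟙_ (YD k K))).f
      rw [zCoInd_unitLact_f, id_whiskerRight, whiskerLeft_id, Category.id_comp]
      exact (Category.id_comp _).symm))

theorem ydComparison_act (V : YD k K) :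
    ((ydComparison ι).modObj V).act.f = unitAct (coInd ι) V.X := by
  change (coInd ι).obj V.X ◁ 𝟙 ((coInd ι).obj (𝟙_ (LMod k K))) ≫ (unitAct (zCoInd ι) V).f = _
  rw [zCoInd_unitAct_f, whiskerLeft_id]
  exact Category.id_comp _

theorem ydComparison_lact (V : YD k K) :
    ((ydComparison ι).modObj V).lact.f = unitLact (coInd ι) V.X := by
  rw [UnitComparison.lact_modObj]
  change 𝟙 ((coInd ι).obj (𝟙_ (LMod k K))) ▷ (coInd ι).obj V.X ≫ (unitLact (zCoInd ι) V).f = _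
  rw [zCoInd_unitLact_f, id_whiskerRight]
  exact Category.id_comp _

variable [(res ι).EssSurj]

instance : (ydComparison ι).IsStrong where
  isIso V W := by
    have h := congrArg YD.Hom.f
      (RMod.proj_condition ((ydComparison ι).modObj V) ((ydComparison ι).modObj W))
    have hm := congrArg YD.Hom.f ((ydComparison ι).proj_tensorDesc V W)
    rw [zCoInd_μ_f] at hm
    let p : (coInd ι).obj V.X ⊗ (coInd ι).obj W.X ⟶
        ((ydComparison ι).modObj V ⊗ (ydComparison ι).modObj W).X.X :=
      (RMod.proj ((ydComparison ι).modObj V) ((ydComparison ι).modObj W)).f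
    have : Epi p := inferInstanceAs (Epi ((YD.forgetCo k H).map
        (RMod.proj ((ydComparison ι).modObj V) ((ydComparison ι).modObj W))))
    have h' : unitAct (coInd ι) V.X ▷ (coInd ι).obj W.X ≫ p =
        (α_ _ _ _).hom ≫ (coInd ι).obj V.X ◁ unitLact (coInd ι) W.X ≫ p := by
      rw [← ydComparison_act, ← ydComparison_lact]; exact h
    have : IsIso ((YD.forgetCo k H).map ((ydComparison ι).tensorDesc V W)) :=
      isIso_of_balanced (coIndAdj ι) p h' _ hm
    exact isIso_of_reflects_iso ((ydComparison ι).tensorDesc V W) (YD.forgetCo k H)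

instance : (ydComparison ι).locFunctor.Faithful where
  map_injective w := YD.hom_ext ((faithful_of_essSurj (coIndAdj ι)).map_injective
    (congrArg (fun t => t.hom.f.f) w))

instance : (ydComparison ι).locFunctor.Full where
  map_surjective {V W} φ := by
    have h := congrArg YD.Hom.f φ.hom.comm
    change ((ydComparison ι).modObj V).act.f ≫ φ.hom.f.f =
      φ.hom.f.f ▷ _ ≫ ((ydComparison ι).modObj W).act.f at h
    rw [ydComparison_act, ydComparison_act] at h
    obtain ⟨f, hf⟩ := exists_map_eq (coIndAdj ι) φ.hom.f.f h
    obtain ⟨ψ, hψ⟩ := (ofCenter k H).map_surjective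
      (X := (centerFunctor (coIndAdj ι)).obj ((toCenter k K).obj V))
      (Y := (centerFunctor (coIndAdj ι)).obj ((toCenter k K).obj W)) φ.hom.f
    have hψ' : ψ.f = (coInd ι).map f := (congrArg YD.Hom.f hψ).trans hf.symm
    let g : (toCenter k K).obj V ⟶ (toCenter k K).obj W :=
      ⟨f, comm_of_map_comm (coIndAdj ι) f (fun A => by rw [← hψ']; exact ψ.comm A)⟩
    obtain ⟨t, ht⟩ := (toCenter k K).map_surjective g
    exact ⟨t, ObjectProperty.hom_ext _ (RMod.hom_ext (YD.hom_ext
      ((congrArg (fun s => (coInd ι).map (Center.Hom.f s)) ht).trans hf)))⟩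

/-- The half-braiding of the image of an object of the center under `ofCenter`. -/
theorem ydHB_ofCenter (X : Center (LMod k H)) (U : LMod k H) :
    ((ydHB ((ofCenter k H).obj X)).β U).hom = (X.2.β U).hom :=
  LMod.hom_ext (ModuleCat.hom_ext (LinearMap.ext fun z => (hb_apply X.2 U z).symm))

theorem ydHB_tensor (P Q : YD k H) (A : LMod k H) : ((ydHB (P ⊗ Q)).β A).hom =
    (α_ _ _ _).hom ≫ P.X ◁ ((ydHB Q).β A).hom ≫ (α_ _ _ _).inv ≫
      ((ydHB P).β A).hom ▷ Q.X ≫ (α_ _ _ _).hom := by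
  have h : 𝟙 (P.X ⊗ Q.X) ▷ A ≫ ((ydHB (P ⊗ Q)).β A).hom =
    ((tensorHB (ydHB P) (ydHB Q)).β A).hom ≫ A ◁ 𝟙 (P.X ⊗ Q.X) := (YD.tensorIso P Q).hom.comm A
  rw [id_whiskerRight, whiskerLeft_id, Category.id_comp, Category.comp_id, tensorHB_β] at h
  exact h

theorem ydHB_algYD (A : LMod k H) : ((ydHB (car (algYD ι))).β A).hom =
    (swapIso (coIndAdj ι) unitHB A).hom := 
  ydHB_ofCenter ((centerFunctor (coIndAdj ι)).obj (𝟙_ (Center (LMod k K)))) A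

theorem act_comm (X : RMod (central (algYD ι))) (A : LMod k H) :
    X.act.f ▷ A ≫ ((ydHB X.X).β A).hom =
      ((α_ _ _ _).hom ≫ X.X.X ◁ (swapIso (coIndAdj ι) unitHB A).hom ≫ (α_ _ _ _).inv ≫
        ((ydHB X.X).β A).hom ▷ (coInd ι).obj (𝟙_ (LMod k K)) ≫ (α_ _ _ _).hom) ≫ A ◁ X.act.f := by
  have h := ((toCenter k H).map X.act).comm A
  change X.act.f ▷ A ≫ ((ydHB X.X).β A).hom =
    ((ydHB (X.X ⊗ car (algYD ι))).β A).hom ≫ A ◁ X.act.f at h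
  rw [ydHB_tensor, ydHB_algYD] at h
  exact h

theorem act_local {X : RMod (central (algYD ι))} (hX : isLocal (algYD ι) X) :
    ((ydHB X.X).β ((coInd ι).obj (𝟙_ (LMod k K)))).hom ≫
      (swapIso (coIndAdj ι) unitHB X.X.X).hom ≫ X.act.f = X.act.f := by
  have h : ((ydHB X.X).β ((coInd ι).obj (𝟙_ (LMod k K)))).hom ≫
    ((ydHB (car (algYD ι))).β X.X.X).hom ≫ X.act.f = X.act.f := congrArg YD.Hom.f hX
  rw [ydHB_algYD] at h
  exact h

theorem swapIso_ydHB_ofCenter {V : LMod k K} (d : HalfBraiding V) (A : LMod k H) :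
    (swapIso (coIndAdj ι) (ydHB ((ofCenter k K).obj ⟨V, d⟩)) A).hom =
      (swapIso (coIndAdj ι) d A).hom := by
  have h := swapIso_lproj (coIndAdj ι) (ydHB ((ofCenter k K).obj ⟨V, d⟩)) A
  exact (cancel_mono (lproj (coIndAdj ι) A V)).1 (h.trans
    ((congrArg (fun t => rproj (coIndAdj ι) V A ≫ (coInd ι).map t)
      (ydHB_ofCenter ⟨V, d⟩ ((res ι).obj A))).trans (swapIso_lproj (coIndAdj ι) d A).symm))

/-- A local module whose underlying module is isomorphic to `CoInd(V)` is isomorphic to the image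
of a Yetter-Drinfeld module with underlying module `V`. -/
theorem exists_loc_iso (X : Loc (algYD ι)) {V : LMod k K} (i : (coInd ι).obj V ≅ X.1.X.X)
    (hi : unitAct (coInd ι) V ≫ i.hom = i.hom ▷ _ ≫ X.1.act.f) :
    ∃ W : YD k K, Nonempty ((ydComparison ι).locFunctor.obj W ≅ X) := by
  obtain ⟨d, hd⟩ := exists_halfBraiding_of_iso (coIndAdj ι) i (ydHB X.1.X) X.1.act.f hi
    (act_comm ι X.1) (act_local ι X.2)
  let W := (ofCenter k K).obj ⟨V, d⟩
  let g : (centerFunctor (coIndAdj ι)).obj ((toCenter k K).obj W) ⟶ (toCenter k H).obj X.1.X :=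
    ⟨i.hom, fun A => by
      have h : (swapIso (coIndAdj ι) (ydHB W) A).hom = _ := swapIso_ydHB_ofCenter ι d A
      change i.hom ▷ A ≫ ((ydHB X.1.X).β A).hom = (swapIso (coIndAdj ι) (ydHB W) A).hom ≫ A ◁ i.hom
      exact (hd A).trans (congrArg (· ≫ A ◁ i.hom) h.symm)⟩
  refine ⟨W, ⟨(isLocal (algYD ι)).isoMk (RMod.isoMk (X := (ydComparison ι).modObj W) (Y := X.1)
    (YD.isoMk i fun v => ?_) (YD.hom_ext ?_))⟩⟩
  · have h := coac_map g v
    change coac (ydHB X.1.X) _ = _ at h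
    rw [coac_ydHB] at h
    exact h
  · exact (congrArg (· ≫ i.hom) (ydComparison_act ι W)).trans hi

instance [PreservesColimitsOfShape WalkingParallelPair (coInd ι)] :
    (ydComparison ι).locFunctor.EssSurj where
  mem_essImage X := by
    obtain ⟨V, ⟨e⟩⟩ := Functor.EssSurj.mem_essImage (F := (unitComparison (coIndAdj ι)).modFunctor)
      ((locToRMod ι).obj X)
    refine exists_loc_iso ι X ((RMod.forg _).mapIso e) ?_
    have h := e.hom.comm
    change ((unitComparison (coIndAdj ι)).modObj V).act ≫ _ = _ at h
    rw [unitComparison_act] at h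
    exact h

instance [PreservesColimitsOfShape WalkingParallelPair (coInd ι)] :
    (ydComparison ι).locFunctor.IsEquivalence where

/-- The right module underlying the local module of a Yetter-Drinfeld module. -/
def locToRModIso : (ydComparison ι).locFunctor ⋙ locToRMod ι ≅
    YD.forgetCo k K ⋙ (unitComparison (coIndAdj ι)).modFunctor :=
  NatIso.ofComponents (fun V => RMod.isoMk
      (X := (locToRMod ι).obj ((ydComparison ι).locFunctor.obj V))
      (Y := (unitComparison (coIndAdj ι)).modObj V.X) (Iso.refl ((coInd ι).obj V.X))
      ((Category.comp_id _).trans ((ydComparison_act ι V).trans (by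
        rw [unitComparison_act]
        change _ = 𝟙 ((coInd ι).obj V.X) ▷ (coInd ι).obj (𝟙_ (LMod k K)) ≫ _
        rw [id_whiskerRight, Category.id_comp]))))
    (fun f => RMod.hom_ext ((Category.comp_id ((coInd ι).map f.f)).trans
      (Category.id_comp ((coInd ι).map f.f)).symm))

end YDComparison

end HopfCat

end

theorem mainTheorem10 {k K H : Type u} [Field k] [Ring K] [Ring H] [HopfAlgebra k K]
    [HopfAlgebra k H] [BijectiveAntipode k K] [BijectiveAntipode k H] (ι : K →ₐc[k] H)
    [FGProjective ι] (π : H →ₐ[k] K) (hπ : ∀ x : K, π (ι x) = x) :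
    (toCenter k K).IsEquivalence ∧
    ∃ (P : Kleisli (freeMonad (algA ι)) ≌ LMod k K) (_ : P.functor.Monoidal)
      (E : LMod k K ≌ RMod (algA ι)) (_ : E.functor.Monoidal)
      (Φ : YD k K ≌ Loc (algYD ι)) (_ : Φ.functor.Braided)
      (ζ : KleisliMonoidal.free (freeMonad (algA ι)) ⋙ P.functor ≅ res ι)
      (θ : E.functor ⋙ RMod.forg (algA ι) ≅ coInd ι)
      (Λ : Φ.functor ⋙ locToRMod ι ≅ YD.forgetCo k K ⋙ E.functor)
      (Ξ : Φ.functor ⋙ Loc.forg (algYD ι) ≅ zCoInd ι),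
      NatTrans.IsMonoidal ζ.hom ∧
      Nonempty (P.functor ⋙ E.functor ≅ kleisliToRMod (algA ι)) ∧
      NatTrans.IsMonoidal θ.hom ∧
      NatTrans.IsMonoidal Ξ.hom ∧
      ∀ V : YD k K,
        (RMod.forg (algA ι)).map (Λ.hom.app V) ≫ θ.hom.app V.X = (Ξ.hom.app V).f := by
  have : (res ι).EssSurj := res_essSurj hπ
  have := coInd_preservesCoequalizers hπ
  have hP : (kleisliFunctor (coIndAdj ι)).IsEquivalence := inferInstance
  have hE : (unitComparison (coIndAdj ι)).modFunctor.IsEquivalence := inferInstance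
  have hΦ : (ydComparison ι).locFunctor.IsEquivalence := inferInstance
  refine ⟨(centerEquiv k K).isEquivalence_functor,
    (kleisliFunctor (coIndAdj ι)).asEquivalence,
    (inferInstance : (kleisliFunctor (coIndAdj ι)).Monoidal),
    (unitComparison (coIndAdj ι)).modFunctor.asEquivalence,
    (inferInstance : (unitComparison (coIndAdj ι)).modFunctor.Monoidal),
    (ydComparison ι).locFunctor.asEquivalence,
    (inferInstance : (ydComparison ι).locFunctor.Braided),
    freeKleisliIso (coIndAdj ι), (unitComparison (coIndAdj ι)).forgIso, locToRModIso ι,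
    (ydComparison ι).locForgIso, ?_, ⟨kleisliCompIso (coIndAdj ι)⟩, ?_, ?_, fun V => ?_⟩
  · exact inferInstanceAs (NatTrans.IsMonoidal (freeKleisliIso (coIndAdj ι)).hom)
  · exact inferInstanceAs (NatTrans.IsMonoidal (unitComparison (coIndAdj ι)).forgIso.hom)
  · exact inferInstanceAs (NatTrans.IsMonoidal (ydComparison ι).locForgIso.hom)
  · exact Category.id_comp (𝟙 ((coInd ι).obj V.X))
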